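/- Let $n_1,n_2\ge 0$ be integers and $n=n_1+n_2+1$. Write $\mathbb{S}^{2m+1}\subset\mathbb{C}^{m+1}$ for the unit sphere with the standard Hermitian product $(\cdot,\cdot)$, and $\mathbb{H}_1^{2m+1}=\{z\in\mathbb{C}^{m+1} : (z,z)=-1\}$ for the anti-de Sitter space, where $(z,w)=\sum_{i=1}^{m}z_i\bar w_i-z_{m+1}\bar w_{m+1}$. In both cases $\langle\cdot,\cdot\rangle=\mathrm{Re}(\cdot,\cdot)$ and $|v|^2=\langle v,v\rangle$ for vectors tangent to the space. A smooth map $\phi$ into one of these spaces is called horizontal if $\phi^*\Lambda=0$, where $\Lambda_z(v)=\langle v,iz\rangle$; a Legendrian immersion is a horizontal immersion of an $m$-dimensional manifold. If the manifold is oriented, its Legendrian angle $\beta_\phi$ (mod $2\pi$) is defined by $e^{i\beta_\phi(p)}=\det_{\mathbb{C}}\{\phi(p),\phi_*e_1,\dots,\phi_*e_m\}$ for an oriented frame $e_1,\dots,e_m$ of the tangent space at $p$ that is orthonormal for the induced metric (for $m=0$: the determinant times the sign of the orientation at $p$). A Legendre curve $\alpha=(\alpha_1,\alpha_2):I\to\mathbb{H}_1^3\subset\mathbb{C}^2$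 is a regular smooth curve on an open interval $I$ with $\alpha^*\Lambda=0$; its Legendre angle is given by $e^{i\beta_\alpha}=(\alpha_1\alpha_2'-\alpha_2\alpha_1')/|\alpha'|$. (1) Let $\psi_1:N_1\to\mathbb{S}^{2n_1+1}$ and $\psi_2:N_2\to\mathbb{H}_1^{2n_2+1}$ be Legendrian isometric immersions of oriented Riemannian manifolds $(N_i,g_{N_i})$ of dimension $n_i$, and let $\alpha:I\to\mathbb{H}_1^3$ be a Legendre curve. Then $\phi(s,p,q)=(\alpha_1(s)\psi_1(p),\alpha_2(s)\psi_2(q))$ is a smooth horizontal map $\phi:I\times N_1\times N_2\to\mathbb{H}_1^{2n+1}\subset\mathbb{C}^{n_1+1}\times\mathbb{C}^{n_2+1}$ with $$\phi^*\langle\cdot,\cdot\rangle=|\alpha'|^2ds^2+|\alpha_1|^2g_{N_1}+|\alpha_2|^2g_{N_2},$$ and at every point $(s,p,q)$ with $\alpha_1(s)\ne0$ (at every point, if $n_1=0$) it is an immersion, hence a Legendrian immersion there, with Legendrian angle, for the product orientation of $I\times N_1\times N_2$, $$\beta_\phi(s,p,q)\equiv n_1\pi+\beta_\alpha(s)+n_1\arg\alpha_1(s)+n_2\arg\alpha_2(s)+\beta_{\psi_1}(p)+\beta_{\psi_2}(q)\pmod{2\pi}.$$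 (2) Let $n_1,n_2\ge2$, and let $G=SO(n_1+1)\times SO_0^1(n_2+1)$, where $SO_0^1(n_2+1)$ is the identity component of the indefinite special orthogonal group of signature $(n_2,1)$, act on $\mathbb{C}^{n+1}=\mathbb{C}^{n_1+1}\times\mathbb{C}^{n_2+1}$ by block diagonal matrices. Let $\mathbb{RH}^{n_2}=\{y\in\mathbb{R}^{n_2+1}:\sum_{i=1}^{n_2}y_i^2-y_{n_2+1}^2=-1,\ y_{n_2+1}>0\}$. Let $\phi:M^n\to\mathbb{H}_1^{2n+1}$ be a Legendrian immersion of a (Hausdorff, second countable) manifold. Call $\phi$ locally invariant if for every $p\in M$ and every neighbourhood $U$ of $p$ one has $g\,\phi(p)\in\phi(U)$ for all $g\in G$ close enough to the identity. Call $\phi$ standard near $p$ if there are a Legendre curve $\alpha:I\to\mathbb{H}_1^3$ with $\alpha_1\ne0$ on $I$ and a diffeomorphism $F$ from an open subset of $I\times\mathbb{S}^{n_1}\times\mathbb{RH}^{n_2}$ onto a neighbourhood of $p$ with $\phi(F(s,x,y))=(\alpha_1(s)x,\alpha_2(s)y)$. (a) $\phi$ is locally invariant if and only if it is standard near every $p\in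 M$ at which the $\mathbb{C}^{n_1+1}$-component of $\phi(p)$ is not $0$. (b) If the image $\phi(M)$ is invariant under all of $G$, then $\phi$ is standard near every such $p$. (c) Conversely, for every Legendre curve $\alpha:I\to\mathbb{H}_1^3$, the image of $I\times\mathbb{S}^{n_1}\times\mathbb{RH}^{n_2}$ under $(s,x,y)\mapsto(\alpha_1(s)x,\alpha_2(s)y)$ is invariant under $G$. -/

import Mathlib

open scoped Manifold ContDiff Topology ComplexConjugate

noncomputable section

namespace AdSLegendrian

/-! ### The quadrics in complex space -/

/-- The Hermitian form `(z, w) = ∑_{i ≤ n} z_i w̄_i + ε z_{n+1} w̄_{n+1}` on `ℂ^{n+1}`.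
It is the Euclidean one for `ε = 1` and the one of signature `(n, 1)` for `ε = -1`. -/
def hForm {n : ℕ} (ε : ℝ) (z w : Fin (n + 1) → ℂ) : ℂ :=
  ∑ i : Fin n, z i.castSucc * conj (w i.castSucc) + (ε : ℂ) * (z (Fin.last n) * conj (w (Fin.last n)))

/-- The quadric `(z, z) = ε`: the unit sphere `S^{2n+1}` for `ε = 1`, the anti-de Sitter space
`H_1^{2n+1}` for `ε = -1`. -/
def quadric (n : ℕ) (ε : ℝ) : Set (Fin (n + 1) → ℂ) := {z | hForm ε z z = (ε : ℂ)}

/-- The Liouville 1-form `Λ_z(v) = ⟨v, J z⟩`, where `⟨ , ⟩ = Re ( , )` and `J` is multiplication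
by `i`. -/
def liouville {n : ℕ} (ε : ℝ) (z v : Fin (n + 1) → ℂ) : ℝ := (hForm ε v (Complex.I • z)).re

/-- The complex `n`-form `Ω_z(v_1, …, v_n) = det_ℂ {z, v_1, …, v_n}`. -/
def volForm {n : ℕ} (z : Fin (n + 1) → ℂ) (v : Fin n → Fin (n + 1) → ℂ) : ℂ :=
  (Matrix.of (Fin.cons z v : Fin (n + 1) → Fin (n + 1) → ℂ)).det

/-! ### Legendrian immersions -/

section Immersions

variable {E : Type*} [NormedAddCommGroup E] [NormedSpace ℝ E]
  {H : Type*} [TopologicalSpace H] (I : ModelWithCorners ℝ E H)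
  {M : Type*} [TopologicalSpace M] [ChartedSpace H M]

/-- A smooth map into the quadric that pulls the contact form back to `0`. -/
structure IsLegendrianMap {n : ℕ} (ε : ℝ) (φ : M → Fin (n + 1) → ℂ) : Prop where
  smooth : ContMDiff I 𝓘(ℝ, Fin (n + 1) → ℂ) ∞ φ
  mem_quadric : ∀ p, φ p ∈ quadric n ε
  horizontal : ∀ p (v : TangentSpace I p), liouville ε (φ p) (mvfderiv I φ p v) = 0

/-- A Legendrian immersion into the quadric; it is used for manifolds of dimension `n`. -/
structure IsLegendrianImmersion {n : ℕ} (ε : ℝ) (φ : M → Fin (n + 1) → ℂ) : Prop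
    extends IsLegendrianMap I ε φ where
  immersive : ∀ p, Function.Injective (mvfderiv I φ p)

/-- The tensor `φ^* ⟨ , ⟩` on `T_p M`. -/
def inducedMetric {n : ℕ} (ε : ℝ) (φ : M → Fin (n + 1) → ℂ) (p : M) (v w : TangentSpace I p) : ℝ :=
  (hForm ε (mvfderiv I φ p v) (mvfderiv I φ p w)).re

variable (M) in
/-- An orientation of an `n`-dimensional manifold: a choice of an orientation of each tangent space
that is locally constant when tangent vectors are compared in a chart. -/
structure ManifoldOrientation (n : ℕ) where
  /-- The orientation of the tangent space at a point. -/
  orient : ∀ p : M, Orientation ℝ (TangentSpace I p) (Fin n)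
  /-- Near `p`, a frame at `q` is positive exactly if its expression in the chart at `p` is. -/
  locallyConstant : ∀ p : M, ∀ᶠ q in 𝓝 p,
    ∀ (b : Module.Basis (Fin n) ℝ (TangentSpace I q)) (c : Module.Basis (Fin n) ℝ (TangentSpace I p)),
      (∀ i, c i = mfderiv I 𝓘(ℝ, E) (extChartAt I p) q (b i)) →
        (b.orientation = orient q ↔ c.orientation = orient p)

/-- `1` for a positively oriented frame, `-1` for a negatively oriented one. -/
def frameSign {n : ℕ} {V : Type*} [AddCommGroup V] [Module ℝ V] (o : Orientation ℝ V (Fin n))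
    (b : Module.Basis (Fin n) ℝ V) : ℝ :=
  open Classical in if b.orientation = o then 1 else -1

/-- `β` is the Legendrian angle at `p` of `φ`, for the orientation `o` of `T_p M`: one has
`(φ^* Ω)_p(e_1, …, e_n) = e^{iβ}` for every oriented orthonormal frame. The frames of the opposite
orientation are listed as well, with the opposite sign; this only matters if `n = 0`. -/
def IsLegendrianAngleAt {n : ℕ} (ε : ℝ) (φ : M → Fin (n + 1) → ℂ) (p : M)
    (o : Orientation ℝ (TangentSpace I p) (Fin n)) (β : Real.Angle) : Prop :=
  ∀ e : Module.Basis (Fin n) ℝ (TangentSpace I p),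
    (∀ i j, inducedMetric I ε φ p (e i) (e j) = if i = j then 1 else 0) →
      (frameSign o e : ℂ) * volForm (φ p) (fun i => mvfderiv I φ p (e i)) = (β.toCircle : ℂ)

end Immersions

/-! ### Legendre curves in `H_1^3` -/

/-- `α`, restricted to the open interval `I`, is a (smooth, regular) Legendre curve in `H_1^3`. -/
structure IsLegendreCurve (I : Set ℝ) (α : ℝ → Fin 2 → ℂ) : Prop where
  isOpen : IsOpen I
  interval : I.OrdConnected
  smooth : ContDiffOn ℝ ∞ α I
  mem_quadric : ∀ s ∈ I, α s ∈ quadric 1 (-1)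
  horizontal : ∀ s ∈ I, liouville (-1) (α s) (deriv α s) = 0
  regular : ∀ s ∈ I, deriv α s ≠ 0

/-- `|α'(s)|² = ⟨α'(s), α'(s)⟩`, in the metric of `H_1^3`. -/
def speedSq (α : ℝ → Fin 2 → ℂ) (s : ℝ) : ℝ := (hForm (-1) (deriv α s) (deriv α s)).re

/-- `β` is the Legendre angle of `α` at `s`: `e^{iβ} = Ω_α(α' / |α'|)`. -/
def IsLegendreAngleAt (α : ℝ → Fin 2 → ℂ) (s : ℝ) (β : Real.Angle) : Prop :=
  volForm (α s) (fun _ : Fin 1 => ((√(speedSq α s))⁻¹ : ℝ) • deriv α s) = (β.toCircle : ℂ)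

/-! ### The construction -/

/-- The point `(z₁, z₂)` of `ℂ^{n+1} = ℂ^{n₁+1} × ℂ^{n₂+1}`, where `n = n₁ + n₂ + 1`. -/
def join {n₁ n₂ : ℕ} (z₁ : Fin (n₁ + 1) → ℂ) (z₂ : Fin (n₂ + 1) → ℂ) : Fin (n₁ + 1 + n₂ + 1) → ℂ :=
  Fin.append (m := n₁ + 1) (n := n₂ + 1) z₁ z₂

/-- The component in `ℂ^{n₁+1}` of a point of `ℂ^{n₁+1} × ℂ^{n₂+1}`. -/
def fstPart {n₁ n₂ : ℕ} (z : Fin (n₁ + 1 + n₂ + 1) → ℂ) : Fin (n₁ + 1) → ℂ :=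
  fun i => z (Fin.castAdd (n₂ + 1) i)

/-- The component in `ℂ^{n₂+1}` of a point of `ℂ^{n₁+1} × ℂ^{n₂+1}`. -/
def sndPart {n₁ n₂ : ℕ} (z : Fin (n₁ + 1 + n₂ + 1) → ℂ) : Fin (n₂ + 1) → ℂ :=
  fun i => z (Fin.natAdd (n₁ + 1) i)

/-- The map `(s, p, q) ↦ (α₁(s) ψ₁(p), α₂(s) ψ₂(q))`. -/
def product {n₁ n₂ : ℕ} {N₁ N₂ : Type*} (α : ℝ → Fin 2 → ℂ) (ψ₁ : N₁ → Fin (n₁ + 1) → ℂ)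
    (ψ₂ : N₂ → Fin (n₂ + 1) → ℂ) (s : ℝ) (p : N₁) (q : N₂) : Fin (n₁ + 1 + n₂ + 1) → ℂ :=
  join (α s 0 • ψ₁ p) (α s 1 • ψ₂ q)

/-- The model with corners of `I × N₁ × N₂`, for an interval `I` and manifolds `N_i` of
dimension `n_i`. -/
abbrev prodModel (n₁ n₂ : ℕ) :=
  (𝓘(ℝ, ℝ)).prod ((𝓡 n₁).prod (𝓡 n₂))

/-- The basis `(1, 0, 0), (0, b₁, 0), (0, 0, b₂)` of `ℝ × V₁ × V₂`, in this order. -/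
def productBasis {n₁ n₂ : ℕ} {V₁ V₂ : Type*} [AddCommGroup V₁] [Module ℝ V₁] [AddCommGroup V₂]
    [Module ℝ V₂] (b₁ : Module.Basis (Fin n₁) ℝ V₁) (b₂ : Module.Basis (Fin n₂) ℝ V₂) :
    Module.Basis (Fin (n₁ + 1 + n₂)) ℝ (ℝ × V₁ × V₂) :=
  ((Module.Basis.singleton (Fin 1) ℝ).prod (b₁.prod b₂)).reindex
    ((Equiv.sumAssoc (Fin 1) (Fin n₁) (Fin n₂)).symm.trans
      ((finSumFinEquiv.sumCongr (Equiv.refl _)).trans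
        (finSumFinEquiv.trans (finCongr (by omega)))))

/-- The product orientation of `ℝ × V₁ × V₂`: `(1, 0, 0), (0, b₁, 0), (0, 0, b₂)` is positive if the
frames `b₁` and `b₂` are both positive or both negative. As this does not depend on the frames, it
is stated for the standard ones. -/
def productOrientation {n₁ n₂ : ℕ}
    (o₁ : Orientation ℝ (EuclideanSpace ℝ (Fin n₁)) (Fin n₁))
    (o₂ : Orientation ℝ (EuclideanSpace ℝ (Fin n₂)) (Fin n₂)) :
    Orientation ℝ (ℝ × EuclideanSpace ℝ (Fin n₁) × EuclideanSpace ℝ (Fin n₂))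
      (Fin (n₁ + 1 + n₂)) :=
  let b₁ := (EuclideanSpace.basisFun (Fin n₁) ℝ).toBasis
  let b₂ := (EuclideanSpace.basisFun (Fin n₂) ℝ).toBasis
  open Classical in
  if frameSign o₁ b₁ = frameSign o₂ b₂ then (productBasis b₁ b₂).orientation
  else -(productBasis b₁ b₂).orientation

/-! ### Real hyperbolic space -/

/-- `ℝH^n = {y ∈ ℝ^{n+1} | ∑_{i ≤ n} y_i² - y_{n+1}² = -1, y_{n+1} > 0}`. -/
def RH (n : ℕ) : Type :=
  {y : EuclideanSpace ℝ (Fin (n + 1)) //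
    ∑ i : Fin n, y i.castSucc ^ 2 - y (Fin.last n) ^ 2 = -1 ∧ 0 < y (Fin.last n)}

instance (n : ℕ) : TopologicalSpace (RH n) := instTopologicalSpaceSubtype

/-- `ℝH^n` is the graph of `u ↦ √(1 + |u|²)`. -/
def RH.homeo (n : ℕ) : RH n ≃ₜ EuclideanSpace ℝ (Fin n) where
  toFun y := WithLp.toLp 2 fun i => y.1 i.castSucc
  invFun u := ⟨WithLp.toLp 2 (Fin.snoc (α := fun _ => ℝ) (fun i => u i) √(1 + ∑ i, u i ^ 2)), by
    have h : 0 < 1 + ∑ i, u i ^ 2 :=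
      add_pos_of_pos_of_nonneg one_pos (Finset.sum_nonneg fun i _ => sq_nonneg _)
    refine ⟨?_, ?_⟩
    · simp only [Fin.snoc_castSucc, Fin.snoc_last, Real.sq_sqrt h.le]
      ring
    · simpa only [Fin.snoc_last] using Real.sqrt_pos.2 h⟩
  left_inv y := by
    obtain ⟨y, hy, hpos⟩ := y
    apply Subtype.ext
    ext i
    refine Fin.lastCases ?_ (fun i => ?_) i
    · simp only [Fin.snoc_last]
      rw [show 1 + ∑ i : Fin n, y i.castSucc ^ 2 = y (Fin.last n) ^ 2 by linarith]
      exact Real.sqrt_sq hpos.le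
    · simp only [Fin.snoc_castSucc]
  right_inv u := by
    ext i
    simp only [Fin.snoc_castSucc]
  continuous_toFun := by
    refine (PiLp.continuous_toLp 2 _).comp (continuous_pi fun i => ?_)
    exact ((continuous_apply i.castSucc).comp (PiLp.continuous_ofLp 2 _)).comp
      continuous_subtype_val
  continuous_invFun := by
    refine Continuous.subtype_mk ((PiLp.continuous_toLp 2 _).comp (continuous_pi fun i => ?_)) _
    refine Fin.lastCases ?_ (fun i => ?_) i
    · simp only [Fin.snoc_last]
      fun_prop
    · simp only [Fin.snoc_castSucc]
      fun_prop

/-- The smooth structure of `ℝH^n` as a submanifold of `ℝ^{n+1}`, given by one global chart. -/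
instance (n : ℕ) : ChartedSpace (EuclideanSpace ℝ (Fin n)) (RH n) :=
  (RH.homeo n).toOpenPartialHomeomorph.singletonChartedSpace rfl

instance (n : ℕ) : IsManifold (𝓡 n) ∞ (RH n) :=
  haveI := (RH.homeo n).toOpenPartialHomeomorph.singleton_hasGroupoid rfl (contDiffGroupoid ∞ (𝓡 n))
  IsManifold.mk' (𝓡 n) ∞ (RH n)

/-- The unit sphere `S^n` of `ℝ^{n+1}`. -/
abbrev RS (n : ℕ) : Type := Metric.sphere (0 : EuclideanSpace ℝ (Fin (n + 1))) 1

/-- The totally geodesic Legendrian embedding of `S^n` in `S^{2n+1}`, the inclusion. -/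
def sphereIncl (n : ℕ) (x : RS n) : Fin (n + 1) → ℂ := fun i => ((x.1 i : ℝ) : ℂ)

/-- The totally geodesic Legendrian embedding of `ℝH^n` in `H_1^{2n+1}`, the inclusion. -/
def hypIncl (n : ℕ) (y : RH n) : Fin (n + 1) → ℂ := fun i => ((y.1 i : ℝ) : ℂ)

/-! ### The group action and invariance -/

/-- The indefinite special orthogonal group of signature `(n, 1)`. -/
def SOOne (n : ℕ) : Set (Matrix (Fin (n + 1)) (Fin (n + 1)) ℝ) :=
  let J := Matrix.diagonal (Fin.snoc (α := fun _ => ℝ) (fun _ : Fin n => 1) (-1))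
  {A | A.transpose * J * A = J ∧ A.det = 1}

/-- `SO(n₁+1) × SO_0^1(n₂+1)`; the second factor is the identity component of `SOOne n₂`. -/
def actionGroup (n₁ n₂ : ℕ) : Set (Matrix (Fin (n₁ + 1)) (Fin (n₁ + 1)) ℝ ×
    Matrix (Fin (n₂ + 1)) (Fin (n₂ + 1)) ℝ) :=
  (Matrix.specialOrthogonalGroup (Fin (n₁ + 1)) ℝ : Set (Matrix (Fin (n₁ + 1)) (Fin (n₁ + 1)) ℝ)) ×ˢ
    connectedComponentIn (SOOne n₂) 1

/-- The action of `(A₁, A₂)` on `ℂ^{n+1}` by the block diagonal matrix with blocks `A₁` and `A₂`. -/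
def act {n₁ n₂ : ℕ}
    (g : Matrix (Fin (n₁ + 1)) (Fin (n₁ + 1)) ℝ × Matrix (Fin (n₂ + 1)) (Fin (n₂ + 1)) ℝ)
    (z : Fin (n₁ + 1 + n₂ + 1) → ℂ) : Fin (n₁ + 1 + n₂ + 1) → ℂ :=
  join ((g.1.map ((↑) : ℝ → ℂ)).mulVec (fstPart z)) ((g.2.map ((↑) : ℝ → ℂ)).mulVec (sndPart z))

/-- The image of `φ` is invariant under the whole group. -/
def IsImageInvariant {n₁ n₂ : ℕ} {M : Type*} (φ : M → Fin (n₁ + 1 + n₂ + 1) → ℂ) : Prop :=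
  ∀ g ∈ actionGroup n₁ n₂, ∀ p, act g (φ p) ∈ Set.range φ

/-- Local invariance of the immersed submanifold `φ`: the elements of the group that are close to
the identity (how close may depend on the point and on the neighbourhood) move each point of `φ`
inside the given sheet of `φ`. -/
def IsLocallyInvariant {n₁ n₂ : ℕ} {M : Type*} [TopologicalSpace M]
    (φ : M → Fin (n₁ + 1 + n₂ + 1) → ℂ) : Prop :=
  ∀ p, ∀ U ∈ 𝓝 p, ∀ᶠ g in 𝓝[actionGroup n₁ n₂] 1, act g (φ p) ∈ φ '' U

/-- Near `p`, after a local diffeomorphism, `φ` is `(s, x, y) ↦ (α₁(s) x, α₂(s) y)` with `x ∈ S^{n₁}`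
and `y ∈ ℝH^{n₂}`, for a Legendre curve `α` in `H_1^3` for which this is an immersion. -/
def IsStandardNear {n₁ n₂ : ℕ} {M : Type*} [TopologicalSpace M]
    [ChartedSpace (EuclideanSpace ℝ (Fin (n₁ + 1 + n₂))) M]
    (φ : M → Fin (n₁ + 1 + n₂ + 1) → ℂ) (p : M) : Prop :=
  ∃ (I : Set ℝ) (α : ℝ → Fin 2 → ℂ), IsLegendreCurve I α ∧ (∀ s ∈ I, α s 0 ≠ 0) ∧
    ∃ F : PartialDiffeomorph (prodModel n₁ n₂) (𝓡 (n₁ + 1 + n₂)) (ℝ × RS n₁ × RH n₂) M ∞,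
      p ∈ F.target ∧ ∀ x ∈ F.source, x.1 ∈ I ∧
        φ (F x) = product α (sphereIncl n₁) (hypIncl n₂) x.1 x.2.1 x.2.2

end AdSLegendrian

end

open AdSLegendrian

open scoped Manifold ContDiff Topology ComplexConjugate

noncomputable section

namespace AdSLegendrian

/-! ### The Hermitian form and its derivative along maps into a quadric -/

section Form
variable {n : ℕ} (ε : ℝ)

/-! Part (1) rests on one orthogonality. For a horizontal map into a quadric the derivative is
Hermitian orthogonal to the position: the real part of the product vanishes because the square is
constant, the imaginary part because of horizontality (`hForm_hasFDerivAt_eq_zero`). Applied to the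
two immersions and to the curve, it removes all cross terms from the form on derivatives of `φ`,
which gives horizontality and the warped metric. This metric is definite where `α₁ ≠ 0`, since
Legendre curves have positive speed and `|α₂|² = |α₁|² + 1`. For the angle, an orthonormal frame is
compared with the product of orthonormal frames of the factors: the change of frame contributes a
sign and a positive factor, and on the product frame the determinant factors (`volForm_join`).

Part (2) rests on the moment map. For a one-parameter group with generator `X`, the contact form on
the velocity of the orbit of `z` is `Im (X z, z)` at all times (`exists_oneParameter`). If the orbit
stays in one sheet of a Legendrian immersion for a while, its velocity is tangent to the sheet, so
this number is `0`. Local invariance supplies such a time interval at once. Invariance of the image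
supplies one by Baire's theorem, because countably many compact sheets cover the image. Vanishing
for all `X` says that the components inside each block are real multiples of each other
(`isRealBlocks_of_moment_eq_zero`).

Hence `φ = (a x, b y)` with `x` in the sphere, `y` in hyperbolic space and complex functions `a`,
`b`, wherever the first block is nonzero. The map `(a, b)` into `H_1^3` is again horizontal. Its
tangent images are isotropic and lie in a contact plane, which is a complex line, so they have real
dimension at most one. As `φ` is immersive, counting dimensions makes `(x, y)` and one real function
of `(a, b)` local coordinates, and `(a, b)` depends on the latter only: it is a Legendre curve
(`exists_legendreCurve_of_horizontal`).

Conversely, the group moves the parameters `x` and `y`, so the standard form gives local invariance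
where the first block is nonzero. The other points are limits of these: otherwise an isotropic space
of dimension `n₁ + 1 + n₂` would fit into `ℂ^{n₂+1}`. To pass to the limit one needs a neighbourhood
of the identity that works uniformly for all nearby points. It is a connected one, given by the
Cayley transform, that keeps the orbits of nearby points off the rim of a compact sheet; an open and
closed argument then keeps these orbits inside the sheet. -/

lemma hForm_add_left (z z' w : Fin (n + 1) → ℂ) :
    hForm ε (z + z') w = hForm ε z w + hForm ε z' w := by
  simp only [hForm, Pi.add_apply, add_mul, Finset.sum_add_distrib]; ring

lemma hForm_add_right (z w w' : Fin (n + 1) → ℂ) :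
    hForm ε z (w + w') = hForm ε z w + hForm ε z w' := by
  simp only [hForm, Pi.add_apply, map_add, mul_add, Finset.sum_add_distrib]; ring

lemma hForm_smul_left (c : ℂ) (z w : Fin (n + 1) → ℂ) :
    hForm ε (c • z) w = c * hForm ε z w := by
  simp only [hForm, Pi.smul_apply, smul_eq_mul, mul_add, Finset.mul_sum]
  congr 1
  · exact Finset.sum_congr rfl fun i _ => by ring
  · ring

lemma hForm_smul_right (c : ℂ) (z w : Fin (n + 1) → ℂ) :
    hForm ε z (c • w) = conj c * hForm ε z w := by
  simp only [hForm, Pi.smul_apply, smul_eq_mul, mul_add, Finset.mul_sum, map_mul]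
  congr 1
  · exact Finset.sum_congr rfl fun i _ => by ring
  · ring

lemma hForm_real_smul_left (c : ℝ) (z w : Fin (n + 1) → ℂ) :
    hForm ε (c • z) w = c * hForm ε z w := by
  rw [← hForm_smul_left]; congr 1

lemma hForm_real_smul_right (c : ℝ) (z w : Fin (n + 1) → ℂ) :
    hForm ε z (c • w) = c * hForm ε z w := by
  have : c • w = (c : ℂ) • w := by ext i; simp
  rw [this, hForm_smul_right, Complex.conj_ofReal]

lemma conj_hForm (z w : Fin (n + 1) → ℂ) : conj (hForm ε z w) = hForm ε w z := by
  simp only [hForm, map_add, map_sum, map_mul, Complex.conj_conj, Complex.conj_ofReal]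
  congr 1
  · exact Finset.sum_congr rfl fun i _ => by ring
  · ring

lemma liouville_eq (z v : Fin (n + 1) → ℂ) : liouville ε z v = (hForm ε v z).im := by
  rw [liouville, hForm_smul_right]; simp

/-- The Hermitian form is a continuous real bilinear map. -/
def hFormBilin (n : ℕ) (ε : ℝ) : (Fin (n + 1) → ℂ) →L[ℝ] (Fin (n + 1) → ℂ) →L[ℝ] ℂ :=
  LinearMap.toContinuousLinearMap
    { toFun := fun z => LinearMap.toContinuousLinearMap
        { toFun := hForm ε z
          map_add' := hForm_add_right ε z
          map_smul' := fun c w => by simp [hForm_real_smul_right] }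
      map_add' := fun z z' => by ext w; exact hForm_add_left ε z z' w
      map_smul' := fun c z => by ext w; simp [hForm_real_smul_left] }

@[simp] lemma hForm_zero_left (w : Fin (n + 1) → ℂ) : hForm ε 0 w = 0 := by simp [hForm]
@[simp] lemma hForm_zero_right (w : Fin (n + 1) → ℂ) : hForm ε w 0 = 0 := by simp [hForm]

lemma mem_quadric {z : Fin (n + 1) → ℂ} : z ∈ quadric n ε ↔ hForm ε z z = (ε : ℂ) := Iff.rfl

/-- On a map into the quadric, the derivative is Hermitian orthogonal to the position if the map is
horizontal. -/
lemma hForm_hasFDerivAt_eq_zero {E : Type*} [NormedAddCommGroup E] [NormedSpace ℝ E]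
    {f : E → Fin (n + 1) → ℂ} {f' : E →L[ℝ] Fin (n + 1) → ℂ} {u : E} (hf : HasFDerivAt f f' u)
    (hq : ∀ᶠ x in 𝓝 u, f x ∈ quadric n ε) {v : E} (hh : liouville ε (f u) (f' v) = 0) :
    hForm ε (f' v) (f u) = 0 := by
  have h1 := (hFormBilin n ε).hasFDerivAt_of_bilinear hf hf
  have h2 : HasFDerivAt (fun x => hFormBilin n ε (f x) (f x)) (0 : E →L[ℝ] ℂ) u :=
    (hasFDerivAt_const (ε : ℂ) u).congr_of_eventuallyEq (hq.mono fun x hx => hx)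
  -- The two terms of the product rule are conjugate, so each has real part `0`.
  have h3 : (hForm ε (f u) (f' v)).re + (hForm ε (f' v) (f u)).re = 0 :=
    congrArg (fun L : E →L[ℝ] ℂ => (L v).re) (h1.unique h2)
  rw [← conj_hForm ε (f' v), Complex.conj_re] at h3
  rw [liouville_eq] at hh
  exact Complex.ext (by simpa using (by linarith : (hForm ε (f' v) (f u)).re = 0)) hh

end Form

/-! ### The splitting of `ℂ^{n+1}` into two blocks -/

section Join
variable {n₁ n₂ : ℕ}

@[simp] lemma join_castAdd (a : Fin (n₁ + 1) → ℂ) (b : Fin (n₂ + 1) → ℂ) (i : Fin (n₁ + 1)) :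
    join a b (Fin.castAdd (n₂ + 1) i) = a i := Fin.append_left a b i
@[simp] lemma join_natAdd (a : Fin (n₁ + 1) → ℂ) (b : Fin (n₂ + 1) → ℂ) (i : Fin (n₂ + 1)) :
    join a b (Fin.natAdd (n₁ + 1) i) = b i := Fin.append_right a b i
@[simp] lemma fstPart_join (a : Fin (n₁ + 1) → ℂ) (b : Fin (n₂ + 1) → ℂ) : fstPart (join a b) = a := by
  ext i; exact join_castAdd a b i
@[simp] lemma sndPart_join (a : Fin (n₁ + 1) → ℂ) (b : Fin (n₂ + 1) → ℂ) : sndPart (join a b) = b := by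
  ext i; exact join_natAdd a b i

lemma join_ext {z w : Fin (n₁ + 1 + n₂ + 1) → ℂ} (h1 : fstPart z = fstPart w)
    (h2 : sndPart z = sndPart w) : z = w := by
  ext i
  refine Fin.addCases (m := n₁ + 1) (n := n₂ + 1) (motive := fun i => z i = w i)
    (fun i => congrFun h1 i) (fun i => congrFun h2 i) i

@[simp] lemma join_parts (z : Fin (n₁ + 1 + n₂ + 1) → ℂ) : join (fstPart z) (sndPart z) = z :=
  join_ext (by simp) (by simp)

/-- The coordinate with weight `ε` is the last one and belongs to the second block, so the first
block always carries the Euclidean form. -/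
lemma hForm_parts (ε : ℝ) (z w : Fin (n₁ + 1 + n₂ + 1) → ℂ) :
    hForm ε z w = hForm 1 (fstPart z) (fstPart w) + hForm ε (sndPart z) (sndPart w) := by
  simp only [hForm, fstPart, sndPart]
  rw [Fin.sum_univ_add, Fin.sum_univ_castSucc]
  simp only [Complex.ofReal_one, one_mul]
  have h1 : ∀ i : Fin n₂, (Fin.natAdd (n₁ + 1) i).castSucc = Fin.natAdd (n₁ + 1) i.castSucc := fun i => rfl
  have h2 : Fin.last (n₁ + 1 + n₂) = Fin.natAdd (n₁ + 1) (Fin.last n₂) := rfl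
  have h3 : ∀ i : Fin (n₁ + 1), (Fin.castAdd n₂ i).castSucc = Fin.castAdd (n₂ + 1) i := fun i => rfl
  simp only [h1, h2, h3]
  ring

lemma hForm_join (ε : ℝ) (a c : Fin (n₁ + 1) → ℂ) (b d : Fin (n₂ + 1) → ℂ) :
    hForm ε (join a b) (join c d) = hForm 1 a c + hForm ε b d := by
  rw [hForm_parts]; simp

/-- The join of two vectors, as a continuous linear map. -/
def joinCLM (n₁ n₂ : ℕ) :
    (Fin (n₁ + 1) → ℂ) × (Fin (n₂ + 1) → ℂ) →L[ℝ] (Fin (n₁ + 1 + n₂ + 1) → ℂ) :=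
  LinearMap.toContinuousLinearMap
    { toFun := fun x => join x.1 x.2
      map_add' := fun x y => join_ext (by ext i; simp [fstPart]) (by ext i; simp [sndPart])
      map_smul' := fun c x => join_ext (by ext i; simp [fstPart]) (by ext i; simp [sndPart]) }

@[simp] lemma joinCLM_apply (x : (Fin (n₁ + 1) → ℂ) × (Fin (n₂ + 1) → ℂ)) :
    joinCLM n₁ n₂ x = join x.1 x.2 := rfl

lemma continuous_fstPart : Continuous (fstPart (n₁ := n₁) (n₂ := n₂)) := by
  unfold fstPart; fun_prop
lemma continuous_sndPart : Continuous (sndPart (n₁ := n₁) (n₂ := n₂)) := by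
  unfold sndPart; fun_prop
end Join

/-! ### Tangent spaces of horizontal maps -/

section Isotropic
variable {E : Type*} [NormedAddCommGroup E] [NormedSpace ℝ E]

/-- The tangent spaces of a horizontal map are isotropic for the symplectic form `Im ( , )`. -/
lemma hForm_fderiv_im_eq_zero {n : ℕ} {ε : ℝ} {f : E → Fin (n + 1) → ℂ} {u : E}
    (hf : ContDiffAt ℝ ∞ f u)
    (hh : ∀ᶠ x in 𝓝 u, ∀ v, liouville ε (f x) (fderiv ℝ f x v) = 0) (v w : E) :
    (hForm ε (fderiv ℝ f u v) (fderiv ℝ f u w)).im = 0 := by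
  have h0 : HasFDerivAt f (fderiv ℝ f u) u := (hf.differentiableAt (by simp)).hasFDerivAt
  have h1 : HasFDerivAt (fderiv ℝ f) (fderiv ℝ (fderiv ℝ f) u) u :=
    ((hf.fderiv_right (m := 1) (by norm_cast)).differentiableAt (by simp)).hasFDerivAt
  -- This is the derivative of `Im (∂_v f, f) = 0` in the direction `w`. Exchanging `v` and `w`
  -- keeps the second derivative and changes the sign of the first term, so that term vanishes.
  have key : ∀ v w, (hForm ε (fderiv ℝ f u v) (fderiv ℝ f u w)).im
      + (hForm ε (fderiv ℝ (fderiv ℝ f) u w v) (f u)).im = 0 := by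
    intro v w
    have h2 : HasFDerivAt (fun x => fderiv ℝ f x v) _ u :=
      (ContinuousLinearMap.apply ℝ (Fin (n + 1) → ℂ) v).hasFDerivAt.comp u h1
    have h3 := Complex.imCLM.hasFDerivAt.comp u ((hFormBilin n ε).hasFDerivAt_of_bilinear h2 h0)
    have h4 : HasFDerivAt (Complex.imCLM ∘ fun y => hFormBilin n ε (fderiv ℝ f y v) (f y))
        (0 : E →L[ℝ] ℝ) u := by
      refine (hasFDerivAt_const (0 : ℝ) u).congr_of_eventuallyEq (hh.mono fun x hx => ?_)
      have := hx v
      rw [liouville_eq] at this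
      exact this
    exact congrArg (fun L : E →L[ℝ] ℝ => L w) (h3.unique h4)
  have hsymm : fderiv ℝ (fderiv ℝ f) u w v = fderiv ℝ (fderiv ℝ f) u v w :=
    (hf.isSymmSndFDerivAt (by simp only [minSmoothness_of_isRCLikeNormedField]; norm_cast)) w v
  have h5 := key v w
  have h6 := key w v
  rw [← hsymm, ← conj_hForm, Complex.conj_im] at h6
  linarith

end Isotropic

/-! ### The contact planes of `H_1^3` -/

section Curve

lemma hForm_one_eq (ε : ℝ) (z w : Fin 2 → ℂ) :
    hForm ε z w = z 0 * conj (w 0) + ε * (z 1 * conj (w 1)) := by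
  simp [hForm]

/-- The contact planes of `H_1^3` are complex lines, so isotropic vectors in them are
proportional over the reals. -/
lemma exists_eq_smul_of_isotropic {z v w : Fin 2 → ℂ} (hz : z ∈ quadric 1 (-1))
    (hv : hForm (-1) v z = 0) (hw : hForm (-1) w z = 0) (hvw : (hForm (-1) v w).im = 0)
    (hv0 : v ≠ 0) : ∃ c : ℝ, w = c • v := by
  rw [mem_quadric, hForm_one_eq] at hz
  rw [hForm_one_eq] at hv hw hvw
  push_cast at hz hv hw hvw
  have hz1 : z 1 ≠ 0 := by
    intro h
    rw [h, Complex.mul_conj] at hz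
    have := congrArg Complex.re hz
    simp at this
    linarith [Complex.normSq_nonneg (z 0)]
  have hz1c : conj (z 1) ≠ 0 := by simpa using hz1
  -- The contact plane at `z` is the complex line through `(conj z₁, conj z₀)`, a vector of square
  -- `|z₁|² - |z₀|² = 1`. The coordinates of `v` and `w` along it are `l` and `m`, whence `(v, w) =
  -- l conj m`.
  set l := v 0 / conj (z 1) with hl
  set m := w 0 / conj (z 1) with hm
  have v0 : v 0 = l * conj (z 1) := (div_mul_cancel₀ _ hz1c).symm
  have w0 : w 0 = m * conj (z 1) := (div_mul_cancel₀ _ hz1c).symm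
  have v1 : v 1 = l * conj (z 0) := by
    apply mul_right_cancel₀ hz1c
    rw [v0] at hv; linear_combination -hv
  have w1 : w 1 = m * conj (z 0) := by
    apply mul_right_cancel₀ hz1c
    rw [w0] at hw; linear_combination -hw
  have hlm : (l * conj m).im = 0 := by
    rw [v0, w0, v1, w1] at hvw
    have : l * conj (z 1) * conj (m * conj (z 1)) + -1 * (l * conj (z 0) * conj (m * conj (z 0)))
      = l * conj m := by
      simp only [map_mul, Complex.conj_conj]
      linear_combination (-(l * conj m)) * hz
    rwa [this] at hvw
  have hl0 : l ≠ 0 := by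
    rintro h
    apply hv0
    ext i; fin_cases i
    · simpa [h] using v0
    · simpa [h] using v1
  have hmc : m = ((l * conj m).re / Complex.normSq l : ℝ) * l := by
    have h1 : l * conj m = ((l * conj m).re : ℂ) := Complex.ext (by simp) (by simpa using hlm)
    have h2 : conj l * m = ((l * conj m).re : ℂ) := by
      rw [← Complex.conj_ofReal, ← h1]; simp
    have h3 : (Complex.normSq l : ℂ) ≠ 0 := by simpa using hl0
    rw [Complex.ofReal_div, ← h2, div_mul_eq_mul_div, eq_div_iff h3, ← Complex.mul_conj]
    ring
  refine ⟨(l * conj m).re / Complex.normSq l, ?_⟩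
  ext i; fin_cases i
  · change w 0 = ((l * conj m).re / Complex.normSq l) • v 0
    rw [w0, v0, Complex.real_smul, ← mul_assoc, ← hmc]
  · change w 1 = ((l * conj m).re / Complex.normSq l) • v 1
    rw [w1, v1, Complex.real_smul, ← mul_assoc, ← hmc]

end Curve

/-! ### Horizontal maps into `H_1^3` are locally curves -/

section Submersion
variable {E E' : Type*} [NormedAddCommGroup E] [NormedSpace ℝ E] [FiniteDimensional ℝ E]
  [NormedAddCommGroup E'] [NormedSpace ℝ E'] [FiniteDimensional ℝ E']

/-- A smooth inverse function theorem with control of the target: the image of the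
local inverse is a ball. -/
lemma exists_openPartialHomeomorph_of_injective {F : Type*} [NormedAddCommGroup F]
    [NormedSpace ℝ F] [FiniteDimensional ℝ F] {U : Set E} (hU : IsOpen U) {f : E → F}
    (hf : ContDiffOn ℝ ∞ f U) {u₀ : E} (hu₀ : u₀ ∈ U)
    (hinj : Function.Injective (fderiv ℝ f u₀))
    (hdim : Module.finrank ℝ E = Module.finrank ℝ F) :
    ∃ Φ : OpenPartialHomeomorph E F, u₀ ∈ Φ.source ∧ Φ.source ⊆ U ∧ (∀ u, Φ u = f u) ∧
      (∃ r > 0, Φ.target = Metric.ball (f u₀) r) ∧ ContDiffOn ℝ ∞ Φ.symm Φ.target := by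
  have : CompleteSpace E := FiniteDimensional.complete ℝ E
  have : CompleteSpace F := FiniteDimensional.complete ℝ F
  have hat : ∀ u ∈ U, ContDiffAt ℝ ∞ f u := fun u hu => hf.contDiffAt (hU.mem_nhds hu)
  have hd : ∀ u ∈ U, HasFDerivAt f (fderiv ℝ f u) u := fun u hu =>
    ((hat u hu).differentiableAt (by simp)).hasFDerivAt
  let e : E ≃L[ℝ] F :=
    (LinearEquiv.ofInjectiveOfFinrankEq (fderiv ℝ f u₀ : E →ₗ[ℝ] F) hinj hdim).toContinuousLinearEquiv
  have he : (e : E →L[ℝ] F) = fderiv ℝ f u₀ := by ext x; rfl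
  let Φ₀ := (hat u₀ hu₀).toOpenPartialHomeomorph f (f' := e) (he ▸ hd u₀ hu₀) (by simp)
  have hΦ₀ : ∀ u, Φ₀ u = f u := fun u => rfl
  have hcont : ContinuousOn (fderiv ℝ f) U := hf.continuousOn_fderiv_of_isOpen hU (by simp)
  -- Where the derivative stays invertible, the local inverse is smooth at every point of its domain
  -- and not only at the image of `u₀`.
  let S := U ∩ fderiv ℝ f ⁻¹' Set.range ((↑) : (E ≃L[ℝ] F) → E →L[ℝ] F)
  have hS : IsOpen S := hcont.isOpen_inter_preimage hU ContinuousLinearEquiv.isOpen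
  have hu₀S : u₀ ∈ S := ⟨hu₀, e, he⟩
  let Φ₁ := Φ₀.restrOpen S hS
  have h₁ : f u₀ ∈ Φ₁.target :=
    Φ₁.map_source (x := u₀) ⟨ContDiffAt.mem_toOpenPartialHomeomorph_source _ _ _, hu₀S⟩
  obtain ⟨r, hr, hball⟩ := Metric.isOpen_iff.1 Φ₁.open_target _ h₁
  -- Shrinking on the side of the target makes the target a ball. In a product space such a ball is
  -- a box with connected slices.
  let Φ := (Φ₁.symm.restrOpen (Metric.ball (f u₀) r) Metric.isOpen_ball).symm
  have ht : Φ.target = Metric.ball (f u₀) r := by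
    change Φ₁.target ∩ Metric.ball (f u₀) r = _
    exact Set.inter_eq_right.2 hball
  have hs : Φ.source = (Φ₀.source ∩ S) ∩ f ⁻¹' Metric.ball (f u₀) r := rfl
  have hsub : Φ.source ⊆ S := fun u hu => (hs ▸ hu).1.2
  have hΦ : ∀ u, Φ u = f u := fun u => rfl
  refine ⟨Φ, ?_, fun u hu => (hsub hu).1, hΦ, ⟨r, hr, ht⟩, ?_⟩
  · rw [hs]
    exact ⟨⟨ContDiffAt.mem_toOpenPartialHomeomorph_source _ _ _, hu₀S⟩, Metric.mem_ball_self hr⟩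
  · intro y hy
    have h3 := hsub (Φ.map_target hy)
    obtain ⟨g, hg⟩ := h3.2
    refine (Φ.contDiffAt_symm hy (f₀' := g) ?_ (hat _ h3.1)).contDiffWithinAt
    rw [hg]
    exact hd _ h3.1

/-- A horizontal map into `H_1^3` whose derivative is injective on the kernel of the derivative of
`X` is, in coordinates extending `X`, a Legendre curve. -/
lemma exists_legendreCurve_of_horizontal {U : Set E} (hU : IsOpen U) {θ : E → Fin 2 → ℂ}
    {X : E → E'} (hθ : ContDiffOn ℝ ∞ θ U) (hX : ContDiffOn ℝ ∞ X U)
    (hq : ∀ u ∈ U, θ u ∈ quadric 1 (-1))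
    (hh : ∀ u ∈ U, ∀ v, liouville (-1) (θ u) (fderiv ℝ θ u v) = 0)
    (hdim : Module.finrank ℝ E = Module.finrank ℝ E' + 1) {u₀ : E} (hu₀ : u₀ ∈ U)
    (hinj : ∀ v, fderiv ℝ θ u₀ v = 0 → fderiv ℝ X u₀ v = 0 → v = 0) :
    ∃ (I : Set ℝ) (α : ℝ → Fin 2 → ℂ) (Φ : OpenPartialHomeomorph E (ℝ × E')),
      IsLegendreCurve I α ∧ u₀ ∈ Φ.source ∧ Φ.source ⊆ U ∧ ContDiffOn ℝ ∞ Φ Φ.source ∧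
      ContDiffOn ℝ ∞ Φ.symm Φ.target ∧
      (∀ s ∈ I, ∃ u ∈ U, α s = θ u) ∧
      ∀ u ∈ Φ.source, (Φ u).1 ∈ I ∧ (Φ u).2 = X u ∧ θ u = α (Φ u).1 := by
  have hθd : ∀ u ∈ U, HasFDerivAt θ (fderiv ℝ θ u) u := fun u hu =>
    ((hθ.contDiffAt (hU.mem_nhds hu)).differentiableAt (by simp)).hasFDerivAt
  have hXd : ∀ u ∈ U, HasFDerivAt X (fderiv ℝ X u) u := fun u hu =>
    ((hX.contDiffAt (hU.mem_nhds hu)).differentiableAt (by simp)).hasFDerivAt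
  have hortho : ∀ u ∈ U, ∀ v, hForm (-1) (fderiv ℝ θ u v) (θ u) = 0 := fun u hu v =>
    hForm_hasFDerivAt_eq_zero (-1) (hθd u hu)
      (Filter.eventually_of_mem (hU.mem_nhds hu) hq) (hh u hu v)
  have hrank : ∀ u ∈ U, ∀ v w, fderiv ℝ θ u v ≠ 0 →
      ∃ c : ℝ, fderiv ℝ θ u w = c • fderiv ℝ θ u v := fun u hu v w hv =>
    exists_eq_smul_of_isotropic (hq u hu) (hortho u hu v) (hortho u hu w)
      (hForm_fderiv_im_eq_zero (hθ.contDiffAt (hU.mem_nhds hu))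
        (Filter.eventually_of_mem (hU.mem_nhds hu) hh) v w) hv
  -- The source has one dimension more than the target of `X`. On the resulting kernel direction `θ`
  -- must have nonzero derivative, and a functional `l` that detects it gives the missing
  -- coordinate.
  have hker : ∃ v₀, v₀ ≠ 0 ∧ fderiv ℝ X u₀ v₀ = 0 := by
    by_contra! hcon
    have h1 : Function.Injective (fderiv ℝ X u₀ : E →ₗ[ℝ] E') := by
      rw [← LinearMap.ker_eq_bot, LinearMap.ker_eq_bot']
      intro v hv
      by_contra hv0
      exact hcon v hv0 hv
    have := LinearMap.finrank_le_finrank_of_injective h1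
    omega
  obtain ⟨v₀, hv₀, hXv₀⟩ := hker
  have hθv₀ : fderiv ℝ θ u₀ v₀ ≠ 0 := fun h => hv₀ (hinj v₀ h hXv₀)
  obtain ⟨l, hl⟩ := SeparatingDual.exists_ne_zero (R := ℝ) hθv₀
  -- The derivative of `θ` has rank at most one, so `l` is injective on its image as soon as it does
  -- not vanish there.
  have hlin : ∀ u ∈ U, ∀ v w, l (fderiv ℝ θ u v) ≠ 0 → l (fderiv ℝ θ u w) = 0 →
      fderiv ℝ θ u w = 0 := by
    intro u hu v w hv hw
    obtain ⟨c, hc⟩ := hrank u hu v w (fun h => hv (by rw [h, map_zero]))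
    rw [hc, map_smul, smul_eq_mul] at hw
    rw [hc, (mul_eq_zero.1 hw).resolve_right hv, zero_smul]
  let f : E → ℝ × E' := fun u => (l (θ u), X u)
  have hf : ContDiffOn ℝ ∞ f U := (l.contDiff.comp_contDiffOn hθ).prodMk hX
  have hfd : ∀ u ∈ U, HasFDerivAt f ((l.comp (fderiv ℝ θ u)).prod (fderiv ℝ X u)) u :=
    fun u hu => (l.hasFDerivAt.comp u (hθd u hu)).prodMk (hXd u hu)
  have hfinj : Function.Injective (fderiv ℝ f u₀) := by
    rw [(hfd u₀ hu₀).fderiv, injective_iff_map_eq_zero]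
    intro v hv
    have h1 : l (fderiv ℝ θ u₀ v) = 0 := congrArg Prod.fst hv
    have h2 : fderiv ℝ X u₀ v = 0 := congrArg Prod.snd hv
    exact hinj v (hlin u₀ hu₀ v₀ v hl h1) h2
  obtain ⟨Φ, hΦ₀, hΦU, hΦf, ⟨r, hr, hΦt⟩, hΦs⟩ := exists_openPartialHomeomorph_of_injective hU hf hu₀
    hfinj (by rw [hdim, Module.finrank_prod, Module.finrank_self, add_comm])
  have hbox : ∀ y : ℝ × E', y ∈ Φ.target ↔ y.1 ∈ Metric.ball (l (θ u₀)) r ∧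
      y.2 ∈ Metric.ball (X u₀) r := by
    intro y
    rw [hΦt, show f u₀ = (l (θ u₀), X u₀) from rfl, ← ball_prod_same]; rfl
  have hmem : ∀ y ∈ Φ.target, Φ.symm y ∈ U := fun y hy => hΦU (Φ.map_target hy)
  have hfs : ∀ y ∈ Φ.target, f (Φ.symm y) = y := fun y hy => by rw [← hΦf]; exact Φ.right_inv hy
  have hsd : ∀ y ∈ Φ.target, HasFDerivAt Φ.symm (fderiv ℝ Φ.symm y) y := fun y hy =>
    ((hΦs.contDiffAt (Φ.open_target.mem_nhds hy)).differentiableAt (by simp)).hasFDerivAt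
  have hθs : ∀ y ∈ Φ.target, HasFDerivAt (fun y => θ (Φ.symm y))
      ((fderiv ℝ θ (Φ.symm y)).comp (fderiv ℝ Φ.symm y)) y := fun y hy =>
    (hθd _ (hmem y hy)).comp y (hsd y hy)
  -- In the new coordinates `l ∘ θ` is the first coordinate.
  have hlθ : ∀ y ∈ Φ.target, ∀ a, l (fderiv ℝ θ (Φ.symm y) (fderiv ℝ Φ.symm y a)) = a.1 := by
    intro y hy a
    have h1 := l.hasFDerivAt.comp y (hθs y hy)
    have h2 : HasFDerivAt (l ∘ fun y => θ (Φ.symm y)) (ContinuousLinearMap.fst ℝ ℝ E') y :=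
      hasFDerivAt_fst.congr_of_eventuallyEq
        (Filter.eventually_of_mem (Φ.open_target.mem_nhds hy) fun z hz =>
          congrArg Prod.fst (hfs z hz))
    exact congrArg (fun L : ℝ × E' →L[ℝ] ℝ => L a) (h1.unique h2)
  -- Along a slice with fixed first coordinate `l ∘ θ` is constant, hence by `hlin` the derivative
  -- of `θ` vanishes there. The slice is a ball, so `θ` is constant on it.
  have hconst : ∀ y ∈ Φ.target, θ (Φ.symm y) = θ (Φ.symm (y.1, X u₀)) := by
    intro y hy
    have hy' := (hbox y).1 hy
    have hsl : ∀ x ∈ Metric.ball (X u₀) r, (y.1, x) ∈ Φ.target := fun x hx => (hbox _).2 ⟨hy'.1, hx⟩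
    have hder : ∀ x ∈ Metric.ball (X u₀) r, HasFDerivAt (fun x => θ (Φ.symm (y.1, x)))
        (0 : E' →L[ℝ] Fin 2 → ℂ) x := by
      intro x hx
      refine ((hθs _ (hsl x hx)).comp x (hasFDerivAt_prodMk_right y.1 x)).congr_fderiv ?_
      ext1 a
      refine hlin _ (hmem _ (hsl x hx)) (fderiv ℝ Φ.symm (y.1, x) (1, 0)) _ ?_ ?_
      · rw [hlθ _ (hsl x hx)]; exact one_ne_zero
      · exact hlθ _ (hsl x hx) (0, a)
    exact Metric.isOpen_ball.is_const_of_fderiv_eq_zero (convex_ball _ _).isPreconnected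
      (fun x hx => (hder x hx).differentiableAt.differentiableWithinAt)
      (fun x hx => (hder x hx).fderiv) hy'.2 (Metric.mem_ball_self hr)
  have hline : ∀ s ∈ Metric.ball (l (θ u₀)) r, (s, X u₀) ∈ Φ.target := fun s hs =>
    (hbox _).2 ⟨hs, Metric.mem_ball_self hr⟩
  let α : ℝ → Fin 2 → ℂ := fun s => θ (Φ.symm (s, X u₀))
  have hαd : ∀ s ∈ Metric.ball (l (θ u₀)) r, HasDerivAt α
      (fderiv ℝ θ (Φ.symm (s, X u₀)) (fderiv ℝ Φ.symm (s, X u₀) (1, 0))) s := by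
    intro s hs
    exact HasFDerivAt.comp_hasDerivAt (f := fun s : ℝ => (s, X u₀)) s (hθs _ (hline s hs))
      ((hasDerivAt_id' s).prodMk (hasDerivAt_const s (X u₀)))
  refine ⟨Metric.ball (l (θ u₀)) r, α, Φ, ⟨Metric.isOpen_ball, (convex_ball _ _).ordConnected, ?_,
    fun s hs => hq _ (hmem _ (hline s hs)), fun s hs => ?_, fun s hs h0 => ?_⟩, hΦ₀, hΦU, ?_, hΦs,
    fun s hs => ⟨_, hmem _ (hline s hs), rfl⟩, fun u hu => ?_⟩
  · exact (hθ.comp hΦs hmem).comp (contDiff_id.prodMk contDiff_const).contDiffOn hline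
  · rw [(hαd s hs).deriv]
    exact hh _ (hmem _ (hline s hs)) _
  · rw [(hαd s hs).deriv] at h0
    have := hlθ _ (hline s hs) (1, 0)
    rw [h0, map_zero] at this
    exact zero_ne_one this
  · exact (hf.mono hΦU).congr fun u _ => hΦf u
  · have h1 := hconst _ (Φ.map_source hu)
    rw [Φ.left_inv hu] at h1
    exact ⟨((hbox _).1 (Φ.map_source hu)).1, congrArg Prod.snd (hΦf u), h1⟩

end Submersion

lemma hasFDerivAt_of_contDiffOn {E F : Type*} [NormedAddCommGroup E] [NormedSpace ℝ E]
    [NormedAddCommGroup F] [NormedSpace ℝ F] {U : Set E} (hU : IsOpen U) {g : E → F}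
    (hg : ContDiffOn ℝ ∞ g U) {u : E} (hu : u ∈ U) : HasFDerivAt g (fderiv ℝ g u) u :=
  ((hg.contDiffAt (hU.mem_nhds hu)).differentiableAt (by simp)).hasFDerivAt

/-! ### Maps into real points and derivatives of joins -/

section ProductDerivative
variable {E : Type*} [NormedAddCommGroup E] [NormedSpace ℝ E]

lemma hForm_real_real_im {n : ℕ} (ε : ℝ) {z w : Fin (n + 1) → ℂ} (hz : ∀ i, conj (z i) = z i)
    (hw : ∀ i, conj (w i) = w i) : (hForm ε z w).im = 0 := by
  have : conj (hForm ε z w) = hForm ε z w := by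
    simp only [hForm, map_add, map_sum, map_mul, Complex.conj_ofReal, hz, hw]
  exact Complex.conj_eq_iff_im.1 this

/-- The derivative of a map into the real points is real. -/
lemma conj_hasFDerivAt {n : ℕ} {f : E → Fin (n + 1) → ℂ} {f' : E →L[ℝ] Fin (n + 1) → ℂ} {u : E}
    (hf : HasFDerivAt f f' u) (hr : ∀ x i, conj (f x i) = f x i) (v : E) (i : Fin (n + 1)) :
    conj (f' v i) = f' v i := by
  have h1 := (hasFDerivAt_pi'.1 hf) i
  have h2 : HasFDerivAt (fun x => f x i) (Complex.conjCLE.toContinuousLinearMap.comp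
      ((ContinuousLinearMap.proj i).comp f')) u :=
    (Complex.conjCLE.toContinuousLinearMap.hasFDerivAt.comp u h1).congr_of_eventuallyEq
      (Filter.Eventually.of_forall fun x => (hr x i).symm)
  exact congrArg (fun L : E →L[ℝ] ℂ => L v) (h2.unique h1)

/-- Maps into the real points are automatically horizontal, because the form takes real values on
real vectors. -/
lemma hForm_real_hasFDerivAt {n : ℕ} {ε : ℝ} {f : E → Fin (n + 1) → ℂ}
    {f' : E →L[ℝ] Fin (n + 1) → ℂ} {u : E}
    (hf : HasFDerivAt f f' u) (hr : ∀ x i, conj (f x i) = f x i) (hq : ∀ x, f x ∈ quadric n ε)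
    (v : E) : hForm ε (f' v) (f u) = 0 :=
  hForm_hasFDerivAt_eq_zero ε hf (Filter.Eventually.of_forall hq) (by
    rw [liouville_eq]
    exact hForm_real_real_im ε (conj_hasFDerivAt hf hr v) (hr u))

lemma hasFDerivAt_join {n₁ n₂ : ℕ} {a b : E → ℂ} {ψ₁ : E → Fin (n₁ + 1) → ℂ}
    {ψ₂ : E → Fin (n₂ + 1) → ℂ} {a' b' : E →L[ℝ] ℂ} {ψ₁' : E →L[ℝ] Fin (n₁ + 1) → ℂ}
    {ψ₂' : E →L[ℝ] Fin (n₂ + 1) → ℂ} {u : E} (ha : HasFDerivAt a a' u) (hb : HasFDerivAt b b' u)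
    (h₁ : HasFDerivAt ψ₁ ψ₁' u) (h₂ : HasFDerivAt ψ₂ ψ₂' u) :
    HasFDerivAt (fun x => join (a x • ψ₁ x) (b x • ψ₂ x))
      ((joinCLM n₁ n₂).comp ((a u • ψ₁' + a'.smulRight (ψ₁ u)).prod
        (b u • ψ₂' + b'.smulRight (ψ₂ u)))) u :=
  (joinCLM n₁ n₂).hasFDerivAt.comp u ((ha.smul h₁).prodMk (hb.smul h₂))

end ProductDerivative

/-! ### From a product of real quadrics to a Legendre curve -/

section Standard
variable {E E₁ E₂ : Type*} [NormedAddCommGroup E] [NormedSpace ℝ E] [FiniteDimensional ℝ E]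
  [NormedAddCommGroup E₁] [NormedSpace ℝ E₁] [FiniteDimensional ℝ E₁]
  [NormedAddCommGroup E₂] [NormedSpace ℝ E₂] [FiniteDimensional ℝ E₂] {n₁ n₂ : ℕ}

/-- If a Legendrian immersion is `(a x, b y)` for points `x`, `y` of real quadrics, then it has
coordinates in which `(a, b)` is a Legendre curve. -/
lemma exists_legendreCurve_of_eq_join {U : Set E} (hU : IsOpen U)
    {f : E → Fin (n₁ + 1 + n₂ + 1) → ℂ} {a b : E → ℂ} {X₁ : E → E₁} {X₂ : E → E₂}
    {S₁ : E₁ → Fin (n₁ + 1) → ℂ} {S₂ : E₂ → Fin (n₂ + 1) → ℂ}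
    (ha : ContDiffOn ℝ ∞ a U) (hb : ContDiffOn ℝ ∞ b U) (hX₁ : ContDiffOn ℝ ∞ X₁ U)
    (hX₂ : ContDiffOn ℝ ∞ X₂ U) (hS₁ : ContDiff ℝ ∞ S₁) (hS₂ : ContDiff ℝ ∞ S₂)
    (hr₁ : ∀ x i, conj (S₁ x i) = S₁ x i) (hr₂ : ∀ x i, conj (S₂ x i) = S₂ x i)
    (hq₁ : ∀ x, S₁ x ∈ quadric n₁ 1) (hq₂ : ∀ x, S₂ x ∈ quadric n₂ (-1))
    (hf : ∀ u ∈ U, f u = join (a u • S₁ (X₁ u)) (b u • S₂ (X₂ u)))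
    (hfq : ∀ u ∈ U, f u ∈ quadric (n₁ + 1 + n₂) (-1))
    (hfh : ∀ u ∈ U, ∀ v, liouville (-1) (f u) (fderiv ℝ f u v) = 0)
    (hdim : Module.finrank ℝ E = Module.finrank ℝ (E₁ × E₂) + 1) {u₀ : E} (hu₀ : u₀ ∈ U)
    (hinj : Function.Injective (fderiv ℝ f u₀)) :
    ∃ (I : Set ℝ) (α : ℝ → Fin 2 → ℂ) (Φ : OpenPartialHomeomorph E (ℝ × E₁ × E₂)),
      IsLegendreCurve I α ∧ u₀ ∈ Φ.source ∧ Φ.source ⊆ U ∧ ContDiffOn ℝ ∞ Φ Φ.source ∧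
      ContDiffOn ℝ ∞ Φ.symm Φ.target ∧ (∀ s ∈ I, ∃ u ∈ U, α s = ![a u, b u]) ∧
      ∀ u ∈ Φ.source, (Φ u).1 ∈ I ∧ (Φ u).2 = (X₁ u, X₂ u) ∧ ![a u, b u] = α (Φ u).1 := by
  have hd₁ : ∀ x, HasFDerivAt S₁ (fderiv ℝ S₁ x) x := fun x =>
    (hS₁.differentiable (by simp) x).hasFDerivAt
  have hd₂ : ∀ x, HasFDerivAt S₂ (fderiv ℝ S₂ x) x := fun x =>
    (hS₂.differentiable (by simp) x).hasFDerivAt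
  have hfd : ∀ u ∈ U, HasFDerivAt f ((joinCLM n₁ n₂).comp
      ((a u • ((fderiv ℝ S₁ (X₁ u)).comp (fderiv ℝ X₁ u)) + (fderiv ℝ a u).smulRight (S₁ (X₁ u))).prod
        (b u • ((fderiv ℝ S₂ (X₂ u)).comp (fderiv ℝ X₂ u)) +
          (fderiv ℝ b u).smulRight (S₂ (X₂ u))))) u := fun u hu =>
    (hasFDerivAt_join (hasFDerivAt_of_contDiffOn hU ha hu) (hasFDerivAt_of_contDiffOn hU hb hu) ((hd₁ _).comp u (hasFDerivAt_of_contDiffOn hU hX₁ hu))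
      ((hd₂ _).comp u (hasFDerivAt_of_contDiffOn hU hX₂ hu))).congr_of_eventuallyEq
        (Filter.eventually_of_mem (hU.mem_nhds hu) hf)
  have hfd' : ∀ u ∈ U, ∀ v, fderiv ℝ f u v =
      join (a u • fderiv ℝ S₁ (X₁ u) (fderiv ℝ X₁ u v) + fderiv ℝ a u v • S₁ (X₁ u))
        (b u • fderiv ℝ S₂ (X₂ u) (fderiv ℝ X₂ u v) + fderiv ℝ b u v • S₂ (X₂ u)) :=
    fun u hu v => by rw [(hfd u hu).fderiv]; rfl
  have hθd : ∀ u ∈ U, HasFDerivAt (fun u => ![a u, b u])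
      (ContinuousLinearMap.pi ![fderiv ℝ a u, fderiv ℝ b u]) u := by
    intro u hu
    rw [hasFDerivAt_pi']
    intro i
    fin_cases i
    · exact hasFDerivAt_of_contDiffOn hU ha hu
    · exact hasFDerivAt_of_contDiffOn hU hb hu
  have hθd' : ∀ u ∈ U, ∀ v, fderiv ℝ (fun u => ![a u, b u]) u v =
      ![fderiv ℝ a u v, fderiv ℝ b u v] := by
    intro u hu v
    rw [(hθd u hu).fderiv]
    ext i; fin_cases i <;> rfl
  have hθ : ContDiffOn ℝ ∞ (fun u => ![a u, b u]) U := by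
    rw [contDiffOn_pi]
    intro i
    fin_cases i
    · exact ha
    · exact hb
  -- The points `S₁` and `S₂` have squares `1` and `-1`, so `(c, d) ↦ (c S₁, d S₂)` embeds `ℂ²` with
  -- its form of signature `(1, 1)` isometrically.
  have hform : ∀ u (c d c' d' : ℂ), hForm (-1) (join (c • S₁ (X₁ u)) (d • S₂ (X₂ u)))
      (join (c' • S₁ (X₁ u)) (d' • S₂ (X₂ u))) = hForm (-1) ![c, d] ![c', d'] := by
    intro u c d c' d'
    rw [hForm_join, hForm_smul_left, hForm_smul_left, hForm_smul_right, hForm_smul_right,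
      hq₁ (X₁ u), hq₂ (X₂ u), hForm_one_eq]
    simp
  refine exists_legendreCurve_of_horizontal hU hθ (hX₁.prodMk hX₂) ?_ ?_ hdim hu₀ ?_
  · intro u hu
    have := hfq u hu
    rw [mem_quadric, hf u hu, hform] at this
    exact this
  · intro u hu v
    have h1 := hfh u hu v
    -- The derivatives of `S₁` and `S₂` are orthogonal to `S₁` and `S₂`. Only the derivatives of `a`
    -- and `b` survive in the contact form.
    rw [liouville_eq, hfd' u hu, hf u hu, hForm_join, hForm_add_left, hForm_add_left,
      hForm_smul_left, hForm_smul_right _ (a u), hForm_smul_left _ (b u), hForm_smul_right _ (b u),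
      hForm_real_hasFDerivAt (hd₁ _) hr₁ hq₁, hForm_real_hasFDerivAt (hd₂ _) hr₂ hq₂, mul_zero,
      mul_zero, mul_zero, mul_zero, zero_add, zero_add, ← hForm_join, hform] at h1
    rw [liouville_eq, hθd' u hu]
    exact h1
  · intro v hv hXv
    rw [hθd' u₀ hu₀] at hv
    have hXd : HasFDerivAt (fun u => (X₁ u, X₂ u)) _ u₀ := (hasFDerivAt_of_contDiffOn hU hX₁ hu₀).prodMk (hasFDerivAt_of_contDiffOn hU hX₂ hu₀)
    rw [hXd.fderiv] at hXv
    have e1 : fderiv ℝ X₁ u₀ v = 0 := congrArg Prod.fst hXv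
    have e2 : fderiv ℝ X₂ u₀ v = 0 := congrArg Prod.snd hXv
    have e3 : fderiv ℝ a u₀ v = 0 := congrFun hv 0
    have e4 : fderiv ℝ b u₀ v = 0 := congrFun hv 1
    apply hinj
    rw [hfd' u₀ hu₀, e1, e2, e3, e4, map_zero, map_zero, map_zero]
    exact join_ext (by simp; rfl) (by simp; rfl)

end Standard

/-! ### Charts of the sphere and of hyperbolic space -/

section Sphere

/-- The charts of the sphere are restrictions of smooth functions. -/
lemma exists_contDiffOn_eq_chart_sphere (n : ℕ) (v : RS n) :
    ∃ κ : EuclideanSpace ℝ (Fin (n + 1)) → EuclideanSpace ℝ (Fin n),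
      ContDiffOn ℝ ∞ κ {x | innerSL ℝ (-v : RS n).1 x ≠ (1 : ℝ)} ∧
      ∀ x : RS n, κ x.1 = extChartAt (𝓡 n) v x := by
  have : Fact (Module.finrank ℝ (EuclideanSpace ℝ (Fin (n + 1))) = n + 1) :=
    ⟨finrank_euclideanSpace_fin⟩
  let U : _ ≃ₗᵢ[ℝ] EuclideanSpace ℝ (Fin n) :=
    (OrthonormalBasis.fromOrthogonalSpanSingleton (𝕜 := ℝ)
        n (ne_zero_of_mem_unit_sphere (-v))).repr
  exact ⟨fun x => U (stereoToFun (-v : RS n).1 x),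
    U.contDiff.comp_contDiffOn contDiffOn_stereoToFun, fun x => rfl⟩

/-- The chart at `v` is the stereographic projection from `-v`, and `-v` is the only unit vector
whose product with `-v` is `1`. -/
lemma mem_source_chart_sphere (n : ℕ) (v x : RS n) (h : innerSL ℝ (-v : RS n).1 x.1 ≠ (1 : ℝ)) :
    x ∈ (extChartAt (𝓡 n) v).source := by
  have : Fact (Module.finrank ℝ (EuclideanSpace ℝ (Fin (n + 1))) = n + 1) :=
    ⟨finrank_euclideanSpace_fin⟩
  rw [extChartAt_source]
  change x ∈ (stereographic' n (-v)).source
  rw [stereographic'_source]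
  rintro rfl
  apply h
  rw [innerSL_apply_apply, real_inner_self_eq_norm_sq, norm_eq_of_mem_sphere]; norm_num

lemma inner_neg_self_sphere_ne_one (n : ℕ) (v : RS n) :
    innerSL ℝ (-v : RS n).1 v.1 ≠ (1 : ℝ) := by
  rw [innerSL_apply_apply, show (-v : RS n).1 = -v.1 from rfl, inner_neg_left,
    real_inner_self_eq_norm_sq, norm_eq_of_mem_sphere]; norm_num

lemma target_chart_sphere (n : ℕ) (v : RS n) : (extChartAt (𝓡 n) v).target = Set.univ := by
  have : Fact (Module.finrank ℝ (EuclideanSpace ℝ (Fin (n + 1))) = n + 1) :=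
    ⟨finrank_euclideanSpace_fin⟩
  rw [extChartAt_target]
  change (𝓡 n).symm ⁻¹' (stereographic' n (-v)).target ∩ Set.range (𝓡 n) = _
  simp

lemma contDiff_coe_chart_symm_sphere (n : ℕ) (v : RS n) :
    ContDiff ℝ ∞ fun ξ => ((extChartAt (𝓡 n) v).symm ξ).1 := by
  have : Fact (Module.finrank ℝ (EuclideanSpace ℝ (Fin (n + 1))) = n + 1) :=
    ⟨finrank_euclideanSpace_fin⟩
  have h := (contMDiff_iff.1 (contMDiff_coe_sphere (m := ∞) (n := n)
    (E := EuclideanSpace ℝ (Fin (n + 1))))).2 v 0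
  rw [← contDiffOn_univ]
  refine h.mono ?_
  rw [target_chart_sphere, extChartAt_model_space_eq_id]
  simp

lemma contDiff_sphereIncl_chart_symm (n : ℕ) (v : RS n) :
    ContDiff ℝ ∞ fun ξ => sphereIncl n ((extChartAt (𝓡 n) v).symm ξ) := by
  refine contDiff_pi.2 fun i => Complex.ofRealCLM.contDiff.comp ?_
  exact (contDiff_euclidean.1 (contDiff_coe_chart_symm_sphere n v)) i

lemma sphereIncl_mem_quadric (n : ℕ) (x : RS n) : sphereIncl n x ∈ quadric n 1 := by
  have h : ∑ i, x.1 i ^ 2 = 1 := by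
    rw [← EuclideanSpace.real_norm_sq_eq, norm_eq_of_mem_sphere]; norm_num
  rw [mem_quadric]
  simp only [hForm, sphereIncl, Complex.conj_ofReal, Complex.ofReal_one, one_mul]
  rw [Fin.sum_univ_castSucc] at h
  norm_cast
  simpa only [pow_two] using h

lemma hypIncl_mem_quadric (n : ℕ) (y : RH n) : hypIncl n y ∈ quadric n (-1) := by
  rw [mem_quadric]
  simp only [hForm, hypIncl, Complex.conj_ofReal]
  have h : ∑ i : Fin n, y.1 i.castSucc * y.1 i.castSucc
      + (-1) * (y.1 (Fin.last n) * y.1 (Fin.last n)) = -1 := by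
    have := y.2.1
    simp only [pow_two] at this
    linarith
  exact_mod_cast congrArg ((↑) : ℝ → ℂ) h

lemma chart_symm_RH (n : ℕ) (v : RH n) (η : EuclideanSpace ℝ (Fin n)) :
    (extChartAt (𝓡 n) v).symm η = (RH.homeo n).symm η := rfl

lemma contDiff_hypIncl_chart_symm (n : ℕ) (v : RH n) :
    ContDiff ℝ ∞ fun η => hypIncl n ((extChartAt (𝓡 n) v).symm η) := by
  simp only [chart_symm_RH]
  refine contDiff_pi.2 fun i => Complex.ofRealCLM.contDiff.comp ?_
  refine Fin.lastCases ?_ (fun i => ?_) i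
  · have : (fun η : EuclideanSpace ℝ (Fin n) => ((RH.homeo n).symm η).1 (Fin.last n)) =
        fun η => √(1 + ∑ i, η i ^ 2) := by
      ext η; exact Fin.snoc_last (α := fun _ => ℝ) _ _
    have h : ContDiff ℝ ∞ fun η : EuclideanSpace ℝ (Fin n) => ((RH.homeo n).symm η).1 (Fin.last n) := by
      rw [this]
      -- The square root is smooth since its argument is at least `1`.
      refine ContDiff.sqrt (by fun_prop) fun η => ne_of_gt ?_
      exact add_pos_of_pos_of_nonneg one_pos (Finset.sum_nonneg fun i _ => sq_nonneg _)
    exact h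
  · have : (fun η : EuclideanSpace ℝ (Fin n) => ((RH.homeo n).symm η).1 i.castSucc) =
        fun η => η i := by
      ext η; exact Fin.snoc_castSucc (α := fun _ => ℝ) _ _ _
    have h : ContDiff ℝ ∞ fun η : EuclideanSpace ℝ (Fin n) => ((RH.homeo n).symm η).1 i.castSucc := by
      rw [this]
      fun_prop
    exact h

end Sphere

/-! ### From Euclidean coordinates to partial diffeomorphisms -/

section StandardNear
variable {n₁ n₂ : ℕ} {M : Type*} [TopologicalSpace M]
  [ChartedSpace (EuclideanSpace ℝ (Fin (n₁ + 1 + n₂))) M]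
  [IsManifold (𝓡 (n₁ + 1 + n₂)) ∞ M]

/-- Coordinates in which a map is `(α₁(s) x, α₂(s) y)` give the standard form. -/
lemma isStandardNear_of_coordinates {φ : M → Fin (n₁ + 1 + n₂ + 1) → ℂ} {p : M}
    {I : Set ℝ} {α : ℝ → Fin 2 → ℂ} (hα : IsLegendreCurve I α) (hα0 : ∀ s ∈ I, α s 0 ≠ 0)
    (v : RS n₁) (w : RH n₂)
    (Φ : OpenPartialHomeomorph (EuclideanSpace ℝ (Fin (n₁ + 1 + n₂)))
      (ℝ × EuclideanSpace ℝ (Fin n₁) × EuclideanSpace ℝ (Fin n₂)))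
    (hp : extChartAt (𝓡 (n₁ + 1 + n₂)) p p ∈ Φ.source)
    (hsub : Φ.source ⊆ (extChartAt (𝓡 (n₁ + 1 + n₂)) p).target)
    (hΦ : ContDiffOn ℝ ∞ Φ Φ.source) (hΦs : ContDiffOn ℝ ∞ Φ.symm Φ.target)
    (h : ∀ u ∈ Φ.source, (Φ u).1 ∈ I ∧ φ ((extChartAt (𝓡 (n₁ + 1 + n₂)) p).symm u) =
      join (α (Φ u).1 0 • sphereIncl n₁ ((extChartAt (𝓡 n₁) v).symm (Φ u).2.1))
        (α (Φ u).1 1 • hypIncl n₂ ((extChartAt (𝓡 n₂) w).symm (Φ u).2.2))) :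
    IsStandardNear φ p := by
  refine ⟨I, α, hα, hα0, ?_⟩
  -- The first entry `0` is arbitrary, because the chart of the line is the identity at every point.
  let c := extChartAt (prodModel n₁ n₂) ((0, v, w) : ℝ × RS n₁ × RH n₂)
  let e := extChartAt (𝓡 (n₁ + 1 + n₂)) p
  have hc : ∀ x : ℝ × RS n₁ × RH n₂,
      c x = (x.1, extChartAt (𝓡 n₁) v x.2.1, extChartAt (𝓡 n₂) w x.2.2) := fun x => rfl
  -- All three charts are onto, so composing with the inverse of `c` puts no condition on the
  -- coordinates.
  have hct : c.target = Set.univ := by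
    simp only [c, extChartAt_prod, PartialEquiv.prod_target, target_chart_sphere]
    have : (extChartAt (𝓡 n₂) w).target = Set.univ := by
      rw [extChartAt_target]
      simp only [mfld_simps]
    rw [this, extChartAt_model_space_eq_id]; simp
  have hcs : IsOpen c.source := isOpen_extChartAt_source _
  have hes : IsOpen e.source := isOpen_extChartAt_source _
  have hcm : ContMDiffOn (prodModel n₁ n₂)
      𝓘(ℝ, ℝ × EuclideanSpace ℝ (Fin n₁) × EuclideanSpace ℝ (Fin n₂)) ∞ c c.source := by
    have := contMDiffOn_extChartAt (I := prodModel n₁ n₂) (n := ∞) (x := ((0, v, w) : ℝ × RS n₁ × RH n₂))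
    rwa [← extChartAt_source (prodModel n₁ n₂)] at this
  have hem : ContMDiffOn (𝓡 (n₁ + 1 + n₂)) 𝓘(ℝ, EuclideanSpace ℝ (Fin (n₁ + 1 + n₂))) ∞ e e.source := by
    have := contMDiffOn_extChartAt (I := 𝓡 (n₁ + 1 + n₂)) (n := ∞) (x := p)
    rwa [← extChartAt_source (𝓡 (n₁ + 1 + n₂))] at this
  let F : PartialEquiv (ℝ × RS n₁ × RH n₂) M :=
    (c.trans Φ.symm.toPartialEquiv).trans e.symm
  have hFs : F.source = c.source ∩ c ⁻¹' Φ.target := by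
    ext x
    simp only [F, PartialEquiv.trans_source, Set.mem_inter_iff, Set.mem_preimage]
    constructor
    · exact fun hx => hx.1
    · exact fun hx => ⟨hx, hsub (Φ.map_target hx.2)⟩
  have hFt : F.target = e.source ∩ e ⁻¹' Φ.source := by
    ext x
    simp [F, PartialEquiv.trans_target, hct]
  refine ⟨⟨F, ?_, ?_, ?_, ?_⟩, ?_, ?_⟩
  · rw [hFs]
    exact hcm.continuousOn.isOpen_inter_preimage hcs Φ.open_target
  · rw [hFt]
    exact hem.continuousOn.isOpen_inter_preimage hes Φ.open_source
  · rw [hFs]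
    refine ((contMDiffOn_extChartAt_symm p).comp (hΦs.contMDiffOn.comp
      (hcm.mono Set.inter_subset_left) fun x hx => hx.2) fun x hx => ?_)
    exact hsub (Φ.map_target hx.2)
  · rw [hFt]
    refine ((contMDiffOn_extChartAt_symm ((0, v, w) : ℝ × RS n₁ × RH n₂)).comp (hΦ.contMDiffOn.comp
      (hem.mono Set.inter_subset_left) fun x hx => hx.2) fun x hx => ?_)
    exact hct ▸ Set.mem_univ _
  · change p ∈ F.target
    rw [hFt]
    exact ⟨mem_extChartAt_source p, hp⟩
  · intro x hx
    change x ∈ F.source at hx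
    rw [hFs] at hx
    obtain ⟨h1, h2⟩ := h _ (Φ.map_target hx.2)
    rw [Φ.right_inv hx.2] at h1 h2
    have h3 : extChartAt (𝓡 n₁) v x.2.1 = (c x).2.1 := rfl
    refine ⟨h1, h2.trans ?_⟩
    have hx1 := hx.1
    simp only [c, extChartAt_prod, PartialEquiv.prod_source, Set.mem_prod] at hx1
    rw [hc, PartialEquiv.left_inv _ hx1.2.1, PartialEquiv.left_inv _ hx1.2.2]
    rfl

end StandardNear

/-! ### Legendrian immersions in a chart -/

section Coordinates
variable {n m : ℕ} {M : Type*} [TopologicalSpace M]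
  [ChartedSpace (EuclideanSpace ℝ (Fin m)) M] [IsManifold (𝓡 m) ∞ M]
  {ε : ℝ} {φ : M → Fin (n + 1) → ℂ}

lemma contDiffOn_comp_chart_symm (hφ : ContMDiff (𝓡 m) 𝓘(ℝ, Fin (n + 1) → ℂ) ∞ φ) (p : M) :
    ContDiffOn ℝ ∞ (fun u => φ ((extChartAt (𝓡 m) p).symm u)) (extChartAt (𝓡 m) p).target :=
  (hφ.comp_contMDiffOn (contMDiffOn_extChartAt_symm p)).contDiffOn

/-- The derivative of the expression of a map in a chart. -/
lemma exists_fderiv_comp_chart_symm (hφ : ContMDiff (𝓡 m) 𝓘(ℝ, Fin (n + 1) → ℂ) ∞ φ) (p : M)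
    {u : EuclideanSpace ℝ (Fin m)} (hu : u ∈ (extChartAt (𝓡 m) p).target) :
    ∃ L : EuclideanSpace ℝ (Fin m) →L[ℝ] TangentSpace (𝓡 m) ((extChartAt (𝓡 m) p).symm u),
      Function.Injective L ∧
      ∀ v, fderiv ℝ (fun u => φ ((extChartAt (𝓡 m) p).symm u)) u v =
        mvfderiv (𝓡 m) φ ((extChartAt (𝓡 m) p).symm u) (L v) := by
  -- The model has no boundary, so derivatives within its range are ordinary derivatives.
  have hinv : (mfderiv 𝓘(ℝ, EuclideanSpace ℝ (Fin m)) (𝓡 m) (extChartAt (𝓡 m) p).symm u).IsInvertible := by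
    have := isInvertible_mfderivWithin_extChartAt_symm (I := 𝓡 m) (x := p) hu
    rwa [(𝓡 m).range_eq_univ, mfderivWithin_univ] at this
  refine ⟨_, hinv.injective, fun v => ?_⟩
  have h1 : MDifferentiableAt 𝓘(ℝ, EuclideanSpace ℝ (Fin m)) (𝓡 m) (extChartAt (𝓡 m) p).symm u :=
    mdifferentiableAt_of_isInvertible_mfderiv hinv
  have h2 := mfderiv_comp u (hφ.mdifferentiableAt (by simp)
    (x := (extChartAt (𝓡 m) p).symm u)) h1
  rw [mfderiv_eq_fderiv] at h2
  exact congrArg (fun L => L v) h2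

lemma IsLegendrianMap.liouville_fderiv_comp_chart_symm (hφ : IsLegendrianMap (𝓡 m) ε φ) (p : M)
    {u : EuclideanSpace ℝ (Fin m)} (hu : u ∈ (extChartAt (𝓡 m) p).target)
    (v : EuclideanSpace ℝ (Fin m)) :
    liouville ε (φ ((extChartAt (𝓡 m) p).symm u))
      (fderiv ℝ (fun u => φ ((extChartAt (𝓡 m) p).symm u)) u v) = 0 := by
  obtain ⟨L, -, hL⟩ := exists_fderiv_comp_chart_symm hφ.smooth p hu
  rw [hL]
  exact hφ.horizontal _ _

lemma IsLegendrianImmersion.injective_fderiv_comp_chart_symm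
    (hφ : IsLegendrianImmersion (𝓡 m) ε φ) (p : M)
    {u : EuclideanSpace ℝ (Fin m)} (hu : u ∈ (extChartAt (𝓡 m) p).target) :
    Function.Injective (fderiv ℝ (fun u => φ ((extChartAt (𝓡 m) p).symm u)) u) := by
  obtain ⟨L, hinj, hL⟩ := exists_fderiv_comp_chart_symm hφ.smooth p hu
  intro v w hvw
  rw [hL, hL] at hvw
  exact hinj (hφ.immersive _ hvw)

end Coordinates

/-! ### Points with vanishing moment -/

section RealMultiples

/-- Up to the positive factor `|w|⁻²`, the quotient `z / w` is `z * conj w`, so it is real. -/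
lemma eq_re_div_mul {z w : ℂ} (hw : w ≠ 0) (h : (z * conj w).im = 0) :
    z = ((z / w).re : ℂ) * w := by
  have : (z / w).im = 0 := by
    rw [div_eq_mul_inv, Complex.inv_def, ← mul_assoc, Complex.im_mul_ofReal, h, zero_mul]
  rw [show ((z / w).re : ℂ) = z / w from Complex.ext (by simp) (by simp [this]),
    div_mul_cancel₀ _ hw]

lemma contDiffOn_re_div {E : Type*} [NormedAddCommGroup E] [NormedSpace ℝ E] {U : Set E}
    {g h : E → ℂ} (hg : ContDiffOn ℝ ∞ g U) (hh : ContDiffOn ℝ ∞ h U) (h0 : ∀ u ∈ U, h u ≠ 0) :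
    ContDiffOn ℝ ∞ (fun u => (g u / h u).re) U := by
  simp only [div_eq_mul_inv]
  exact Complex.reCLM.contDiff.comp_contDiffOn (hg.mul (hh.inv h0))

/-- The moment map of the block diagonal action vanishes: the components of each block are real
multiples of each other. -/
structure IsRealBlocks {n₁ n₂ : ℕ} (z : Fin (n₁ + 1 + n₂ + 1) → ℂ) : Prop where
  fst : ∀ i j, (fstPart z i * conj (fstPart z j)).im = 0
  snd : ∀ i : Fin n₂, (sndPart z i.castSucc * conj (sndPart z (Fin.last n₂))).im = 0

lemma hForm_self_eq {n : ℕ} (ε : ℝ) (z : Fin (n + 1) → ℂ) :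
    hForm ε z z = ((∑ i : Fin n, ‖z i.castSucc‖ ^ 2 + ε * ‖z (Fin.last n)‖ ^ 2 : ℝ) : ℂ) := by
  simp only [hForm, Complex.mul_conj, Complex.normSq_eq_norm_sq]
  push_cast; rfl

/-- This is the equation of the quadric, solved for its only negative direction. It makes the last
component a safe denominator and later yields `D > 0`. -/
lemma norm_sndPart_last {n₁ n₂ : ℕ} {z : Fin (n₁ + 1 + n₂ + 1) → ℂ}
    (hz : z ∈ quadric (n₁ + 1 + n₂) (-1)) :
    ∑ i, ‖fstPart z i‖ ^ 2 + ∑ i : Fin n₂, ‖sndPart z i.castSucc‖ ^ 2 + 1 =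
      ‖sndPart z (Fin.last n₂)‖ ^ 2 := by
  rw [mem_quadric, hForm_parts, hForm_self_eq, hForm_self_eq] at hz
  rw [Fin.sum_univ_castSucc]
  rw [← Complex.ofReal_add, Complex.ofReal_inj] at hz
  linarith

lemma sndPart_last_ne_zero {n₁ n₂ : ℕ} {z : Fin (n₁ + 1 + n₂ + 1) → ℂ}
    (hz : z ∈ quadric (n₁ + 1 + n₂) (-1)) : sndPart z (Fin.last n₂) ≠ 0 := by
  intro h
  have := norm_sndPart_last hz
  rw [h, norm_zero] at this
  have h1 : 0 ≤ ∑ i, ‖fstPart z i‖ ^ 2 := Finset.sum_nonneg fun i _ => sq_nonneg _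
  have h2 : 0 ≤ ∑ i : Fin n₂, ‖sndPart z i.castSucc‖ ^ 2 := Finset.sum_nonneg fun i _ => sq_nonneg _
  linarith

end RealMultiples

/-! ### The standard form where the moment map vanishes -/

section Standard
variable {n₁ n₂ : ℕ} {M : Type*} [TopologicalSpace M]
  [ChartedSpace (EuclideanSpace ℝ (Fin (n₁ + 1 + n₂))) M]
  [IsManifold (𝓡 (n₁ + 1 + n₂)) ∞ M]

/-- A Legendrian immersion on which the moment map vanishes has the standard form where the first
component is not zero. -/
theorem isStandardNear_of_isRealBlocks {φ : M → Fin (n₁ + 1 + n₂ + 1) → ℂ}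
    (hφ : IsLegendrianImmersion (𝓡 (n₁ + 1 + n₂)) (-1) φ) (hreal : ∀ q, IsRealBlocks (φ q)) {p : M}
    (hp : fstPart (φ p) ≠ 0) : IsStandardNear φ p := by
  set e := extChartAt (𝓡 (n₁ + 1 + n₂)) p with he
  let f : EuclideanSpace ℝ (Fin (n₁ + 1 + n₂)) → Fin (n₁ + 1 + n₂ + 1) → ℂ := fun u => φ (e.symm u)
  have hT : IsOpen e.target := isOpen_extChartAt_target p
  have hf : ContDiffOn ℝ ∞ f e.target := contDiffOn_comp_chart_symm hφ.smooth p
  have hfi : ∀ i, ContDiffOn ℝ ∞ (fun u => f u i) e.target := fun i => contDiffOn_pi.1 hf i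
  have hfq : ∀ u, f u ∈ quadric (n₁ + 1 + n₂) (-1) := fun u => hφ.mem_quadric _
  obtain ⟨k, hk⟩ : ∃ k, fstPart (φ p) k ≠ 0 := by
    by_contra! h
    exact hp (funext h)
  have hfp : f (e p) = φ p := congrArg φ (extChartAt_to_inv p)
  have hlast : ∀ u, sndPart (f u) (Fin.last n₂) ≠ 0 := fun u => sndPart_last_ne_zero (hfq u)
  let U₁ := e.target ∩ {u | fstPart (f u) k ≠ 0}
  have hU₁ : IsOpen U₁ :=
    (hfi (Fin.castAdd (n₂ + 1) k)).continuousOn.isOpen_inter_preimage hT isOpen_compl_singleton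
  -- The first block is its `k`-th component times `ρ`: the quotients are real, so taking real parts
  -- loses nothing. Normalizing `ρ` gives the point `x` of the sphere.
  let ρ : EuclideanSpace ℝ (Fin (n₁ + 1 + n₂)) → EuclideanSpace ℝ (Fin (n₁ + 1)) :=
    fun u => WithLp.toLp 2 fun i => (fstPart (f u) i / fstPart (f u) k).re
  have hρ : ContDiffOn ℝ ∞ ρ U₁ := contDiffOn_euclidean.2 fun i =>
    contDiffOn_re_div ((hfi _).mono Set.inter_subset_left) ((hfi _).mono Set.inter_subset_left)
      fun u hu => hu.2
  have hρ0 : ∀ u ∈ U₁, ρ u ≠ 0 := by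
    intro u hu h
    have h1 : (fstPart (f u) k / fstPart (f u) k).re = 0 := congrArg (fun x => x.ofLp k) h
    rw [div_self hu.2] at h1
    exact one_ne_zero h1
  let x : EuclideanSpace ℝ (Fin (n₁ + 1 + n₂)) → EuclideanSpace ℝ (Fin (n₁ + 1)) :=
    fun u => ‖ρ u‖⁻¹ • ρ u
  have hρn : ContDiffOn ℝ ∞ (fun u => ‖ρ u‖) U₁ := hρ.norm ℝ hρ0
  have hx : ContDiffOn ℝ ∞ x U₁ := (hρn.inv fun u hu => norm_ne_zero_iff.2 (hρ0 u hu)).smul hρ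
  have hxs : ∀ u ∈ U₁, x u ∈ Metric.sphere (0 : EuclideanSpace ℝ (Fin (n₁ + 1))) 1 := by
    intro u hu
    rw [mem_sphere_zero_iff_norm, norm_smul, norm_inv, norm_norm,
      inv_mul_cancel₀ (norm_ne_zero_iff.2 (hρ0 u hu))]
  have hp₁ : e p ∈ U₁ := ⟨mem_extChartAt_target p, by
    change fstPart (f (e p)) k ≠ 0
    rwa [hfp]⟩
  let v : RS n₁ := ⟨x (e p), hxs _ hp₁⟩
  obtain ⟨κ, hκ, hκv⟩ := exists_contDiffOn_eq_chart_sphere n₁ v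
  -- This keeps `x` away from `-v`, the pole of the chart at `v`.
  let U := U₁ ∩ x ⁻¹' {y | innerSL ℝ (-v : RS n₁).1 y ≠ (1 : ℝ)}
  have hU : IsOpen U := hx.continuousOn.isOpen_inter_preimage hU₁
    (isOpen_ne_fun (by fun_prop) continuous_const)
  have hUT : U ⊆ e.target := fun u hu => hu.1.1
  have hpU : e p ∈ U := ⟨hp₁, inner_neg_self_sphere_ne_one n₁ v⟩
  let σ : Fin (n₂ + 1) → EuclideanSpace ℝ (Fin (n₁ + 1 + n₂)) → ℝ :=
    fun i u => (sndPart (f u) i / sndPart (f u) (Fin.last n₂)).re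
  have hσ : ∀ i, ContDiffOn ℝ ∞ (σ i) U := fun i =>
    contDiffOn_re_div ((hfi _).mono hUT) ((hfi _).mono hUT) fun u _ => hlast u
  have hσeq : ∀ u (i : Fin n₂), sndPart (f u) i.castSucc =
      (σ i.castSucc u : ℂ) * sndPart (f u) (Fin.last n₂) := fun u i =>
    eq_re_div_mul (hlast u) ((hreal _).snd i)
  -- The second block is its last component times the real vector `(σ, 1)`, whose square is `-D`.
  -- The equation of the quadric gives `D > 0`, so division by `√D` leads to hyperbolic space.
  let D : EuclideanSpace ℝ (Fin (n₁ + 1 + n₂)) → ℝ := fun u => 1 - ∑ i : Fin n₂, σ i.castSucc u ^ 2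
  have hD : ContDiffOn ℝ ∞ D U :=
    contDiffOn_const.sub (ContDiffOn.sum fun i _ => (hσ i.castSucc).pow 2)
  have hD0 : ∀ u, 0 < D u := by
    intro u
    have h1 := norm_sndPart_last (hfq u)
    have h2 : ∑ i : Fin n₂, ‖sndPart (f u) i.castSucc‖ ^ 2 =
        (∑ i : Fin n₂, σ i.castSucc u ^ 2) * ‖sndPart (f u) (Fin.last n₂)‖ ^ 2 := by
      rw [Finset.sum_mul]
      refine Finset.sum_congr rfl fun i _ => ?_
      rw [hσeq, norm_mul, mul_pow, Complex.norm_real, Real.norm_eq_abs, sq_abs]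
    have h3 : 0 ≤ ∑ i, ‖fstPart (f u) i‖ ^ 2 := Finset.sum_nonneg fun i _ => sq_nonneg _
    have h4 : 0 < ‖sndPart (f u) (Fin.last n₂)‖ ^ 2 := pow_pos (norm_pos_iff.2 (hlast u)) 2
    refine pos_of_mul_pos_left (b := ‖sndPart (f u) (Fin.last n₂)‖ ^ 2) ?_ h4.le
    simp only [D, sub_mul, one_mul, ← h2]
    linarith
  have hsD : ContDiffOn ℝ ∞ (fun u => √(D u)) U := hD.sqrt fun u _ => (hD0 u).ne'
  have hsD0 : ∀ u, √(D u) ≠ 0 := fun u => (Real.sqrt_pos.2 (hD0 u)).ne'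
  let X₂ : EuclideanSpace ℝ (Fin (n₁ + 1 + n₂)) → EuclideanSpace ℝ (Fin n₂) :=
    fun u => WithLp.toLp 2 fun i => σ i.castSucc u / √(D u)
  have hX₂ : ContDiffOn ℝ ∞ X₂ U := contDiffOn_euclidean.2 fun i =>
    (hσ i.castSucc).div hsD fun u _ => hsD0 u
  -- The factors `a` and `b` absorb the normalizations of `ρ` and of `(σ, 1)`.
  let a : EuclideanSpace ℝ (Fin (n₁ + 1 + n₂)) → ℂ := fun u => (‖ρ u‖ : ℂ) * fstPart (f u) k
  let b : EuclideanSpace ℝ (Fin (n₁ + 1 + n₂)) → ℂ :=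
    fun u => (√(D u) : ℂ) * sndPart (f u) (Fin.last n₂)
  have ha : ContDiffOn ℝ ∞ a U :=
    (Complex.ofRealCLM.contDiff.comp_contDiffOn (hρn.mono Set.inter_subset_left)).mul
      ((hfi _).mono hUT)
  have hb : ContDiffOn ℝ ∞ b U :=
    (Complex.ofRealCLM.contDiff.comp_contDiffOn hsD).mul ((hfi _).mono hUT)
  -- Any base point would do, since hyperbolic space has a single global chart.
  let w : RH n₂ := (RH.homeo n₂).symm 0
  have hX₁ : ContDiffOn ℝ ∞ (fun u => κ (x u)) U :=
    hκ.comp (hx.mono Set.inter_subset_left) fun u hu => hu.2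
  have hS₁ : ∀ u ∈ U, ∀ i, sphereIncl n₁ ((extChartAt (𝓡 n₁) v).symm (κ (x u))) i = ((x u i : ℝ) : ℂ) := by
    intro u hu i
    have := hκv ⟨x u, hxs u hu.1⟩
    rw [this, PartialEquiv.left_inv _ (mem_source_chart_sphere n₁ v ⟨x u, hxs u hu.1⟩ hu.2)]
    rfl
  -- It identifies the last coordinate of the point over `X₂ u` as `1 / √D`.
  have hnorm2 : ∀ u, 1 + ∑ i, (X₂ u i) ^ 2 = (D u)⁻¹ := by
    intro u
    have h1 : ∀ i, X₂ u i ^ 2 = σ i.castSucc u ^ 2 * (D u)⁻¹ := fun i => by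
      change (σ i.castSucc u / √(D u)) ^ 2 = _
      rw [div_pow, Real.sq_sqrt (hD0 u).le, div_eq_mul_inv]
    simp only [h1]
    rw [← Finset.sum_mul, eq_comm, ← sub_eq_iff_eq_add, ← one_sub_mul]
    exact mul_inv_cancel₀ (hD0 u).ne'
  have hjoin : ∀ u ∈ U, f u = join (a u • sphereIncl n₁ ((extChartAt (𝓡 n₁) v).symm (κ (x u))))
      (b u • hypIncl n₂ ((extChartAt (𝓡 n₂) w).symm (X₂ u))) := by
    intro u hu
    refine join_ext ?_ ?_
    · rw [fstPart_join]
      ext i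
      rw [Pi.smul_apply, hS₁ u hu]
      have h1 : fstPart (f u) i = ((fstPart (f u) i / fstPart (f u) k).re : ℂ) * fstPart (f u) k :=
        eq_re_div_mul hu.1.2 ((hreal (e.symm u)).fst i k)
      have h2 : (‖ρ u‖ : ℂ) ≠ 0 := by
        simpa using hρ0 u hu.1
      change fstPart (f u) i = (‖ρ u‖ : ℂ) * fstPart (f u) k *
        ((‖ρ u‖⁻¹ * (fstPart (f u) i / fstPart (f u) k).re : ℝ) : ℂ)
      refine h1.trans ?_
      push_cast
      field_simp
    · rw [sndPart_join]
      ext i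
      rw [Pi.smul_apply, chart_symm_RH]
      have h2 : (√(D u) : ℂ) ≠ 0 := by exact_mod_cast hsD0 u
      refine Fin.lastCases ?_ (fun i => ?_) i
      · have h3 : hypIncl n₂ ((RH.homeo n₂).symm (X₂ u)) (Fin.last n₂) = ((√(D u))⁻¹ : ℝ) := by
          rw [← Real.sqrt_inv, ← hnorm2]
          exact congrArg _ (Fin.snoc_last (α := fun _ => ℝ) _ _)
        rw [h3, smul_eq_mul]
        push_cast
        simp only [b]
        field_simp
      · have h3 : hypIncl n₂ ((RH.homeo n₂).symm (X₂ u)) i.castSucc = (σ i.castSucc u / √(D u) : ℝ) :=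
          congrArg _ (Fin.snoc_castSucc (α := fun _ => ℝ) _ _ _)
        rw [h3, smul_eq_mul, hσeq]
        push_cast
        simp only [b]
        field_simp
  obtain ⟨I, α, Φ, hα, hΦp, hΦU, hΦ, hΦs, hIU, hval⟩ := exists_legendreCurve_of_eq_join hU
    (S₁ := fun ξ => sphereIncl n₁ ((extChartAt (𝓡 n₁) v).symm ξ))
    (S₂ := fun η => hypIncl n₂ ((extChartAt (𝓡 n₂) w).symm η)) ha hb hX₁ hX₂
    (contDiff_sphereIncl_chart_symm n₁ v) (contDiff_hypIncl_chart_symm n₂ w)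
    (fun _ _ => Complex.conj_ofReal _) (fun _ _ => Complex.conj_ofReal _)
    (fun _ => sphereIncl_mem_quadric _ _) (fun _ => hypIncl_mem_quadric _ _) hjoin
    (fun u _ => hfq u) (fun u hu v => hφ.toIsLegendrianMap.liouville_fderiv_comp_chart_symm p (hUT hu) v)
    (by simp; omega) hpU (hφ.injective_fderiv_comp_chart_symm p (hUT hpU))
  refine isStandardNear_of_coordinates hα ?_ v w Φ hΦp (hΦU.trans hUT) hΦ hΦs ?_
  · intro s hs h0
    obtain ⟨u, hu, hs'⟩ := hIU s hs
    rw [hs'] at h0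
    rcases mul_eq_zero.1 (show (‖ρ u‖ : ℂ) * fstPart (f u) k = 0 from h0) with h | h
    · exact hρ0 u hu.1 (by simpa using h)
    · exact hu.1.2 h
  · intro u hu
    obtain ⟨h1, h2, h3⟩ := hval u hu
    refine ⟨h1, ?_⟩
    rw [h2, ← h3]
    exact hjoin u (hΦU hu)

end Standard

/-! ### Orthogonal groups of real forms near the identity -/

section Pseudoorthogonal
variable {n : ℕ}

/-- The Gram matrix of the form `(z, w) = ∑_{i ≤ n} z_i w̄_i + ε z_{n+1} w̄_{n+1}`. -/
def gram (n : ℕ) (ε : ℝ) : Matrix (Fin (n + 1)) (Fin (n + 1)) ℝ :=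
  Matrix.diagonal (Fin.snoc (α := fun _ => ℝ) (fun _ : Fin n => 1) ε)

/-- The special orthogonal group of the form with Gram matrix `gram n ε`. -/
def pseudoSO (n : ℕ) (ε : ℝ) : Set (Matrix (Fin (n + 1)) (Fin (n + 1)) ℝ) :=
  {A | A.transpose * gram n ε * A = gram n ε ∧ A.det = 1}

lemma gram_one : gram n 1 = 1 := by
  rw [gram, ← Matrix.diagonal_one]
  congr 1
  ext i
  refine Fin.lastCases ?_ (fun i => ?_) i <;> simp

lemma gram_mul_gram {ε : ℝ} (hε : ε * ε = 1) : gram n ε * gram n ε = 1 := by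
  rw [gram, Matrix.diagonal_mul_diagonal, ← Matrix.diagonal_one]
  congr 1
  ext i
  refine Fin.lastCases ?_ (fun i => ?_) i <;> simp [hε]

lemma transpose_gram (ε : ℝ) : (gram n ε).transpose = gram n ε := Matrix.diagonal_transpose _

/-- This lets the rotation group share the lemmas on `pseudoSO` with the Lorentz group. -/
lemma specialOrthogonalGroup_eq :
    (Matrix.specialOrthogonalGroup (Fin (n + 1)) ℝ : Set (Matrix (Fin (n + 1)) (Fin (n + 1)) ℝ)) =
      pseudoSO n 1 := by
  ext A
  rw [SetLike.mem_coe, Matrix.mem_specialOrthogonalGroup_iff, Matrix.mem_orthogonalGroup_iff',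
    pseudoSO, Set.mem_ofPred_eq, gram_one, mul_one]

lemma one_mem_pseudoSO (ε : ℝ) : (1 : Matrix (Fin (n + 1)) (Fin (n + 1)) ℝ) ∈ pseudoSO n ε := by
  simp [pseudoSO]

lemma mul_mem_pseudoSO {ε : ℝ} {A B : Matrix (Fin (n + 1)) (Fin (n + 1)) ℝ}
    (hA : A ∈ pseudoSO n ε) (hB : B ∈ pseudoSO n ε) : A * B ∈ pseudoSO n ε := by
  refine ⟨?_, by rw [Matrix.det_mul, hA.2, hB.2, one_mul]⟩
  rw [Matrix.transpose_mul]
  calc B.transpose * A.transpose * gram n ε * (A * B)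
      = B.transpose * (A.transpose * gram n ε * A) * B := by noncomm_ring
    _ = gram n ε := by rw [hA.1, hB.1]

lemma inv_mem_pseudoSO {ε : ℝ} {A : Matrix (Fin (n + 1)) (Fin (n + 1)) ℝ}
    (hA : A ∈ pseudoSO n ε) : A⁻¹ ∈ pseudoSO n ε := by
  have hu : IsUnit A.det := by rw [hA.2]; exact isUnit_one
  refine ⟨?_, by rw [Matrix.det_nonsing_inv, hA.2, Ring.inverse_one]⟩
  calc (A⁻¹).transpose * gram n ε * A⁻¹
      = (A⁻¹).transpose * (A.transpose * gram n ε * A) * A⁻¹ := by rw [hA.1]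
    _ = (A * A⁻¹).transpose * gram n ε * (A * A⁻¹) := by
        rw [Matrix.transpose_mul]; noncomm_ring
    _ = gram n ε := by rw [Matrix.mul_nonsing_inv _ hu]; simp

lemma hForm_eq_dotProduct (ε : ℝ) (z w : Fin (n + 1) → ℂ) :
    hForm ε z w = z ⬝ᵥ ((gram n ε).map ((↑) : ℝ → ℂ)).mulVec (star w) := by
  rw [gram, Matrix.diagonal_map (by simp), dotProduct, Fin.sum_univ_castSucc]
  simp [Matrix.mulVec_diagonal, hForm, mul_left_comm]

/-- Real matrices commute with conjugation, so they act on the Hermitian form through its real Gram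
matrix. -/
lemma hForm_mulVec {ε : ℝ} {A B : Matrix (Fin (n + 1)) (Fin (n + 1)) ℝ} (z w : Fin (n + 1) → ℂ) :
    hForm ε ((A.map ((↑) : ℝ → ℂ)).mulVec z) ((B.map ((↑) : ℝ → ℂ)).mulVec w) =
      z ⬝ᵥ ((A.transpose * gram n ε * B).map ((↑) : ℝ → ℂ)).mulVec (star w) := by
  have h1 : star ((B.map ((↑) : ℝ → ℂ)).mulVec w) = (B.map ((↑) : ℝ → ℂ)).mulVec (star w) := by
    ext i
    simp [Matrix.mulVec, dotProduct]
  have h2 : (A.transpose * gram n ε * B).map ((↑) : ℝ → ℂ) = (A.map ((↑) : ℝ → ℂ)).transpose *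
      (gram n ε).map ((↑) : ℝ → ℂ) * B.map ((↑) : ℝ → ℂ) := by
    have h3 : (A.transpose * gram n ε * B).map ((↑) : ℝ → ℂ) =
        (A.transpose * gram n ε).map ((↑) : ℝ → ℂ) * B.map ((↑) : ℝ → ℂ) :=
      Matrix.map_mul (f := Complex.ofRealHom)
    have h4 : (A.transpose * gram n ε).map ((↑) : ℝ → ℂ) =
        A.transpose.map ((↑) : ℝ → ℂ) * (gram n ε).map ((↑) : ℝ → ℂ) :=
      Matrix.map_mul (f := Complex.ofRealHom)
    rw [h3, h4, Matrix.transpose_map]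
  rw [hForm_eq_dotProduct, h1, h2, ← Matrix.mulVec_mulVec, ← Matrix.mulVec_mulVec,
    Matrix.dotProduct_mulVec _ (Matrix.transpose _), Matrix.vecMul_transpose]

lemma hForm_mulVec_of_mem {ε : ℝ} {A : Matrix (Fin (n + 1)) (Fin (n + 1)) ℝ}
    (hA : A.transpose * gram n ε * A = gram n ε) (z w : Fin (n + 1) → ℂ) :
    hForm ε ((A.map ((↑) : ℝ → ℂ)).mulVec z) ((A.map ((↑) : ℝ → ℂ)).mulVec w) = hForm ε z w := by
  rw [hForm_mulVec, hA, hForm_eq_dotProduct]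

open NormedSpace in
-- Writing `J` for the Gram matrix, the hypothesis reads `Xᵀ = J (-X) J⁻¹`, so the transpose of `exp
-- X` is `J (exp X)⁻¹ J⁻¹`. The determinant is the square of that of `exp (X / 2)`, which preserves
-- the form too and so has determinant `±1`.
lemma exp_mem_pseudoSO {ε : ℝ} (hε : ε * ε = 1) {X : Matrix (Fin (n + 1)) (Fin (n + 1)) ℝ}
    (hX : X.transpose * gram n ε + gram n ε * X = 0) : exp X ∈ pseudoSO n ε := by
  have horth : ∀ {Y : Matrix (Fin (n + 1)) (Fin (n + 1)) ℝ},
      Y.transpose * gram n ε + gram n ε * Y = 0 →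
      (exp Y).transpose * gram n ε * exp Y = gram n ε := by
    intro Y hY
    have hu : IsUnit (gram n ε) := IsUnit.of_mul_eq_one _ (gram_mul_gram hε)
    have hinv : (gram n ε)⁻¹ = gram n ε := Matrix.inv_eq_right_inv (gram_mul_gram hε)
    have h1 : Y.transpose = gram n ε * (-Y) * (gram n ε)⁻¹ := by
      rw [hinv, mul_neg, ← eq_neg_of_add_eq_zero_left hY, mul_assoc, gram_mul_gram hε, mul_one]
    rw [← Matrix.exp_transpose, h1, Matrix.exp_conj _ _ hu, hinv, mul_assoc _ _ (gram n ε),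
      gram_mul_gram hε, mul_one, mul_assoc, ← Matrix.exp_add_of_commute _ _ ((Commute.refl Y).neg_left)]
    simp
  refine ⟨horth hX, ?_⟩
  have h2 : (exp ((1 / 2 : ℝ) • X)).transpose * gram n ε * exp ((1 / 2 : ℝ) • X) = gram n ε := by
    apply horth
    rw [Matrix.transpose_smul, Matrix.smul_mul, Matrix.mul_smul, ← smul_add, hX, smul_zero]
  have h3 : exp X = exp ((1 / 2 : ℝ) • X) * exp ((1 / 2 : ℝ) • X) := by
    rw [← Matrix.exp_add_of_commute _ _ rfl, ← add_smul]; norm_num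
  have h4 := congrArg Matrix.det h2
  have h5 : (gram n ε).det ≠ 0 := by
    intro h
    have := congrArg Matrix.det (gram_mul_gram (n := n) hε)
    rw [Matrix.det_mul, h] at this
    simp at this
  rw [Matrix.det_mul, Matrix.det_mul, Matrix.det_transpose] at h4
  rw [h3, Matrix.det_mul]
  apply mul_right_cancel₀ h5
  linarith

lemma continuousAt_matrix_inv {ι : Type*} [Fintype ι] [DecidableEq ι] {A : Matrix ι ι ℝ}
    (hA : A.det ≠ 0) : ContinuousAt (fun Y : Matrix ι ι ℝ => Y⁻¹) A := by
  have : ContinuousAt (fun Y : Matrix ι ι ℝ => Ring.inverse Y.det • Y.adjugate) A := by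
    simp only [Ring.inverse_eq_inv']
    exact ContinuousAt.smul
      (ContinuousAt.inv₀ (Continuous.matrix_det continuous_id).continuousAt hA)
      (Continuous.matrix_adjugate continuous_id).continuousAt
  exact this

/-- A neighbourhood base of the identity in the orthogonal group of a form consists of connected
sets: the images of balls of the Lie algebra under the Cayley transform. -/
lemma exists_isPreconnected_mem_nhdsWithin_one {ε : ℝ} (hε : ε * ε = 1)
    {V : Set (Matrix (Fin (n + 1)) (Fin (n + 1)) ℝ)} (hV : V ∈ 𝓝 1) :
    ∃ S ⊆ V ∩ pseudoSO n ε, IsPreconnected S ∧ 1 ∈ S ∧ S ∈ 𝓝[pseudoSO n ε] 1 := by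
  let _ : NormedRing (Matrix (Fin (n + 1)) (Fin (n + 1)) ℝ) := Matrix.linftyOpNormedRing
  let _ : NormedAlgebra ℝ (Matrix (Fin (n + 1)) (Fin (n + 1)) ℝ) := Matrix.linftyOpNormedAlgebra
  let J := gram n ε
  have hJJ : J * J = 1 := gram_mul_gram hε
  let C : Matrix (Fin (n + 1)) (Fin (n + 1)) ℝ → Matrix (Fin (n + 1)) (Fin (n + 1)) ℝ :=
    fun X => (1 + X) * (1 - X)⁻¹
  have hCcont : ∀ X : Matrix (Fin (n + 1)) (Fin (n + 1)) ℝ, (1 - X).det ≠ 0 → ContinuousAt C X := by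
    intro X hX
    refine ContinuousAt.mul (by fun_prop) ?_
    exact (continuousAt_matrix_inv hX).comp (f := fun X => 1 - X) (by fun_prop)
  have hdet : ∀ᶠ X : Matrix (Fin (n + 1)) (Fin (n + 1)) ℝ in 𝓝 0, (1 - X).det ≠ 0 := by
    have : Continuous fun X : Matrix (Fin (n + 1)) (Fin (n + 1)) ℝ => (1 - X).det :=
      Continuous.matrix_det (by fun_prop)
    exact this.continuousAt.eventually_ne (by simp)
  have hC0 : C 0 = 1 := by simp [C]
  have hCV : ∀ᶠ X in 𝓝 (0 : Matrix (Fin (n + 1)) (Fin (n + 1)) ℝ), C X ∈ V :=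
    (hCcont 0 (by simp)).eventually_mem (by rwa [hC0])
  obtain ⟨r, hr, hball⟩ := Metric.eventually_nhds_iff_ball.1 (hdet.and hCV)
  -- A convex piece of the Lie algebra; its image under `C` is therefore connected.
  let A : Set (Matrix (Fin (n + 1)) (Fin (n + 1)) ℝ) :=
    Metric.ball 0 r ∩ {X | X.transpose * J + J * X = 0}
  have hA : Convex ℝ A := by
    refine (convex_ball _ _).inter ?_
    intro X hX Y hY a b _ _ _
    simp only [Set.mem_ofPred_eq] at hX hY ⊢
    rw [Matrix.transpose_add, Matrix.transpose_smul, Matrix.transpose_smul, add_mul, mul_add,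
      Matrix.smul_mul, Matrix.smul_mul, Matrix.mul_smul, Matrix.mul_smul]
    calc _ = a • (X.transpose * J + J * X) + b • (Y.transpose * J + J * Y) := by
          rw [smul_add, smul_add]; abel
      _ = 0 := by rw [hX, hY, smul_zero, smul_zero, add_zero]
  have hJT : J.transpose = J := transpose_gram ε
  have hAso : ∀ X ∈ A, C X ∈ pseudoSO n ε := by
    intro X hX
    have hu : IsUnit (1 - X).det := (hball X hX.1).1.isUnit
    have h1 : (1 + X).transpose * J = J * (1 - X) := by
      rw [Matrix.transpose_add, Matrix.transpose_one, add_mul, mul_sub, one_mul, mul_one,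
        eq_neg_of_add_eq_zero_left hX.2, sub_eq_add_neg]
    have h2 : J * (1 + X) = (1 - X).transpose * J := by
      have := congrArg Matrix.transpose h1
      rwa [Matrix.transpose_mul, Matrix.transpose_mul, Matrix.transpose_transpose, hJT] at this
    refine ⟨?_, ?_⟩
    · calc (C X).transpose * J * C X
          = ((1 - X)⁻¹).transpose * ((1 + X).transpose * J) * ((1 + X) * (1 - X)⁻¹) := by
            simp only [C, Matrix.transpose_mul]; noncomm_ring
        _ = ((1 - X)⁻¹).transpose * (J * ((1 - X) * (1 + X)) * (1 - X)⁻¹) := by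
            rw [h1]; noncomm_ring
        _ = ((1 - X)⁻¹).transpose * ((J * (1 + X)) * ((1 - X) * (1 - X)⁻¹)) := by
            rw [show (1 - X) * (1 + X) = (1 + X) * (1 - X) by noncomm_ring]; noncomm_ring
        _ = ((1 - X) * (1 - X)⁻¹).transpose * J := by
            rw [h2, Matrix.mul_nonsing_inv _ hu, mul_one, ← mul_assoc, ← Matrix.transpose_mul,
              Matrix.mul_nonsing_inv _ hu]
        _ = J := by rw [Matrix.mul_nonsing_inv _ hu]; simp
    -- By `h1` the matrices `1 + X` and `1 - X` have the same determinant, so their quotient has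
    -- determinant `1`.
    · have h3 := congrArg Matrix.det h1
      have h4 : J.det ≠ 0 := by
        intro h
        have := congrArg Matrix.det hJJ
        rw [Matrix.det_mul, h] at this
        simp at this
      rw [Matrix.det_mul, Matrix.det_mul, Matrix.det_transpose, mul_comm] at h3
      have h5 := mul_left_cancel₀ h4 h3
      simp only [C]
      rw [Matrix.det_mul, Matrix.det_nonsing_inv, h5]
      exact Ring.mul_inverse_cancel _ hu
  refine ⟨C '' A, ?_, ?_, ⟨0, ⟨Metric.mem_ball_self hr, by simp⟩, hC0⟩, ?_⟩
  · rintro _ ⟨X, hX, rfl⟩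
    exact ⟨(hball X hX.1).2, hAso X hX⟩
  · exact hA.isPreconnected.image _ fun X hX => (hCcont X (hball X hX.1).1).continuousWithinAt
  -- The inverse Cayley transform is defined near the identity because `1 + 1` is invertible. It
  -- shows that every nearby element of the group is the Cayley transform of an element of `A`.
  · let Z : Matrix (Fin (n + 1)) (Fin (n + 1)) ℝ → Matrix (Fin (n + 1)) (Fin (n + 1)) ℝ :=
      fun g => (g - 1) * (g + 1)⁻¹
    have hdet1 : ((1 : Matrix (Fin (n + 1)) (Fin (n + 1)) ℝ) + 1).det ≠ 0 := by
      rw [← two_smul ℝ (1 : Matrix (Fin (n + 1)) (Fin (n + 1)) ℝ), Matrix.det_smul]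
      simp
    have hZ : ContinuousAt Z 1 :=
      ContinuousAt.mul (by fun_prop)
        ((continuousAt_matrix_inv hdet1).comp (f := fun g => g + 1) (by fun_prop))
    have hZV : ∀ᶠ g in 𝓝 (1 : Matrix (Fin (n + 1)) (Fin (n + 1)) ℝ), Z g ∈ Metric.ball 0 r :=
      hZ.eventually_mem (by rw [show Z 1 = 0 by simp [Z]]; exact Metric.ball_mem_nhds _ hr)
    have hdet2 : ∀ᶠ g in 𝓝 (1 : Matrix (Fin (n + 1)) (Fin (n + 1)) ℝ), (g + 1).det ≠ 0 := by
      have : Continuous fun X : Matrix (Fin (n + 1)) (Fin (n + 1)) ℝ => (X + 1).det :=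
        Continuous.matrix_det (by fun_prop)
      exact this.continuousAt.eventually_ne hdet1
    filter_upwards [nhdsWithin_le_nhds hZV, nhdsWithin_le_nhds hdet2, self_mem_nhdsWithin]
      with g hg1 hg2 hg3
    have hu : IsUnit (g + 1).det := hg2.isUnit
    have hW : (g + 1) * (g + 1)⁻¹ = 1 := Matrix.mul_nonsing_inv _ hu
    have hW' : (g + 1)⁻¹ * (g + 1) = 1 := Matrix.nonsing_inv_mul _ hu
    refine ⟨Z g, ⟨hg1, ?_⟩, ?_⟩
    · have hZg : Z g * (g + 1) = g - 1 := by simp only [Z]; rw [mul_assoc, hW', mul_one]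
      -- Conjugation by `g + 1` clears the denominator and turns the Lie algebra condition on `Z g`
      -- into twice `gᵀ J g - J = 0`.
      have h1 : (g + 1).transpose * ((Z g).transpose * J + J * Z g) * (g + 1) = 0 := by
        have h2 : ∀ Y, (g + 1).transpose * (Y.transpose * J + J * Y) * (g + 1) =
            (Y * (g + 1)).transpose * J * (g + 1) + (g + 1).transpose * J * (Y * (g + 1)) := by
          intro Y
          rw [Matrix.transpose_mul]; noncomm_ring
        calc _ = (Z g * (g + 1)).transpose * J * (g + 1) + (g + 1).transpose * J * (Z g * (g + 1)) :=
              h2 _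
          _ = (g.transpose * J * g - J) + (g.transpose * J * g - J) := by
              rw [hZg, Matrix.transpose_sub, Matrix.transpose_add, Matrix.transpose_one]
              noncomm_ring
          _ = 0 := by rw [hg3.1, sub_self, add_zero]
      have hT : ((g + 1)⁻¹).transpose * (g + 1).transpose = 1 := by
        rw [← Matrix.transpose_mul, hW, Matrix.transpose_one]
      calc (Z g).transpose * J + J * Z g
          = ((g + 1)⁻¹).transpose * (g + 1).transpose * ((Z g).transpose * J + J * Z g) *
              ((g + 1) * (g + 1)⁻¹) := by rw [hT, hW, one_mul, mul_one]
        _ = ((g + 1)⁻¹).transpose * ((g + 1).transpose * ((Z g).transpose * J + J * Z g) *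
              (g + 1)) * (g + 1)⁻¹ := by noncomm_ring
        _ = 0 := by rw [h1, mul_zero, zero_mul]
    · have h1 : 1 - Z g = (2 : ℝ) • (g + 1)⁻¹ := by
        calc 1 - Z g = (g + 1) * (g + 1)⁻¹ - (g - 1) * (g + 1)⁻¹ := by rw [hW]
          _ = (2 : ℝ) • (g + 1)⁻¹ := by rw [two_smul]; noncomm_ring
      have h2 : 1 + Z g = (2 : ℝ) • (g * (g + 1)⁻¹) := by
        calc 1 + Z g = (g + 1) * (g + 1)⁻¹ + (g - 1) * (g + 1)⁻¹ := by rw [hW]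
          _ = (2 : ℝ) • (g * (g + 1)⁻¹) := by rw [two_smul]; noncomm_ring
      have h3 : (1 - Z g)⁻¹ = (1 / 2 : ℝ) • (g + 1) := by
        apply Matrix.inv_eq_right_inv
        rw [h1, Matrix.smul_mul, Matrix.mul_smul, hW', smul_smul]
        norm_num
      change (1 + Z g) * (1 - Z g)⁻¹ = g
      rw [h2, h3, Matrix.smul_mul, Matrix.mul_smul, mul_assoc, hW', smul_smul, mul_one]
      norm_num

end Pseudoorthogonal

/-- An immersion has a local left inverse. -/
lemma exists_local_leftInverse {E F : Type*} [NormedAddCommGroup E] [NormedSpace ℝ E]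
    [FiniteDimensional ℝ E] [NormedAddCommGroup F] [NormedSpace ℝ F] [FiniteDimensional ℝ F]
    {f : E → F} {f' : E →L[ℝ] F} {u : E} (hf : HasStrictFDerivAt f f' u)
    (hinj : Function.Injective f') :
    ∃ (r : F → E) (r' : F →L[ℝ] E), HasFDerivAt r r' (f u) ∧ ∀ᶠ x in 𝓝 u, r (f x) = x := by
  have : CompleteSpace E := FiniteDimensional.complete ℝ E
  -- Composing `f` with a linear left inverse `G` of its derivative gives a local diffeomorphism.
  -- Its local inverse, after `G`, is the required `r`.
  obtain ⟨G, hG⟩ := LinearMap.exists_leftInverse_of_injective (f' : E →ₗ[ℝ] F)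
    (LinearMap.ker_eq_bot.2 hinj)
  let G' : F →L[ℝ] E := LinearMap.toContinuousLinearMap G
  have hh : HasStrictFDerivAt (fun x => G' (f x))
      ((ContinuousLinearEquiv.refl ℝ E : E ≃L[ℝ] E) : E →L[ℝ] E) u := by
    have h1 := G'.hasStrictFDerivAt.comp u hf
    have h2 : G'.comp f' = ((ContinuousLinearEquiv.refl ℝ E : E ≃L[ℝ] E) : E →L[ℝ] E) := by
      ext x
      exact LinearMap.congr_fun hG x
    rwa [h2] at h1
  refine ⟨fun y => hh.localInverse _ _ _ (G' y), _,
    hh.to_localInverse.hasFDerivAt.comp (f u) G'.hasFDerivAt, hh.eventually_left_inverse⟩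

/-! ### Curves in a sheet of an immersion -/

section Sheets
variable {n m : ℕ} {M : Type*} [TopologicalSpace M]
  [ChartedSpace (EuclideanSpace ℝ (Fin m)) M] [IsManifold (𝓡 m) ∞ M]
  {ε : ℝ} {φ : M → Fin (n + 1) → ℂ}

/-- The left inverse is differentiable on the ambient space, so it lifts differentiable curves in
the image to differentiable curves in the chart. -/
lemma IsLegendrianImmersion.exists_local_leftInverse_chart
    (hφ : IsLegendrianImmersion (𝓡 m) ε φ) (p : M) :
    ∃ (r : (Fin (n + 1) → ℂ) → EuclideanSpace ℝ (Fin m)) (r' : (Fin (n + 1) → ℂ) →L[ℝ] _),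
      HasFDerivAt r r' (φ p) ∧ ∀ᶠ q in 𝓝 p, r (φ q) = extChartAt (𝓡 m) p q := by
  set e := extChartAt (𝓡 m) p with he
  have hT : IsOpen e.target := isOpen_extChartAt_target p
  have hp : e p ∈ e.target := mem_extChartAt_target p
  have hf := (contDiffOn_comp_chart_symm hφ.smooth p).contDiffAt (hT.mem_nhds hp)
  obtain ⟨r, r', hr, hleft⟩ := exists_local_leftInverse (hf.hasStrictFDerivAt (by simp))
    (hφ.injective_fderiv_comp_chart_symm p hp)
  refine ⟨r, r', ?_, ?_⟩
  · rwa [← he, extChartAt_to_inv p] at hr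
  · have h1 := (continuousAt_extChartAt (I := 𝓡 m) p).eventually hleft
    filter_upwards [h1, extChartAt_source_mem_nhds (I := 𝓡 m) p] with q hq hqs
    rwa [e.left_inv hqs] at hq

/-- An immersion is injective on small compact neighbourhoods. -/
lemma IsLegendrianImmersion.exists_isCompact_injOn
    (hφ : IsLegendrianImmersion (𝓡 m) ε φ) (p : M) {U : Set M} (hU : U ∈ 𝓝 p) :
    ∃ K ∈ 𝓝 p, K ⊆ U ∧ IsCompact K ∧ Set.InjOn φ K := by
  have : LocallyCompactSpace M := ChartedSpace.locallyCompactSpace (EuclideanSpace ℝ (Fin m)) M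
  obtain ⟨r, r', -, hr⟩ := hφ.exists_local_leftInverse_chart p
  obtain ⟨K, hK, hKU, hKc⟩ := local_compact_nhds
    (Filter.inter_mem (Filter.inter_mem hU hr) (extChartAt_source_mem_nhds (I := 𝓡 m) p))
  refine ⟨K, hK, fun q hq => (hKU hq).1.1, hKc, fun q hq q' hq' h => ?_⟩
  have h1 : r (φ q) = extChartAt (𝓡 m) p q := (hKU hq).1.2
  have h2 : r (φ q') = extChartAt (𝓡 m) p q' := (hKU hq').1.2
  exact (extChartAt (𝓡 m) p).injOn (hKU hq).2 (hKU hq').2 (by rw [← h1, ← h2, h])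

/-- On a compact set on which a continuous map is injective, convergence can be tested on the
values. -/
lemma tendsto_of_injOn_of_isCompact {ι X Y : Type*} [TopologicalSpace X] [TopologicalSpace Y]
    [T2Space Y] {f : X → Y} (hf : Continuous f) {K : Set X} (hK : IsCompact K)
    (hinj : Set.InjOn f K) {l : Filter ι} {γ : ι → X} {x : X} (hx : x ∈ K)
    (hγ : ∀ᶠ t in l, γ t ∈ K) (h : Filter.Tendsto (fun t => f (γ t)) l (𝓝 (f x))) :
    Filter.Tendsto γ l (𝓝 x) := by
  rw [tendsto_nhds]
  intro V hV hxV
  -- This set is compact, and by injectivity it misses `f x`. Values near `f x` therefore come from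
  -- `V`.
  have hcl : IsClosed (f '' (K \ V)) := ((hK.diff hV).image hf).isClosed
  have hnot : f x ∉ f '' (K \ V) := by
    rintro ⟨y, hy, hyx⟩
    exact hy.2 (hinj hy.1 hx hyx ▸ hxV)
  filter_upwards [hγ, h.eventually (hcl.isOpen_compl.mem_nhds hnot)] with t ht1 ht2
  by_contra hcon
  exact ht2 ⟨γ t, ⟨ht1, hcon⟩, rfl⟩

/-- A curve that stays in one sheet of a Legendrian immersion is horizontal. -/
lemma IsLegendrianImmersion.liouville_hasDerivAt_eq_zero
    (hφ : IsLegendrianImmersion (𝓡 m) ε φ) {K : Set M} (hK : IsCompact K) (hinj : Set.InjOn φ K)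
    {c : ℝ → Fin (n + 1) → ℂ} {c' : Fin (n + 1) → ℂ} {t₀ : ℝ} (hc : HasDerivAt c c' t₀)
    (hcK : ∀ᶠ t in 𝓝 t₀, c t ∈ φ '' K) : liouville ε (c t₀) c' = 0 := by
  obtain ⟨p, hpK, hp⟩ := hcK.self_of_nhds
  obtain ⟨r, r', hr, hleft⟩ := hφ.exists_local_leftInverse_chart p
  -- The lift `γ` is chosen point by point, with `p` as a default where no lift exists. Its
  -- continuity at `t₀` follows afterwards from compactness and injectivity.
  have : ∀ t, ∃ q, c t ∈ φ '' K → q ∈ K ∧ φ q = c t := fun t => by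
    by_cases h : c t ∈ φ '' K
    · exact ⟨h.choose, fun _ => h.choose_spec⟩
    · exact ⟨p, fun h' => absurd h' h⟩
  choose γ hγ using this
  have hγφ : (fun t => φ (γ t)) =ᶠ[𝓝 t₀] c := hcK.mono fun t ht => (hγ t ht).2
  have hlim : Filter.Tendsto γ (𝓝 t₀) (𝓝 p) :=
    tendsto_of_injOn_of_isCompact hφ.smooth.continuous hK hinj hpK (hcK.mono fun t ht => (hγ t ht).1)
      ((hc.continuousAt.tendsto.congr' hγφ.symm).trans (by rw [hp]))
  set e := extChartAt (𝓡 m) p with he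
  -- The lift, read in the chart, is `r ∘ c` and so is differentiable at `t₀`. This exhibits `c'` as
  -- the image of a tangent vector of `M`.
  have hcf : (fun t => φ (e.symm (r (c t)))) =ᶠ[𝓝 t₀] c := by
    filter_upwards [hγφ, hlim.eventually hleft,
      hlim.eventually (extChartAt_source_mem_nhds (I := 𝓡 m) p)] with t h1 h2 h3
    rw [← h1, h2, e.left_inv h3]
  have hrp : r (c t₀) = e p := by
    rw [← hp]; exact hleft.self_of_nhds
  have hT : e p ∈ e.target := mem_extChartAt_target p
  have hf := hasFDerivAt_of_contDiffOn (isOpen_extChartAt_target p)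
    (contDiffOn_comp_chart_symm hφ.smooth p) hT
  rw [← hrp] at hf
  rw [hp] at hr
  have h1 := (hf.comp_hasDerivAt t₀ (hr.comp_hasDerivAt t₀ hc)).congr_of_eventuallyEq hcf.symm
  rw [hc.unique h1]
  have h2 := hφ.toIsLegendrianMap.liouville_fderiv_comp_chart_symm p hT (r' c')
  rw [extChartAt_to_inv p, hp] at h2
  rw [hrp]
  exact h2

end Sheets

/-! ### One-parameter groups of matrices -/

section OneParameter
variable {n : ℕ}

/-- The action of a real matrix on complex vectors. -/
lemma continuous_mulVec_ofReal {ι : Type*} [Fintype ι] (z : ι → ℂ) :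
    Continuous fun A : Matrix ι ι ℝ => (A.map ((↑) : ℝ → ℂ)).mulVec z := by
  refine Continuous.matrix_mulVec ?_ continuous_const
  exact Continuous.matrix_map continuous_id Complex.continuous_ofReal

open NormedSpace in
lemma continuous_exp_smul (X : Matrix (Fin (n + 1)) (Fin (n + 1)) ℝ) :
    Continuous fun t : ℝ => exp (t • X) := by
  let _ : NormedRing (Matrix (Fin (n + 1)) (Fin (n + 1)) ℝ) := Matrix.linftyOpNormedRing
  let _ : NormedAlgebra ℝ (Matrix (Fin (n + 1)) (Fin (n + 1)) ℝ) := Matrix.linftyOpNormedAlgebra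
  let _ : NormedAlgebra ℚ (Matrix (Fin (n + 1)) (Fin (n + 1)) ℝ) := NormedAlgebra.restrictScalars ℚ ℝ _
  exact exp_continuous.comp (by fun_prop)

open NormedSpace in
lemma hasDerivAt_exp_smul_mulVec (X : Matrix (Fin (n + 1)) (Fin (n + 1)) ℝ) (z : Fin (n + 1) → ℂ)
    (t : ℝ) : HasDerivAt (fun t : ℝ => ((exp (t • X)).map ((↑) : ℝ → ℂ)).mulVec z)
      (((exp (t • X)).map ((↑) : ℝ → ℂ)).mulVec ((X.map ((↑) : ℝ → ℂ)).mulVec z)) t := by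
  let _ : NormedRing (Matrix (Fin (n + 1)) (Fin (n + 1)) ℝ) := Matrix.linftyOpNormedRing
  let _ : NormedAlgebra ℝ (Matrix (Fin (n + 1)) (Fin (n + 1)) ℝ) := Matrix.linftyOpNormedAlgebra
  let L : Matrix (Fin (n + 1)) (Fin (n + 1)) ℝ →L[ℝ] (Fin (n + 1) → ℂ) :=
    LinearMap.toContinuousLinearMap
      { toFun := fun A => (A.map ((↑) : ℝ → ℂ)).mulVec z
        map_add' := fun A B => by
          rw [Matrix.map_add _ (fun a b => Complex.ofReal_add a b), Matrix.add_mulVec]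
        map_smul' := fun c A => by
          ext i
          simp [Matrix.mulVec, dotProduct, Finset.mul_sum, mul_assoc] }
  have h := L.hasFDerivAt.comp_hasDerivAt t (hasDerivAt_exp_smul_const (𝕂 := ℝ) X t)
  have h2 : L (exp (t • X) * X) =
      ((exp (t • X)).map ((↑) : ℝ → ℂ)).mulVec ((X.map ((↑) : ℝ → ℂ)).mulVec z) := by
    have h3 : (exp (t • X) * X).map ((↑) : ℝ → ℂ) =
        (exp (t • X)).map ((↑) : ℝ → ℂ) * X.map ((↑) : ℝ → ℂ) :=
      Matrix.map_mul (f := Complex.ofRealHom)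
    rw [Matrix.mulVec_mulVec, ← h3]; rfl
  rw [← h2]
  exact h

lemma smul_mem_lieAlgebra {ε : ℝ} {X : Matrix (Fin (n + 1)) (Fin (n + 1)) ℝ}
    (hX : X.transpose * gram n ε + gram n ε * X = 0) (t : ℝ) :
    (t • X).transpose * gram n ε + gram n ε * (t • X) = 0 := by
  rw [Matrix.transpose_smul, Matrix.smul_mul, Matrix.mul_smul, ← smul_add, hX, smul_zero]

open NormedSpace in
-- A one-parameter group is a connected set through the identity.
lemma exp_smul_mem_connectedComponentIn {X : Matrix (Fin (n + 1)) (Fin (n + 1)) ℝ}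
    (hX : X.transpose * gram n (-1) + gram n (-1) * X = 0) (t : ℝ) :
    exp (t • X) ∈ connectedComponentIn (SOOne n) 1 := by
  have h1 : IsPreconnected (Set.range fun t : ℝ => exp (t • X)) :=
    isPreconnected_range (continuous_exp_smul X)
  have h2 : (Set.range fun t : ℝ => exp (t • X)) ⊆ SOOne n := by
    rintro _ ⟨s, rfl⟩
    exact exp_mem_pseudoSO (by norm_num) (smul_mem_lieAlgebra hX s)
  exact h1.subset_connectedComponentIn ⟨0, by simp⟩ h2 ⟨t, rfl⟩

end OneParameter

/-! ### The moment map vanishes on invariant immersions -/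

section Moment
variable {n₁ n₂ : ℕ} {M : Type*} [TopologicalSpace M]
  [ChartedSpace (EuclideanSpace ℝ (Fin (n₁ + 1 + n₂))) M]
  [IsManifold (𝓡 (n₁ + 1 + n₂)) ∞ M] {φ : M → Fin (n₁ + 1 + n₂ + 1) → ℂ}

/-- The component of the moment map in the direction of an element of the Lie algebra. -/
def moment (X₁ : Matrix (Fin (n₁ + 1)) (Fin (n₁ + 1)) ℝ) (X₂ : Matrix (Fin (n₂ + 1)) (Fin (n₂ + 1)) ℝ)
    (z : Fin (n₁ + 1 + n₂ + 1) → ℂ) : ℝ :=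
  (hForm 1 ((X₁.map ((↑) : ℝ → ℂ)).mulVec (fstPart z)) (fstPart z)
    + hForm (-1) ((X₂.map ((↑) : ℝ → ℂ)).mulVec (sndPart z)) (sndPart z)).im

open NormedSpace in
-- The velocity of the orbit at time `t` is `g t` applied to `X z`, and `g t` preserves the form.
-- The value of the contact form is thus independent of `t`, so it may be computed at whichever time
-- the orbit is known to lie in a sheet.
lemma exists_oneParameter {X₁ : Matrix (Fin (n₁ + 1)) (Fin (n₁ + 1)) ℝ}
    {X₂ : Matrix (Fin (n₂ + 1)) (Fin (n₂ + 1)) ℝ}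
    (h₁ : X₁.transpose * gram n₁ 1 + gram n₁ 1 * X₁ = 0)
    (h₂ : X₂.transpose * gram n₂ (-1) + gram n₂ (-1) * X₂ = 0) :
    ∃ g : ℝ → Matrix (Fin (n₁ + 1)) (Fin (n₁ + 1)) ℝ × Matrix (Fin (n₂ + 1)) (Fin (n₂ + 1)) ℝ,
      Continuous g ∧ g 0 = 1 ∧ (∀ t, g t ∈ actionGroup n₁ n₂) ∧
      ∀ z : Fin (n₁ + 1 + n₂ + 1) → ℂ, ∀ t, ∃ c', HasDerivAt (fun t => act (g t) z) c' t ∧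
        liouville (-1) (act (g t) z) c' = moment X₁ X₂ z := by
  refine ⟨fun t => (exp (t • X₁), exp (t • X₂)),
    (continuous_exp_smul X₁).prodMk (continuous_exp_smul X₂), by simp, fun t => ⟨?_, ?_⟩, ?_⟩
  · rw [specialOrthogonalGroup_eq]
    exact exp_mem_pseudoSO (by norm_num) (smul_mem_lieAlgebra h₁ t)
  · exact exp_smul_mem_connectedComponentIn h₂ t
  · intro z t
    refine ⟨_, (joinCLM n₁ n₂).hasFDerivAt.comp_hasDerivAt t
      ((hasDerivAt_exp_smul_mulVec X₁ (fstPart z) t).prodMk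
        (hasDerivAt_exp_smul_mulVec X₂ (sndPart z) t)), ?_⟩
    rw [liouville_eq, joinCLM_apply, act, hForm_join,
      hForm_mulVec_of_mem (exp_mem_pseudoSO (by norm_num) (smul_mem_lieAlgebra h₁ t)).1,
      hForm_mulVec_of_mem (exp_mem_pseudoSO (by norm_num) (smul_mem_lieAlgebra h₂ t)).1]
    rfl

lemma mulVec_single_map (i j : Fin (n₁ + 1)) (c : ℝ) (z : Fin (n₁ + 1) → ℂ) :
    ((Matrix.single i j c).map ((↑) : ℝ → ℂ)).mulVec z = Pi.single i (c * z j) := by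
  have : (Matrix.single i j c).map ((↑) : ℝ → ℂ) = Matrix.single i j (c : ℂ) :=
    Matrix.map_single i j c Complex.ofRealHom
  rw [this, Matrix.single_mulVec]
  rfl

lemma hForm_single_left {n : ℕ} (ε : ℝ) (i : Fin (n + 1)) (c : ℂ) (z : Fin (n + 1) → ℂ) :
    hForm ε (Pi.single i c) z = (Fin.snoc (α := fun _ => ℝ) (fun _ : Fin n => 1) ε i : ℝ) * (c * conj (z i)) := by
  refine Fin.lastCases ?_ (fun i => ?_) i
  · simp [hForm]
  · simp [hForm, Pi.single_apply, (Fin.castSucc_ne_last _).symm]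

/-- The rotation generators in the planes `i, j` of the first block and the boosts in the planes `i,
last` of the second give twice the imaginary parts in question, up to sign. Boosts suffice in the
second block since its last component serves as common denominator. -/
lemma isRealBlocks_of_moment_eq_zero {z : Fin (n₁ + 1 + n₂ + 1) → ℂ}
    (h : ∀ (X₁ : Matrix (Fin (n₁ + 1)) (Fin (n₁ + 1)) ℝ)
      (X₂ : Matrix (Fin (n₂ + 1)) (Fin (n₂ + 1)) ℝ),
      X₁.transpose * gram n₁ 1 + gram n₁ 1 * X₁ = 0 →
      X₂.transpose * gram n₂ (-1) + gram n₂ (-1) * X₂ = 0 → moment X₁ X₂ z = 0) :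
    IsRealBlocks z := by
  constructor
  · intro i j
    have h1 := h (Matrix.single i j 1 - Matrix.single j i 1) 0
      (by rw [gram_one]; simp [Matrix.transpose_single]) (by simp)
    have h2 : (Matrix.single i j 1 - Matrix.single j i (1 : ℝ)).map ((↑) : ℝ → ℂ) =
        (Matrix.single i j (1 : ℝ)).map ((↑) : ℝ → ℂ) - (Matrix.single j i (1 : ℝ)).map ((↑) : ℝ → ℂ) :=
      Matrix.map_sub _ (fun a b => Complex.ofReal_sub a b) _ _
    rw [moment, h2, Matrix.sub_mulVec, mulVec_single_map, mulVec_single_map, sub_eq_add_neg,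
      ← Pi.single_neg, hForm_add_left, hForm_single_left, hForm_single_left] at h1
    have h3 : ∀ k : Fin (n₁ + 1), Fin.snoc (α := fun _ => ℝ) (fun _ : Fin n₁ => 1) 1 k = 1 := fun k => by
      refine Fin.lastCases ?_ (fun k => ?_) k <;> simp
    simp [h3] at h1
    simp
    linarith
  · intro i
    have h1 := h 0 (Matrix.single i.castSucc (Fin.last n₂) 1 + Matrix.single (Fin.last n₂) i.castSucc 1)
      (by simp) (by
        have h3 : i.castSucc ≠ Fin.last n₂ := Fin.castSucc_ne_last i
        ext a b
        simp only [Matrix.transpose_add, Matrix.transpose_single, gram, Matrix.add_apply,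
          Matrix.mul_diagonal, Matrix.diagonal_mul, Matrix.single_apply, Matrix.zero_apply]
        rcases Fin.eq_castSucc_or_eq_last a with ⟨a, rfl⟩ | rfl <;>
          rcases Fin.eq_castSucc_or_eq_last b with ⟨b, rfl⟩ | rfl <;>
          simp [h3, (Fin.castSucc_ne_last _).symm, add_comm]
        split_ifs <;> simp)
    have h2 : (Matrix.single i.castSucc (Fin.last n₂) 1 +
          Matrix.single (Fin.last n₂) i.castSucc (1 : ℝ)).map ((↑) : ℝ → ℂ) =
        (Matrix.single i.castSucc (Fin.last n₂) (1 : ℝ)).map ((↑) : ℝ → ℂ) +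
          (Matrix.single (Fin.last n₂) i.castSucc (1 : ℝ)).map ((↑) : ℝ → ℂ) :=
      Matrix.map_add _ (fun a b => Complex.ofReal_add a b) _ _
    rw [moment, h2, Matrix.add_mulVec, mulVec_single_map, mulVec_single_map,
      hForm_add_left, hForm_single_left, hForm_single_left] at h1
    simp at h1
    simp
    linarith

/-- The moment map vanishes on locally invariant Legendrian immersions. -/
theorem isRealBlocks_of_isLocallyInvariant
    (hφ : IsLegendrianImmersion (𝓡 (n₁ + 1 + n₂)) (-1) φ) (hinv : IsLocallyInvariant φ) (p : M) :
    IsRealBlocks (φ p) := by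
  refine isRealBlocks_of_moment_eq_zero fun X₁ X₂ h₁ h₂ => ?_
  obtain ⟨g, hg, hg0, hgG, hd⟩ := exists_oneParameter h₁ h₂
  obtain ⟨K, hK, -, hKc, hKi⟩ := hφ.exists_isCompact_injOn p Filter.univ_mem
  obtain ⟨c', hc', hl⟩ := hd (φ p) 0
  rw [← hl]
  have h1 : Filter.Tendsto g (𝓝 0) (𝓝[actionGroup n₁ n₂] 1) :=
    tendsto_nhdsWithin_iff.2 ⟨by simpa only [hg0] using hg.tendsto 0, Filter.Eventually.of_forall hgG⟩
  have h2 := hφ.liouville_hasDerivAt_eq_zero hKc hKi hc' (h1.eventually (hinv p K hK))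
  exact h2

lemma continuous_act (z : Fin (n₁ + 1 + n₂ + 1) → ℂ) : Continuous fun g => act g z :=
  (joinCLM n₁ n₂).continuous.comp (((continuous_mulVec_ofReal (fstPart z)).comp continuous_fst).prodMk
    ((continuous_mulVec_ofReal (sndPart z)).comp continuous_snd))

/-- The moment map vanishes on Legendrian immersions with invariant image. -/
theorem isRealBlocks_of_isImageInvariant [SecondCountableTopology M]
    (hφ : IsLegendrianImmersion (𝓡 (n₁ + 1 + n₂)) (-1) φ) (hinv : IsImageInvariant φ) (p : M) :
    IsRealBlocks (φ p) := by
  refine isRealBlocks_of_moment_eq_zero fun X₁ X₂ h₁ h₂ => ?_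
  obtain ⟨g, hg, hg0, hgG, hd⟩ := exists_oneParameter h₁ h₂
  -- Countably many compact sheets cover `M`. The times at which the orbit of `φ p` meets the image
  -- of a given one form a closed set, and by Baire's theorem one of these sets has an interior
  -- point `t`.
  choose K hK _ hKc hKi using fun q => hφ.exists_isCompact_injOn q (Filter.univ_mem (f := 𝓝 q))
  obtain ⟨s, hs, hsU⟩ := TopologicalSpace.countable_cover_nhds hK
  have := hs.to_subtype
  obtain ⟨q, t, ht⟩ := nonempty_interior_of_iUnion_of_closed
    (f := fun q : s => (fun t => act (g t) (φ p)) ⁻¹' (φ '' K q))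
    (fun q => ((hKc q).image hφ.smooth.continuous).isClosed.preimage ((continuous_act _).comp hg)) (by
      rw [Set.eq_univ_iff_forall]
      intro t
      obtain ⟨x, hx⟩ := hinv (g t) (hgG t) p
      obtain ⟨q, hq, hxq⟩ := Set.mem_iUnion₂.1 (hsU ▸ Set.mem_univ x)
      exact Set.mem_iUnion.2 ⟨⟨q, hq⟩, x, hxq, hx⟩)
  obtain ⟨c', hc', hl⟩ := hd (φ p) t
  rw [← hl]
  have h2 := hφ.liouville_hasDerivAt_eq_zero (hKc q) (hKi q) hc' (mem_interior_iff_mem_nhds.1 ht)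
  exact h2

end Moment

/-! ### The group acting on the sphere and on hyperbolic space -/

section RealQuadrics
variable {n : ℕ}

lemma hForm_ofReal (ε : ℝ) (y : Fin (n + 1) → ℝ) :
    hForm ε (fun i => (y i : ℂ)) (fun i => (y i : ℂ)) =
      ((∑ i : Fin n, y i.castSucc ^ 2 + ε * y (Fin.last n) ^ 2 : ℝ) : ℂ) := by
  rw [hForm_self_eq]
  simp

lemma mulVec_ofReal (A : Matrix (Fin (n + 1)) (Fin (n + 1)) ℝ) (y : Fin (n + 1) → ℝ) :
    (A.map ((↑) : ℝ → ℂ)).mulVec (fun i => (y i : ℂ)) = fun i => ((A.mulVec y i : ℝ) : ℂ) := by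
  ext i
  simp [Matrix.mulVec, dotProduct]

lemma sum_sq_mulVec {ε : ℝ} {A : Matrix (Fin (n + 1)) (Fin (n + 1)) ℝ} (hA : A ∈ pseudoSO n ε)
    (y : Fin (n + 1) → ℝ) :
    ∑ i : Fin n, A.mulVec y i.castSucc ^ 2 + ε * A.mulVec y (Fin.last n) ^ 2 =
      ∑ i : Fin n, y i.castSucc ^ 2 + ε * y (Fin.last n) ^ 2 := by
  have h := hForm_mulVec_of_mem hA.1 (fun i => (y i : ℂ)) (fun i => (y i : ℂ))
  rw [mulVec_ofReal, hForm_ofReal, hForm_ofReal] at h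
  exact_mod_cast h

/-- The action of the rotations on the sphere. -/
lemma exists_action_sphere (n : ℕ) :
    ∃ rot : Matrix (Fin (n + 1)) (Fin (n + 1)) ℝ → RS n → RS n,
      (∀ A ∈ pseudoSO n 1, ∀ x, sphereIncl n (rot A x) =
        (A.map ((↑) : ℝ → ℂ)).mulVec (sphereIncl n x)) ∧
      ∀ x, Filter.Tendsto (fun A => rot A x) (𝓝[pseudoSO n 1] 1) (𝓝 x) := by
  classical
  let y : Matrix (Fin (n + 1)) (Fin (n + 1)) ℝ → RS n → EuclideanSpace ℝ (Fin (n + 1)) :=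
    fun A x => WithLp.toLp 2 (A.mulVec x.1)
  have hy : ∀ A ∈ pseudoSO n 1, ∀ x, y A x ∈ Metric.sphere (0 : EuclideanSpace ℝ (Fin (n + 1))) 1 := by
    intro A hA x
    have h1 : ∑ i, x.1 i ^ 2 = 1 := by
      rw [← EuclideanSpace.real_norm_sq_eq, norm_eq_of_mem_sphere]; norm_num
    have h2 := sum_sq_mulVec hA x.1
    rw [Fin.sum_univ_castSucc] at h1
    rw [mem_sphere_zero_iff_norm, ← pow_eq_one_iff_of_nonneg (norm_nonneg _) two_ne_zero,
      EuclideanSpace.real_norm_sq_eq, Fin.sum_univ_castSucc]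
    change ∑ i : Fin n, A.mulVec x.1 i.castSucc ^ 2 + A.mulVec x.1 (Fin.last n) ^ 2 = 1
    linarith
  -- The value `x` is a default for matrices that do not preserve the sphere.
  let rot : Matrix (Fin (n + 1)) (Fin (n + 1)) ℝ → RS n → RS n := fun A x =>
    if h : y A x ∈ Metric.sphere (0 : EuclideanSpace ℝ (Fin (n + 1))) 1 then ⟨y A x, h⟩ else x
  have hrot : ∀ A ∈ pseudoSO n 1, ∀ x, (rot A x).1 = y A x := fun A hA x => by
    simp only [rot, dif_pos (hy A hA x)]
  refine ⟨rot, fun A hA x => ?_, fun x => ?_⟩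
  · ext i
    change (((rot A x).1 i : ℝ) : ℂ) = _
    rw [hrot A hA]
    exact (congrFun (mulVec_ofReal A x.1) i).symm
  · rw [tendsto_subtype_rng]
    have h1 : Continuous fun A => y A x :=
      (PiLp.continuous_toLp 2 _).comp (Continuous.matrix_mulVec continuous_id continuous_const)
    have h2 : y 1 x = x.1 := by simp [y]
    refine Filter.Tendsto.congr' ?_ ((h2 ▸ h1.tendsto 1).mono_left nhdsWithin_le_nhds)
    exact Filter.eventually_of_mem self_mem_nhdsWithin fun A hA => (hrot A hA x).symm

/-- The action of the identity component of the Lorentz group on hyperbolic space. -/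
lemma exists_action_RH (n : ℕ) :
    ∃ rot : Matrix (Fin (n + 1)) (Fin (n + 1)) ℝ → RH n → RH n,
      (∀ A ∈ connectedComponentIn (SOOne n) 1, ∀ x, hypIncl n (rot A x) =
        (A.map ((↑) : ℝ → ℂ)).mulVec (hypIncl n x)) ∧
      ∀ x, Filter.Tendsto (fun A => rot A x) (𝓝[connectedComponentIn (SOOne n) 1] 1) (𝓝 x) := by
  classical
  let y : Matrix (Fin (n + 1)) (Fin (n + 1)) ℝ → RH n → EuclideanSpace ℝ (Fin (n + 1)) :=
    fun A x => WithLp.toLp 2 (A.mulVec x.1)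
  have hcont : ∀ x, Continuous fun A => y A x := fun x =>
    (PiLp.continuous_toLp 2 _).comp (Continuous.matrix_mulVec continuous_id continuous_const)
  have h2 : ∀ x, y 1 x = x.1 := fun x => by simp [y]
  have hquad : ∀ A ∈ SOOne n, ∀ x,
      ∑ i : Fin n, y A x i.castSucc ^ 2 - y A x (Fin.last n) ^ 2 = -1 := by
    intro A hA x
    have h1 := x.2.1
    have h2 := sum_sq_mulVec (ε := -1) hA x.1
    change ∑ i : Fin n, A.mulVec x.1 i.castSucc ^ 2 - A.mulVec x.1 (Fin.last n) ^ 2 = -1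
    linarith
  have hone : (1 : Matrix (Fin (n + 1)) (Fin (n + 1)) ℝ) ∈ SOOne n := one_mem_pseudoSO (-1)
  -- The last coordinate cannot vanish on the hyperboloid, as a sum of squares is not `-1`. On a
  -- connected set containing the identity it therefore keeps its sign.
  have hpos : ∀ A ∈ connectedComponentIn (SOOne n) 1, ∀ x, 0 < y A x (Fin.last n) := by
    intro A hA x
    by_contra! hneg
    have h3 := (isPreconnected_connectedComponentIn (F := SOOne n) (x := 1)).intermediate_value hA
      (mem_connectedComponentIn hone) (f := fun A => y A x (Fin.last n))
      (by have := hcont x; fun_prop)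
    obtain ⟨B, hB, hB0⟩ := h3 ⟨hneg, by simp only [h2]; exact x.2.2.le⟩
    have h4 := hquad B (connectedComponentIn_subset _ _ hB) x
    simp only at hB0
    rw [hB0] at h4
    have : 0 ≤ ∑ i : Fin n, y B x i.castSucc ^ 2 := Finset.sum_nonneg fun i _ => sq_nonneg _
    linarith
  let rot : Matrix (Fin (n + 1)) (Fin (n + 1)) ℝ → RH n → RH n := fun A x =>
    if h : ∑ i : Fin n, y A x i.castSucc ^ 2 - y A x (Fin.last n) ^ 2 = -1 ∧ 0 < y A x (Fin.last n)
    then ⟨y A x, h⟩ else x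
  have hrot : ∀ A ∈ connectedComponentIn (SOOne n) 1, ∀ x, (rot A x).1 = y A x := fun A hA x =>
    congrArg Subtype.val
      (dif_pos ⟨hquad A (connectedComponentIn_subset _ _ hA) x, hpos A hA x⟩)
  refine ⟨rot, fun A hA x => ?_, fun x => ?_⟩
  · ext i
    change (((rot A x).1 i : ℝ) : ℂ) = _
    rw [hrot A hA]
    exact (congrFun (mulVec_ofReal A x.1) i).symm
  · refine tendsto_subtype_rng.2 ?_
    refine Filter.Tendsto.congr' ?_ ((h2 x ▸ (hcont x).tendsto 1).mono_left nhdsWithin_le_nhds)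
    exact Filter.eventually_of_mem self_mem_nhdsWithin fun A hA => (hrot A hA x).symm

end RealQuadrics

/-! ### The standard form implies invariance -/

section Invariance
variable {n₁ n₂ : ℕ}

lemma mulVec_smul_map {n : ℕ} (A : Matrix (Fin (n + 1)) (Fin (n + 1)) ℝ) (c : ℂ) (z : Fin (n + 1) → ℂ) :
    (A.map ((↑) : ℝ → ℂ)).mulVec (c • z) = c • (A.map ((↑) : ℝ → ℂ)).mulVec z :=
  Matrix.mulVec_smul _ _ _

/-- The product of a curve with the real quadrics is mapped to itself by the block diagonal
group. -/
theorem isImageInvariant_product (I : Set ℝ) (α : ℝ → Fin 2 → ℂ) :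
    IsImageInvariant (fun x : I × RS n₁ × RH n₂ =>
      product α (sphereIncl n₁) (hypIncl n₂) x.1 x.2.1 x.2.2) := by
  obtain ⟨r₁, h₁, -⟩ := exists_action_sphere n₁
  obtain ⟨r₂, h₂, -⟩ := exists_action_RH n₂
  rintro ⟨A₁, A₂⟩ ⟨hA₁, hA₂⟩ ⟨s, x, y⟩
  rw [specialOrthogonalGroup_eq] at hA₁
  refine ⟨(s, r₁ A₁ x, r₂ A₂ y), ?_⟩
  simp only [product, act, fstPart_join, sndPart_join, mulVec_smul_map]
  rw [h₁ A₁ hA₁, h₂ A₂ hA₂]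

variable {M : Type*} [TopologicalSpace M]
  [ChartedSpace (EuclideanSpace ℝ (Fin (n₁ + 1 + n₂))) M] {φ : M → Fin (n₁ + 1 + n₂ + 1) → ℂ}

/-- The group acts on the parameters by `(s, x, y) ↦ (s, A₁ x, A₂ y)`. For elements near the
identity the new parameters are close to the old ones, so they stay in the domain of `F` and are
sent into `U`. -/
lemma IsStandardNear.eventually_act_mem {p : M} (h : IsStandardNear φ p) {U : Set M} (hU : U ∈ 𝓝 p) :
    ∀ᶠ g in 𝓝[actionGroup n₁ n₂] 1, act g (φ p) ∈ φ '' U := by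
  obtain ⟨I, α, -, -, F, hpF, hF⟩ := h
  obtain ⟨r₁, h₁, ht₁⟩ := exists_action_sphere n₁
  obtain ⟨r₂, h₂, ht₂⟩ := exists_action_RH n₂
  obtain ⟨x, hx, rfl⟩ : ∃ x ∈ F.source, F x = p :=
    ⟨F.invFun p, F.map_target' hpF, F.right_inv' hpF⟩
  have hcont : ContinuousAt F x :=
    (F.contMDiffOn_toFun.continuousOn x hx).continuousAt (F.open_source.mem_nhds hx)
  have h0 : 𝓝[actionGroup n₁ n₂] 1 = 𝓝[pseudoSO n₁ 1] 1 ×ˢ 𝓝[connectedComponentIn (SOOne n₂) 1] 1 := by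
    rw [actionGroup, specialOrthogonalGroup_eq, ← nhdsWithin_prod_eq]; rfl
  have hlim : Filter.Tendsto (fun g : Matrix (Fin (n₁ + 1)) (Fin (n₁ + 1)) ℝ ×
      Matrix (Fin (n₂ + 1)) (Fin (n₂ + 1)) ℝ => (x.1, r₁ g.1 x.2.1, r₂ g.2 x.2.2))
      (𝓝[actionGroup n₁ n₂] 1) (𝓝 x) := by
    rw [h0]
    exact tendsto_const_nhds.prodMk_nhds
      (((ht₁ x.2.1).comp Filter.tendsto_fst).prodMk_nhds ((ht₂ x.2.2).comp Filter.tendsto_snd))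
  filter_upwards [hlim.eventually (F.open_source.mem_nhds hx), hlim.eventually (hcont hU),
    self_mem_nhdsWithin] with g hg1 hg2 hg3
  refine ⟨_, hg2, ?_⟩
  have hg3' := hg3.1
  rw [specialOrthogonalGroup_eq] at hg3'
  rw [(hF _ hg1).2, (hF _ hx).2]
  simp only [product, act, fstPart_join, sndPart_join, mulVec_smul_map]
  rw [h₁ _ hg3', h₂ _ hg3.2]

end Invariance

/-! ### Points where the first block vanishes -/

section Singular
variable {n₁ n₂ : ℕ} {M : Type*} [TopologicalSpace M]
  [ChartedSpace (EuclideanSpace ℝ (Fin (n₁ + 1 + n₂))) M]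
  [IsManifold (𝓡 (n₁ + 1 + n₂)) ∞ M] {φ : M → Fin (n₁ + 1 + n₂ + 1) → ℂ}

/-- The isotropic subspaces of `ℂ^{n+1}` have dimension at most `n + 1`. -/
lemma finrank_le_of_isotropic {E : Type*} [AddCommGroup E] [Module ℝ E] [FiniteDimensional ℝ E]
    {n : ℕ} {L : E →ₗ[ℝ] Fin (n + 1) → ℂ} (hL : Function.Injective L)
    (h : ∀ v w, (hForm (-1) (L v) (L w)).im = 0) : Module.finrank ℝ E ≤ n + 1 := by
  -- The sign change `η` of the last coordinate turns the indefinite form into the Euclidean one.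
  let η : (Fin (n + 1) → ℂ) →ₗ[ℝ] Fin (n + 1) → ℂ := LinearMap.pi fun i =>
    (Fin.snoc (α := fun _ => ℝ) (fun _ : Fin n => 1) (-1) i : ℝ) • LinearMap.proj i
  have hη : ∀ z w, hForm 1 z (η w) = hForm (-1) z w := fun z w => by simp [hForm, η]
  have hη0 : Function.Injective η := by
    intro z w hzw
    ext i
    have := congrFun hzw i
    refine Fin.lastCases (motive := fun i => η z i = η w i → z i = w i) ?_ (fun i => ?_) i this
    · intro h; simpa [η] using h
    · intro h; simpa [η] using h
  -- For the real Euclidean product the image of `L` is orthogonal to `i η` times itself. Both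
  -- copies of `E` together thus embed into a real space of dimension `2 (n + 1)`.
  let P : E × E →ₗ[ℝ] Fin (n + 1) → ℂ :=
    L.coprod ((Complex.I • (LinearMap.id : (Fin (n + 1) → ℂ) →ₗ[ℝ] (Fin (n + 1) → ℂ))).comp (η.comp L))
  have hP : Function.Injective P := by
    rw [injective_iff_map_eq_zero]
    rintro ⟨v, w⟩ hvw
    have h1 : L v + Complex.I • η (L w) = 0 := hvw
    have h2 : (hForm 1 (L v) (L v)).re = 0 := by
      nth_rewrite 2 [eq_neg_of_add_eq_zero_left h1]
      rw [← neg_smul, hForm_smul_right, hη]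
      simp [h v w]
    have h3 : L v = 0 := by
      rw [hForm_self_eq, Complex.ofReal_re, one_mul, ← Fin.sum_univ_castSucc (fun i => ‖L v i‖ ^ 2),
        Finset.sum_eq_zero_iff_of_nonneg fun i _ => sq_nonneg _] at h2
      ext i
      simpa using h2 i (Finset.mem_univ i)
    rw [h3, zero_add, smul_eq_zero] at h1
    have h4 : L w = 0 := hη0 (by rw [h1.resolve_left Complex.I_ne_zero, map_zero])
    rw [hL (h3.trans (map_zero L).symm), hL (h4.trans (map_zero L).symm)]
    rfl
  have := LinearMap.finrank_le_finrank_of_injective hP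
  rw [Module.finrank_prod, Module.finrank_pi_fintype] at this
  simp only [Complex.finrank_real_complex, Finset.sum_const, Finset.card_univ, Fintype.card_fin,
    smul_eq_mul] at this
  omega

/-- The points of a Legendrian immersion with vanishing first component are not interior. -/
lemma IsLegendrianImmersion.mem_closure_fstPart_ne_zero (hn : 1 ≤ n₁)
    (hφ : IsLegendrianImmersion (𝓡 (n₁ + 1 + n₂)) (-1) φ) (p : M) :
    p ∈ closure {q | fstPart (φ q) ≠ 0} := by
  by_contra hcon
  have hev : ∀ᶠ q in 𝓝 p, fstPart (φ q) = 0 := by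
    have := isClosed_closure.isOpen_compl.mem_nhds hcon
    filter_upwards [this] with q hq
    by_contra h
    exact hq (subset_closure h)
  set e := extChartAt (𝓡 (n₁ + 1 + n₂)) p with he
  have hT : IsOpen e.target := isOpen_extChartAt_target p
  have hp : e p ∈ e.target := mem_extChartAt_target p
  have hf := (contDiffOn_comp_chart_symm hφ.smooth p)
  set f := fun u => φ (e.symm u) with hfdef
  have hev' : ∀ᶠ u in 𝓝 (e p), fstPart (f u) = 0 := by
    have h1 := continuousAt_extChartAt_symm (I := 𝓡 (n₁ + 1 + n₂)) p
    rw [ContinuousAt, extChartAt_to_inv p] at h1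
    exact h1.eventually hev
  have hd := hasFDerivAt_of_contDiffOn hT hf hp
  have hfst : ∀ v, fstPart (fderiv ℝ f (e p) v) = 0 := by
    intro v
    ext i
    have h1 := (hasFDerivAt_pi'.1 hd) (Fin.castAdd (n₂ + 1) i)
    have h2 : HasFDerivAt (fun u => f u (Fin.castAdd (n₂ + 1) i))
        (0 : EuclideanSpace ℝ (Fin (n₁ + 1 + n₂)) →L[ℝ] ℂ) (e p) :=
      (hasFDerivAt_const (0 : ℂ) _).congr_of_eventuallyEq (hev'.mono fun u hu => congrFun hu i)
    exact congrArg (fun L : EuclideanSpace ℝ (Fin (n₁ + 1 + n₂)) →L[ℝ] ℂ => L v) (h1.unique h2)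
  let snd : (Fin (n₁ + 1 + n₂ + 1) → ℂ) →ₗ[ℝ] Fin (n₂ + 1) → ℂ :=
    { toFun := sndPart, map_add' := fun _ _ => rfl, map_smul' := fun _ _ => rfl }
  -- If the first block vanished near `p`, the second block of the derivative alone would be
  -- injective and isotropic, which forces `n₁ + 1 + n₂ ≤ n₂ + 1`.
  have hle := finrank_le_of_isotropic (L := snd.comp (fderiv ℝ f (e p) :
      EuclideanSpace ℝ (Fin (n₁ + 1 + n₂)) →ₗ[ℝ] Fin (n₁ + 1 + n₂ + 1) → ℂ)) ?_ ?_
  · rw [finrank_euclideanSpace_fin] at hle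
    omega
  · intro v w hvw
    refine hφ.injective_fderiv_comp_chart_symm p hp (join_ext ?_ hvw)
    exact (hfst v).trans (hfst w).symm
  · intro v w
    have h1 := hForm_fderiv_im_eq_zero (ε := -1) (hf.contDiffAt (hT.mem_nhds hp))
      (Filter.eventually_of_mem (hT.mem_nhds hp) fun u hu =>
        hφ.toIsLegendrianMap.liouville_fderiv_comp_chart_symm p hu) v w
    rw [hForm_parts, hfst v, hForm_zero_left, zero_add] at h1
    exact h1

end Singular

/-! ### Local invariance across the singular points -/

section LocalInvariance
variable {n₁ n₂ : ℕ}

lemma continuous_act_uncurry : Continuous fun x : (Matrix (Fin (n₁ + 1)) (Fin (n₁ + 1)) ℝ ×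
    Matrix (Fin (n₂ + 1)) (Fin (n₂ + 1)) ℝ) × (Fin (n₁ + 1 + n₂ + 1) → ℂ) => act x.1 x.2 := by
  have h₁ : Continuous fun x : (Matrix (Fin (n₁ + 1)) (Fin (n₁ + 1)) ℝ ×
      Matrix (Fin (n₂ + 1)) (Fin (n₂ + 1)) ℝ) × (Fin (n₁ + 1 + n₂ + 1) → ℂ) =>
      (x.1.1.map ((↑) : ℝ → ℂ)).mulVec (fstPart x.2) :=
    Continuous.matrix_mulVec
      ((continuous_fst.comp continuous_fst).matrix_map Complex.continuous_ofReal)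
      (continuous_fstPart.comp continuous_snd)
  have h₂ : Continuous fun x : (Matrix (Fin (n₁ + 1)) (Fin (n₁ + 1)) ℝ ×
      Matrix (Fin (n₂ + 1)) (Fin (n₂ + 1)) ℝ) × (Fin (n₁ + 1 + n₂ + 1) → ℂ) =>
      (x.1.2.map ((↑) : ℝ → ℂ)).mulVec (sndPart x.2) :=
    Continuous.matrix_mulVec
      ((continuous_snd.comp continuous_fst).matrix_map Complex.continuous_ofReal)
      (continuous_sndPart.comp continuous_snd)
  exact (joinCLM n₁ n₂).continuous.comp (h₁.prodMk h₂)

lemma act_one (z : Fin (n₁ + 1 + n₂ + 1) → ℂ) : act 1 z = z := by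
  simp [act, Matrix.map_one, join_parts]

lemma act_mul (g h : Matrix (Fin (n₁ + 1)) (Fin (n₁ + 1)) ℝ ×
    Matrix (Fin (n₂ + 1)) (Fin (n₂ + 1)) ℝ) (z : Fin (n₁ + 1 + n₂ + 1) → ℂ) :
    act (g * h) z = act g (act h z) := by
  have hmap : ∀ {n : ℕ} (A B : Matrix (Fin n) (Fin n) ℝ),
      (A * B).map ((↑) : ℝ → ℂ) = A.map (↑) * B.map (↑) := fun A B =>
    Matrix.map_mul (f := Complex.ofRealHom)
  simp only [act, fstPart_join, sndPart_join, Prod.fst_mul, Prod.snd_mul, hmap,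
    Matrix.mulVec_mulVec]

/-- The action group has a basis of connected neighbourhoods of the identity, and it is a
neighbourhood of the identity in `SO(n₁+1) × SO(n₂,1)`. -/
lemma exists_isPreconnected_mem_nhdsWithin_actionGroup
    {V : Set (Matrix (Fin (n₁ + 1)) (Fin (n₁ + 1)) ℝ × Matrix (Fin (n₂ + 1)) (Fin (n₂ + 1)) ℝ)}
    (hV : V ∈ 𝓝 1) :
    ∃ S ⊆ V ∩ actionGroup n₁ n₂, IsPreconnected S ∧ 1 ∈ S ∧
      S ∈ 𝓝[pseudoSO n₁ 1 ×ˢ pseudoSO n₂ (-1)] 1 := by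
  obtain ⟨V₁, hV₁, V₂, hV₂, hVV⟩ := mem_nhds_prod_iff.1 hV
  obtain ⟨S₁, hS₁, hc₁, h1₁, hn₁⟩ := 
    exists_isPreconnected_mem_nhdsWithin_one (ε := 1) (by norm_num) hV₁
  obtain ⟨S₂, hS₂, hc₂, h1₂, hn₂⟩ :=
    exists_isPreconnected_mem_nhdsWithin_one (ε := -1) (by norm_num) hV₂
  refine ⟨S₁ ×ˢ S₂, fun g hg => ⟨hVV ⟨(hS₁ hg.1).1, (hS₂ hg.2).1⟩, ?_, ?_⟩, hc₁.prod hc₂,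
    ⟨h1₁, h1₂⟩, ?_⟩
  · rw [specialOrthogonalGroup_eq]
    exact (hS₁ hg.1).2
  · exact hc₂.subset_connectedComponentIn h1₂ (fun A hA => (hS₂ hA).2) hg.2
  · change _ ∈ 𝓝[pseudoSO n₁ 1 ×ˢ pseudoSO n₂ (-1)]
      ((1, 1) : Matrix (Fin (n₁ + 1)) (Fin (n₁ + 1)) ℝ × Matrix (Fin (n₂ + 1)) (Fin (n₂ + 1)) ℝ)
    rw [nhdsWithin_prod_eq]
    exact Filter.prod_mem_prod hn₁ hn₂

lemma actionGroup_subset : actionGroup n₁ n₂ ⊆ pseudoSO n₁ 1 ×ˢ pseudoSO n₂ (-1) := by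
  rw [actionGroup, specialOrthogonalGroup_eq]
  exact Set.prod_mono subset_rfl (connectedComponentIn_subset _ _)

/-- The identity component is a neighbourhood of the identity in the full group. Hence a translated
element need only be shown to preserve the forms and to have determinant `1`, not to lie in the
identity component. -/
lemma nhdsWithin_actionGroup :
    𝓝[actionGroup n₁ n₂] 1 = 𝓝[pseudoSO n₁ 1 ×ˢ pseudoSO n₂ (-1)] 1 := by
  refine le_antisymm (nhdsWithin_mono _ actionGroup_subset) ?_
  obtain ⟨S, hS, -, -, hn⟩ :=
    exists_isPreconnected_mem_nhdsWithin_actionGroup (n₁ := n₁) (n₂ := n₂) Filter.univ_mem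
  rw [nhdsWithin.eq_1 (s := actionGroup n₁ n₂), le_inf_iff]
  exact ⟨nhdsWithin_le_nhds, Filter.le_principal_iff.2
    (Filter.mem_of_superset hn fun g hg => (hS hg).2)⟩

/-- Membership of an orbit point in a sheet persists under a small change of the group element. -/
lemma eventually_act_mem_of_mem {M : Type*} {φ : M → Fin (n₁ + 1 + n₂ + 1) → ℂ} {Ω : Set M}
    {g₀ : Matrix (Fin (n₁ + 1)) (Fin (n₁ + 1)) ℝ × Matrix (Fin (n₂ + 1)) (Fin (n₂ + 1)) ℝ}
    (hg₀ : g₀ ∈ actionGroup n₁ n₂) {z : Fin (n₁ + 1 + n₂ + 1) → ℂ}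
    (h : ∀ᶠ g in 𝓝[actionGroup n₁ n₂] 1, act g (act g₀ z) ∈ φ '' Ω) :
    ∀ᶠ g in 𝓝[actionGroup n₁ n₂] g₀, act g z ∈ φ '' Ω := by
  have hg := actionGroup_subset hg₀
  have hu₁ : IsUnit g₀.1.det := by rw [hg.1.2]; exact isUnit_one
  have hu₂ : IsUnit g₀.2.det := by rw [hg.2.2]; exact isUnit_one
  rw [nhdsWithin_actionGroup] at h
  -- Right translation by the inverse of `g₀` carries the question back to the identity.
  have hlim : Filter.Tendsto (fun g => g * g₀⁻¹) (𝓝[actionGroup n₁ n₂] g₀)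
      (𝓝[pseudoSO n₁ 1 ×ˢ pseudoSO n₂ (-1)] 1) := by
    refine tendsto_nhdsWithin_iff.2 ⟨?_, ?_⟩
    · have h1 : g₀ * g₀⁻¹ = 1 :=
        Prod.ext (Matrix.mul_nonsing_inv _ hu₁) (Matrix.mul_nonsing_inv _ hu₂)
      exact h1 ▸ ((continuous_id.mul continuous_const).tendsto g₀).mono_left nhdsWithin_le_nhds
    · refine Filter.eventually_of_mem self_mem_nhdsWithin fun g hgm => ?_
      have hgm' := actionGroup_subset hgm
      exact ⟨mul_mem_pseudoSO hgm'.1 (inv_mem_pseudoSO hg.1),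
        mul_mem_pseudoSO hgm'.2 (inv_mem_pseudoSO hg.2)⟩
  refine (hlim.eventually h).mono fun g hgz => ?_
  rwa [← act_mul, mul_assoc, show g₀⁻¹ * g₀ = 1 from
    Prod.ext (Matrix.nonsing_inv_mul _ hu₁) (Matrix.nonsing_inv_mul _ hu₂), mul_one] at hgz

lemma fstPart_act_ne_zero
    {g : Matrix (Fin (n₁ + 1)) (Fin (n₁ + 1)) ℝ × Matrix (Fin (n₂ + 1)) (Fin (n₂ + 1)) ℝ}
    (hg : g ∈ actionGroup n₁ n₂) {z : Fin (n₁ + 1 + n₂ + 1) → ℂ} (hz : fstPart z ≠ 0) :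
    fstPart (act g z) ≠ 0 := by
  intro h
  rw [act, fstPart_join] at h
  have hdet : (g.1.map ((↑) : ℝ → ℂ)).det = 1 := by
    have h1 := RingHom.map_det Complex.ofRealHom g.1
    rw [(actionGroup_subset hg).1.2, map_one] at h1
    exact h1.symm
  exact hz (Matrix.eq_zero_of_mulVec_eq_zero (by rw [hdet]; exact one_ne_zero) h)

variable {M : Type*} [TopologicalSpace M]
  [ChartedSpace (EuclideanSpace ℝ (Fin (n₁ + 1 + n₂))) M]
  [IsManifold (𝓡 (n₁ + 1 + n₂)) ∞ M] {φ : M → Fin (n₁ + 1 + n₂ + 1) → ℂ}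

/-- A Legendrian immersion that is standard off the zero set of its first component is locally
invariant, also at the points of that set. -/
theorem isLocallyInvariant_of_isStandardNear (hn : 1 ≤ n₁)
    (hφ : IsLegendrianImmersion (𝓡 (n₁ + 1 + n₂)) (-1) φ)
    (h : ∀ p, fstPart (φ p) ≠ 0 → IsStandardNear φ p) : IsLocallyInvariant φ := by
  intro p U hU
  obtain ⟨K, hKp, hKU, hKc, hinj⟩ := hφ.exists_isCompact_injOn p hU
  have hcont : Continuous φ := hφ.smooth.continuous
  have hB : IsClosed (φ '' (K \ interior K)) :=
    ((hKc.diff isOpen_interior).image hcont).isClosed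
  have hK : IsClosed (φ '' K) := (hKc.image hcont).isClosed
  have hpB : φ p ∉ φ '' (K \ interior K) := by
    rintro ⟨q, hq, hqp⟩
    rw [hinj hq.1 (mem_of_mem_nhds hKp) hqp] at hq
    exact hq.2 (mem_interior_iff_mem_nhds.2 hKp)
  -- Group elements in `V` keep points of `W` off the image of the rim `K \ interior K`. The set `S
  -- ⊆ V` obtained from this is the same for all points of `W`.
  have hev := (continuous_act_uncurry.tendsto ((1 : Matrix (Fin (n₁ + 1))
    (Fin (n₁ + 1)) ℝ × Matrix (Fin (n₂ + 1)) (Fin (n₂ + 1)) ℝ), φ p)).eventually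
    (hB.isOpen_compl.mem_nhds (by rw [act_one]; exact hpB))
  rw [nhds_prod_eq] at hev
  obtain ⟨V, hV, W, hW, hVW⟩ := Filter.mem_prod_iff.1 hev
  obtain ⟨S, hS, hSc, hS1, hSn⟩ := exists_isPreconnected_mem_nhdsWithin_actionGroup hV
  have key : ∀ q ∈ interior K, φ q ∈ W → fstPart (φ q) ≠ 0 → ∀ g ∈ S,
      act g (φ q) ∈ φ '' interior K := by
    intro q hq hqW hq0 g hg
    -- Membership of the orbit point in the open sheet is shown to be locally constant on the
    -- connected set `S`.
    refine (hSc.induction₂ (fun a b => act a (φ q) ∈ φ '' interior K ↔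
      act b (φ q) ∈ φ '' interior K) (fun a ha => ?_) (fun _ _ _ _ _ _ => Iff.trans)
      (fun _ _ _ _ => Iff.symm) hS1 hg).1 ⟨q, hq, (act_one _).symm⟩
    by_cases hT : act a (φ q) ∈ φ '' interior K
    · obtain ⟨m, hm, hmq⟩ := hT
      have h1 := (h m (by rw [hmq]; exact fstPart_act_ne_zero (hS ha).2 hq0)).eventually_act_mem
        (isOpen_interior.mem_nhds hm)
      rw [hmq] at h1
      filter_upwards [nhdsWithin_mono a (fun x hx => (hS hx).2)
        (eventually_act_mem_of_mem (hS ha).2 h1)] with b hb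
      exact iff_of_true ⟨m, hm, hmq⟩ hb
    -- An orbit point outside the open sheet is not on the rim either, so it is outside the closed
    -- set `φ '' K`, and this is an open condition.
    · have h1 : act a (φ q) ∉ φ '' K := by
        rintro ⟨m, hm, hmq⟩
        by_cases hmi : m ∈ interior K
        · exact hT ⟨m, hmi, hmq⟩
        · exact hVW (Set.mk_mem_prod (hS ha).1 hqW) ⟨m, ⟨hm, hmi⟩, hmq⟩
      filter_upwards [mem_nhdsWithin_of_mem_nhds
        ((continuous_act (φ q)).continuousAt.preimage_mem_nhds (hK.isOpen_compl.mem_nhds h1))]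
        with b hb
      exact iff_of_false hT fun hc => hb (Set.image_mono interior_subset hc)
  rw [nhdsWithin_actionGroup]
  filter_upwards [hSn] with g hg
  -- For fixed `g` in `S`, let `q` tend to `p` through points with nonzero first block. The limit
  -- stays in `φ '' K`, which is closed.
  refine Set.image_mono hKU (hK.mem_of_frequently_of_tendsto (b := 𝓝 p) (f := fun q => act g (φ q))
    ?_ ((continuous_act_uncurry.comp (continuous_const.prodMk hcont)).tendsto p))
  have hfr := mem_closure_iff_frequently.1 (hφ.mem_closure_fstPart_ne_zero hn p)
  refine (hfr.and_eventually ((hcont.continuousAt.eventually hW).and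
    (interior_mem_nhds.2 hKp))).mono fun q hq => ?_
  exact Set.image_mono interior_subset (key q hq.2.2 hq.2.1 hq.1 g hg)

end LocalInvariance

/-! ### Orientations and volume forms under a change of frame -/

section Frames
variable {n : ℕ} {V : Type*} [AddCommGroup V] [Module ℝ V]

/-- The form `Ω`, evaluated on the image of a frame, changes by the determinant of the change of
frames. -/
lemma volForm_comp_basis (z : Fin (n + 1) → ℂ) (L : V →ₗ[ℝ] Fin (n + 1) → ℂ)
    (c e : Module.Basis (Fin n) ℝ V) :
    volForm z (fun i => L (e i)) = (c.det e : ℂ) * volForm z (fun i => L (c i)) := by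
  let F := (Matrix.detRowAlternating : (Fin (n + 1) → ℂ) [⋀^Fin (n + 1)]→ₗ[ℂ] ℂ).curryLeft z
  have hup : ∀ [DecidableEq (Fin n)] (m : Fin n → V) (i : Fin n) (x : V),
      (fun j => L (Function.update m i x j)) = Function.update (fun j => L (m j)) i (L x) :=
    fun m i x => funext fun j => Function.apply_update (fun _ => L) m i x j
  let f : V [⋀^Fin n]→ₗ[ℝ] ℂ :=
    { toFun := fun v => F fun i => L (v i)
      map_update_add' := fun m i x y => by
        simp only [hup, map_add]
        exact F.map_update_add _ i _ _
      map_update_smul' := fun m i r x => by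
        simp only [hup, map_smul]
        have := F.map_update_smul (fun j => L (m j)) i (r : ℂ) (L x)
        rwa [Complex.coe_smul, Complex.coe_smul] at this
      map_eq_zero_of_eq' := fun v i j hv hij => F.map_eq_zero_of_eq _ (congrArg L hv) hij }
  -- A real alternating form of top degree is determined by its value on one frame; this is used for
  -- the real and imaginary parts separately.
  have hre := congrArg (fun g : V [⋀^Fin n]→ₗ[ℝ] ℝ => g e)
    ((Complex.reLm.compAlternatingMap f).eq_smul_basis_det c)
  have him := congrArg (fun g : V [⋀^Fin n]→ₗ[ℝ] ℝ => g e)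
    ((Complex.imLm.compAlternatingMap f).eq_smul_basis_det c)
  change f e = (c.det e : ℂ) * f c
  refine Complex.ext ?_ ?_
  · rw [Complex.re_ofReal_mul, mul_comm]
    exact hre
  · rw [Complex.im_ofReal_mul, mul_comm]
    exact him

/-- The matrix `P` of the change of frame satisfies `Pᵀ diag(d) P = 1`; take determinants. -/
lemma det_sq_mul_prod_eq_one (B : LinearMap.BilinForm ℝ V) (c e : Module.Basis (Fin n) ℝ V)
    (d : Fin n → ℝ) (hc : ∀ i j, B (c i) (c j) = if i = j then d i else 0)
    (he : ∀ i j, B (e i) (e j) = if i = j then 1 else 0) : c.det e ^ 2 * ∏ i, d i = 1 := by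
  have h := congrArg Matrix.det (LinearMap.BilinForm.toMatrix_mul_basis_toMatrix c e B)
  have h1 : LinearMap.BilinForm.toMatrix c B = Matrix.diagonal d := by
    ext i j
    rw [LinearMap.BilinForm.toMatrix_apply, hc, Matrix.diagonal_apply]
  have h2 : LinearMap.BilinForm.toMatrix e B = 1 := by
    ext i j
    rw [LinearMap.BilinForm.toMatrix_apply, he, Matrix.one_apply]
  rw [h1, h2, Matrix.det_mul, Matrix.det_mul, Matrix.det_transpose, Matrix.det_diagonal,
    Matrix.det_one] at h
  rw [Module.Basis.det_apply, ← h]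
  ring

lemma exists_orthonormal_basis [FiniteDimensional ℝ V] (hV : Module.finrank ℝ V = n)
    (B : LinearMap.BilinForm ℝ V) (hB : ∀ v w, B v w = B w v) (hpos : ∀ v, v ≠ 0 → 0 < B v v) :
    ∃ b : Module.Basis (Fin n) ℝ V, ∀ i j, B (b i) (b j) = if i = j then 1 else 0 := by
  subst hV
  obtain ⟨v, hv⟩ := LinearMap.BilinForm.exists_orthogonal_basis (B := B) ⟨hB⟩
  have hp : ∀ i, 0 < B (v i) (v i) := fun i => hpos _ (v.ne_zero i)
  have hu : ∀ i, IsUnit (√(B (v i) (v i)))⁻¹ := fun i =>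
    (inv_ne_zero (Real.sqrt_pos.2 (hp i)).ne').isUnit
  refine ⟨v.isUnitSMul hu, fun i j => ?_⟩
  rw [Module.Basis.isUnitSMul_apply, Module.Basis.isUnitSMul_apply, map_smul, map_smul,
    LinearMap.smul_apply, smul_eq_mul, smul_eq_mul]
  split_ifs with hij
  · subst hij
    rw [← mul_assoc, ← mul_inv, Real.mul_self_sqrt (hp i).le, inv_mul_cancel₀ (hp i).ne']
  · rw [show B (v i) (v j) = 0 from hv hij, mul_zero, mul_zero]

/-- Replacing `c` by `e` flips the sign of the frame exactly when the determinant is negative. -/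
lemma frameSign_mul_det (o : Orientation ℝ V (Fin n)) (c e : Module.Basis (Fin n) ℝ V) :
    frameSign o e * c.det e = frameSign o c * |c.det e| := by
  have h := c.orientation_eq_iff_det_pos e
  by_cases hpos : 0 < c.det e
  · rw [frameSign, frameSign, h.2 hpos, abs_of_pos hpos]
  · rw [abs_of_nonpos (not_lt.1 hpos)]
    have hne := (c.orientation_ne_iff_eq_neg e.orientation).1 fun h' => hpos (h.1 h'.symm)
    have hne' : c.orientation ≠ -c.orientation := fun h' =>
      hpos (h.1 (h'.trans hne.symm))
    simp only [frameSign]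
    rcases c.orientation_eq_or_eq_neg o with ho | ho
    · rw [ho, hne, if_neg hne'.symm, if_pos rfl]
      ring
    · rw [ho, hne, if_pos rfl, if_neg hne']
      ring

lemma frameSign_mul_self (o : Orientation ℝ V (Fin n)) (c : Module.Basis (Fin n) ℝ V) :
    frameSign o c * frameSign o c = 1 := by
  rw [frameSign]
  split_ifs <;> norm_num

end Frames

/-! ### Product frames and their orientation -/

section ProductFrames
variable {n₁ n₂ : ℕ} {V₁ V₂ : Type*} [AddCommGroup V₁] [Module ℝ V₁] [AddCommGroup V₂]
  [Module ℝ V₂]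

/-- The members of the product frame. -/
lemma productBasis_eq_append (b₁ : Module.Basis (Fin n₁) ℝ V₁) (b₂ : Module.Basis (Fin n₂) ℝ V₂) :
    ⇑(productBasis b₁ b₂) = Fin.append (m := n₁ + 1) (n := n₂)
      (Fin.cons (1, 0, 0) fun i => (0, b₁ i, 0)) (fun j => (0, 0, b₂ j)) := by
  let e : Fin 1 ⊕ (Fin n₁ ⊕ Fin n₂) ≃ Fin (n₁ + 1 + n₂) :=
    ((Equiv.sumAssoc (Fin 1) (Fin n₁) (Fin n₂)).symm.trans
      ((finSumFinEquiv.sumCongr (Equiv.refl _)).trans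
        (finSumFinEquiv.trans (finCongr (by omega)))))
  have h : ∀ x, productBasis b₁ b₂ (e x) =
      ((Module.Basis.singleton (Fin 1) ℝ).prod (b₁.prod b₂)) x := fun x =>
    Module.Basis.reindex_apply _ _ _ |>.trans (by rw [Equiv.symm_apply_apply])
  have e0 : e (Sum.inl 0) = Fin.castAdd n₂ 0 := rfl
  have e1 : ∀ i, e (Sum.inr (Sum.inl i)) = Fin.castAdd n₂ i.succ := fun i =>
    Fin.ext (by simp [e, add_comm])
  have e2 : ∀ j, e (Sum.inr (Sum.inr j)) = Fin.natAdd (n₁ + 1) j := fun j =>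
    Fin.ext (by simp [e, add_comm])
  ext1 i
  refine Fin.addCases (m := n₁ + 1) (n := n₂) (fun i => ?_) (fun j => ?_) i
  · rw [Fin.append_left]
    refine Fin.cases ?_ (fun i => ?_) i
    · rw [← e0, h, Fin.cons_zero]; simp [Prod.zero_eq_mk]
    · rw [← e1, h, Fin.cons_succ]; simp
  · rw [Fin.append_right, ← e2, h]; simp

lemma productBasis_det (b₁ c₁ : Module.Basis (Fin n₁) ℝ V₁) (b₂ c₂ : Module.Basis (Fin n₂) ℝ V₂) :
    (productBasis c₁ c₂).det (productBasis b₁ b₂) = c₁.det b₁ * c₂.det b₂ := by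
  rw [productBasis, productBasis, Module.Basis.det_reindex, Module.Basis.det_apply,
    Module.Basis.det_apply, Module.Basis.det_apply, Module.Basis.coe_reindex]
  have : ((Module.Basis.singleton (Fin 1) ℝ).prod (c₁.prod c₂)).toMatrix
      ((Module.Basis.singleton (Fin 1) ℝ).prod (b₁.prod b₂)) =
      Matrix.fromBlocks 1 0 0 (Matrix.fromBlocks (c₁.toMatrix b₁) 0 0 (c₂.toMatrix b₂)) := by
    ext i j
    rcases i with i | i | i <;> rcases j with j | j | j <;>
      simp [Module.Basis.toMatrix_apply, Matrix.one_apply, eq_iff_true_of_subsingleton]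
  rw [Function.comp_assoc, Equiv.symm_comp_self, Function.comp_id, this,
    Matrix.det_fromBlocks_zero₂₁, Matrix.det_fromBlocks_zero₂₁, Matrix.det_one, one_mul]

/-- The sign of a product frame. -/
lemma frameSign_productBasis (o₁ : Orientation ℝ (EuclideanSpace ℝ (Fin n₁)) (Fin n₁))
    (o₂ : Orientation ℝ (EuclideanSpace ℝ (Fin n₂)) (Fin n₂))
    (b₁ : Module.Basis (Fin n₁) ℝ (EuclideanSpace ℝ (Fin n₁)))
    (b₂ : Module.Basis (Fin n₂) ℝ (EuclideanSpace ℝ (Fin n₂))) :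
    frameSign (productOrientation o₁ o₂) (productBasis b₁ b₂) = frameSign o₁ b₁ * frameSign o₂ b₂ := by
  set c₁ := (EuclideanSpace.basisFun (Fin n₁) ℝ).toBasis with hc₁
  set c₂ := (EuclideanSpace.basisFun (Fin n₂) ℝ).toBasis with hc₂
  -- For the standard frames this is the definition of the product orientation. Other frames follow
  -- because signs and determinants are both multiplicative.
  have hstd : frameSign (productOrientation o₁ o₂) (productBasis c₁ c₂) =
      frameSign o₁ c₁ * frameSign o₂ c₂ := by
    have hne : (productBasis c₁ c₂).orientation ≠ -(productBasis c₁ c₂).orientation :=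
      Module.Ray.ne_neg_self _
    have hsign : ∀ {n : ℕ} {V : Type} [AddCommGroup V] [Module ℝ V] (o : Orientation ℝ V (Fin n))
        (b : Module.Basis (Fin n) ℝ V), frameSign o b = 1 ∨ frameSign o b = -1 := fun o b => by
      rw [frameSign]; split_ifs <;> simp
    rw [productOrientation, ← hc₁, ← hc₂]
    split_ifs with h
    · rw [frameSign, if_pos rfl, h, frameSign_mul_self]
    · rw [frameSign, if_neg hne]
      rcases hsign o₁ c₁ with h1 | h1 <;> rcases hsign o₂ c₂ with h2 | h2 <;>
        simp_all
  have h := frameSign_mul_det (productOrientation o₁ o₂) (productBasis c₁ c₂) (productBasis b₁ b₂)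
  rw [productBasis_det, hstd, abs_mul] at h
  have h1 := frameSign_mul_det o₁ c₁ b₁
  have h2 := frameSign_mul_det o₂ c₂ b₂
  have hd1 := (c₁.isUnit_det b₁).ne_zero
  have hd2 := (c₂.isUnit_det b₂).ne_zero
  refine mul_right_cancel₀ (mul_ne_zero hd1 hd2) (h.trans ?_)
  linear_combination (-frameSign o₂ c₂ * |c₂.det b₂|) * h1 - frameSign o₁ b₁ * c₁.det b₁ * h2

end ProductFrames

/-! ### The determinant of a product frame -/

section Determinant
variable {n₁ n₂ : ℕ}

/-- The complex volume form on the rows of the derivative of `(α₁ ψ₁, α₂ ψ₂)`. -/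
lemma volForm_join (a b a' b' : ℂ) (hb : b ≠ 0) (z₁ : Fin (n₁ + 1) → ℂ) (z₂ : Fin (n₂ + 1) → ℂ)
    (v₁ : Fin n₁ → Fin (n₁ + 1) → ℂ) (v₂ : Fin n₂ → Fin (n₂ + 1) → ℂ) :
    volForm (join (a • z₁) (b • z₂)) (Fin.append (m := n₁ + 1) (n := n₂)
      (Fin.cons (join (a' • z₁) (b' • z₂)) fun i => join (a • v₁ i) 0)
      (fun j => join 0 (b • v₂ j))) =
    (-1) ^ n₁ * (a * b' - b * a') * a ^ n₁ * b ^ n₂ * volForm z₁ v₁ * volForm z₂ v₂ := by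
  set z := join (a • z₁) (b • z₂)
  set R : Fin (n₁ + 1 + n₂ + 1) → Fin (n₁ + 1 + n₂ + 1) → ℂ :=
    Fin.cons z (Fin.append (m := n₁ + 1) (n := n₂)
      (Fin.cons (join (a' • z₁) (b' • z₂)) fun i => join (a • v₁ i) 0)
      (fun j => join 0 (b • v₂ j))) with hR
  -- This cycle moves the position vector from the first row to the head of the second block. Its
  -- sign is `(-1)^(n₁+1)`.
  let σ : Equiv.Perm (Fin (n₁ + 1 + n₂ + 1)) := Fin.cycleRange (Fin.natAdd (n₁ + 1) (0 : Fin (n₂ + 1)))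
  let A₁ : Matrix (Fin (n₁ + 1)) (Fin (n₁ + 1)) ℂ := Matrix.of (Fin.cons z₁ v₁)
  let A₂ : Matrix (Fin (n₂ + 1)) (Fin (n₂ + 1)) ℂ := Matrix.of (Fin.cons z₂ v₂)
  let D : Matrix (Fin (n₁ + 1)) (Fin (n₁ + 1)) ℂ := Matrix.diagonal (Fin.cons a' fun _ => a)
  let E : ℂ → Matrix (Fin (n₁ + 1)) (Fin (n₂ + 1)) ℂ := fun x => Matrix.single 0 0 x
  let E' : ℂ → Matrix (Fin (n₂ + 1)) (Fin (n₁ + 1)) ℂ := fun x => Matrix.single 0 0 x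
  have hσ0 : R (σ (Fin.natAdd (n₁ + 1) (0 : Fin (n₂ + 1)))) = z := by
    rw [show σ (Fin.natAdd (n₁ + 1) (0 : Fin (n₂ + 1))) = 0 from Fin.cycleRange_self _, hR, Fin.cons_zero]
  have hσ1 : ∀ i : Fin (n₁ + 1), R (σ (Fin.castAdd (n₂ + 1) i)) =
      (Fin.cons (join (a' • z₁) (b' • z₂)) fun i => join (a • v₁ i) 0 :
        Fin (n₁ + 1) → Fin (n₁ + 1 + n₂ + 1) → ℂ) i := by
    intro i
    have : σ (Fin.castAdd (n₂ + 1) i) = (Fin.castAdd n₂ i).succ := Fin.ext (by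
      rw [Fin.coe_cycleRange_of_lt (by simp [Fin.lt_def]; omega)]; rfl)
    rw [this, hR, Fin.cons_succ, Fin.append_left]
  have hσ2 : ∀ j : Fin n₂, R (σ (Fin.natAdd (n₁ + 1) j.succ)) = join 0 (b • v₂ j) := by
    intro j
    have : σ (Fin.natAdd (n₁ + 1) j.succ) = (Fin.natAdd (n₁ + 1) j).succ := by
      rw [show σ (Fin.natAdd (n₁ + 1) j.succ) = Fin.natAdd (n₁ + 1) j.succ from
        Fin.cycleRange_of_gt (by simp [Fin.lt_def])]
      rfl
    rw [this, hR, Fin.cons_succ, Fin.append_right]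
  let f : Fin (n₁ + 1) ⊕ Fin (n₂ + 1) ≃ Fin (n₁ + 1 + n₂ + 1) := finSumFinEquiv
  have hf1 : ∀ i, f (Sum.inl i) = Fin.castAdd (n₂ + 1) i := fun i => rfl
  have hf2 : ∀ i, f (Sum.inr i) = Fin.natAdd (n₁ + 1) i := fun i => rfl
  -- After the permutation, the two blocks are mixed only by their head rows, through the
  -- coefficients `a'`, `b'`, `a`, `b`.
  have hblock : ((Matrix.of R).submatrix σ id).submatrix f f =
      Matrix.fromBlocks D (E b') (E' a) (b • 1) * Matrix.fromBlocks A₁ 0 0 A₂ := by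
    rw [Matrix.fromBlocks_multiply]
    simp only [Matrix.mul_zero, zero_add, add_zero, Matrix.smul_mul, Matrix.one_mul]
    ext i j
    rw [Matrix.submatrix_apply, Matrix.submatrix_apply, Matrix.of_apply]
    rcases i with i | i <;> refine Fin.cases ?_ (fun i => ?_) i <;> rcases j with j | j
    · simp [hf1, hσ1, D, A₁, Matrix.diagonal_mul]
    · simp [hf1, hf2, hσ1, E, A₂]
    · simp [hf1, hσ1, D, A₁, Matrix.diagonal_mul]
    · simp [hf1, hf2, hσ1, E, A₂]
    · simp [hf1, hf2, hσ0, E', A₁, z]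
    · simp [hf2, hσ0, A₂, z]
    · simp [hf1, hf2, hσ2, E', A₁]
    · simp [hf2, hσ2, A₂]
  have hdet := congrArg Matrix.det hblock
  rw [Matrix.det_submatrix_equiv_self, Matrix.det_permute, Matrix.det_mul,
    Matrix.det_fromBlocks_zero₂₁, Fin.sign_cycleRange] at hdet
  -- The Schur complement of the invertible block `b • 1` is diagonal. The value has `a' b - b' a`
  -- in place of `a b' - b a'`, which turns the sign `(-1)^(n₁+1)` of `σ` into `(-1)^n₁`.
  have hT : (Matrix.fromBlocks D (E b') (E' a) (b • 1)).det =
      (a' * b - b' * a) * a ^ n₁ * b ^ n₂ := by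
    let _ : Invertible (b • (1 : Matrix (Fin (n₂ + 1)) (Fin (n₂ + 1)) ℂ)) :=
      ⟨b⁻¹ • 1, by simp [smul_smul, hb], by simp [smul_smul, hb]⟩
    have hS : D - E b' * ⅟(b • (1 : Matrix (Fin (n₂ + 1)) (Fin (n₂ + 1)) ℂ)) * E' a =
        Matrix.diagonal (Fin.cons (a' - b' * b⁻¹ * a) fun _ => a) := by
      change D - E b' * (b⁻¹ • (1 : Matrix (Fin (n₂ + 1)) (Fin (n₂ + 1)) ℂ)) * E' a = _
      rw [Matrix.mul_smul, Matrix.mul_one, Matrix.smul_mul, Matrix.single_mul_single_same,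
        Matrix.smul_single]
      ext i j
      refine Fin.cases ?_ (fun i => ?_) i <;> refine Fin.cases ?_ (fun j => ?_) j <;>
        simp [D, Matrix.diagonal_apply, (Fin.succ_ne_zero _).symm]
      ring
    rw [Matrix.det_fromBlocks₂₂, hS, Matrix.det_diagonal, Fin.prod_univ_succ, Matrix.det_smul]
    simp only [Fin.cons_zero, Fin.cons_succ, Finset.prod_const, Finset.card_univ, Fintype.card_fin,
      Matrix.det_one, pow_succ]
    field_simp
  rw [hT] at hdet
  have hsign : ((-1 : ℂ)) ^ (n₁ + 1) * (-1) ^ (n₁ + 1) = 1 := by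
    rw [← mul_pow]; norm_num
  change (Matrix.of R).det = _ * A₁.det * A₂.det
  have hσs : (((-1 : ℤˣ) ^ (Fin.natAdd (n₁ + 1) (0 : Fin (n₂ + 1)) : ℕ) : ℤˣ) : ℂ) =
      (-1) ^ (n₁ + 1) := by
    simp
  rw [hσs] at hdet
  calc (Matrix.of R).det = (-1) ^ (n₁ + 1) * ((-1) ^ (n₁ + 1) * (Matrix.of R).det) := by
        rw [← mul_assoc, hsign, one_mul]
    _ = _ := by rw [hdet]; ring

end Determinant

lemma IsLegendrianMap.hForm_mvfderiv_eq_zero {n m : ℕ} {ε : ℝ} {N : Type*} [TopologicalSpace N]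
    [ChartedSpace (EuclideanSpace ℝ (Fin m)) N] {ψ : N → Fin (n + 1) → ℂ}
    (hψ : IsLegendrianMap (𝓡 m) ε ψ) (p : N) (v : TangentSpace (𝓡 m) p) :
    hForm ε (mvfderiv (𝓡 m) ψ p v) (ψ p) = 0 := by
  have h0 : HasFDerivWithinAt (E := EuclideanSpace ℝ (Fin m)) (F := Fin (n + 1) → ℂ)
      (writtenInExtChartAt (𝓡 m) 𝓘(ℝ, Fin (n + 1) → ℂ) p ψ)
      (mfderiv (𝓡 m) 𝓘(ℝ, Fin (n + 1) → ℂ) ψ p) (Set.range (𝓡 m)) (extChartAt (𝓡 m) p p) :=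
    (hψ.smooth.mdifferentiableAt (by simp) (x := p)).hasMFDerivAt.2
  rw [(𝓡 m).range_eq_univ] at h0
  have h := hasFDerivWithinAt_univ.1 h0
  have h1 := hForm_hasFDerivAt_eq_zero ε h
    (Filter.Eventually.of_forall fun u => hψ.mem_quadric _) (v := v)
  have h2 : writtenInExtChartAt (𝓡 m) 𝓘(ℝ, Fin (n + 1) → ℂ) p ψ (extChartAt (𝓡 m) p p) = ψ p := by
    simp [writtenInExtChartAt]
    rfl
  rw [h2] at h1
  exact h1 (hψ.horizontal p v)

/-! ### Legendre curves in `H_1^3` -/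

section Curve
variable {I : Set ℝ} {α : ℝ → Fin 2 → ℂ}

lemma hForm_fin_two (z w : Fin 2 → ℂ) :
    hForm (-1) z w = z 0 * conj (w 0) - z 1 * conj (w 1) := by
  simp [hForm]; ring

lemma volForm_fin_two (z w : Fin 2 → ℂ) :
    volForm (n := 1) z (fun _ => w) = z 0 * w 1 - z 1 * w 0 := by
  rw [volForm, Matrix.det_fin_two]
  rfl

lemma IsLegendreCurve.hasDerivAt (hα : IsLegendreCurve I α) {s : ℝ} (hs : s ∈ I) :
    HasDerivAt α (deriv α s) s :=
  ((hα.smooth.contDiffAt (hα.isOpen.mem_nhds hs)).differentiableAt (by simp)).hasDerivAt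

lemma IsLegendreCurve.hForm_deriv_eq_zero (hα : IsLegendreCurve I α) {s : ℝ} (hs : s ∈ I) :
    hForm (-1) (deriv α s) (α s) = 0 := by
  have h := hForm_hasFDerivAt_eq_zero (n := 1) (-1) (hα.hasDerivAt hs).hasFDerivAt
    (Filter.eventually_of_mem (hα.isOpen.mem_nhds hs) hα.mem_quadric) (v := 1)
  simp only [ContinuousLinearMap.toSpanSingleton_apply, one_smul] at h
  exact h (hα.horizontal s hs)

lemma IsLegendreCurve.norm_sq_eq (hα : IsLegendreCurve I α) {s : ℝ} (hs : s ∈ I) :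
    ‖α s 1‖ ^ 2 = ‖α s 0‖ ^ 2 + 1 := by
  have h := hα.mem_quadric s hs
  rw [AdSLegendrian.mem_quadric, hForm_fin_two, Complex.mul_conj, Complex.mul_conj, ← Complex.ofReal_sub,
    Complex.ofReal_inj, Complex.normSq_eq_norm_sq, Complex.normSq_eq_norm_sq] at h
  linarith

lemma IsLegendreCurve.snd_ne_zero (hα : IsLegendreCurve I α) {s : ℝ} (hs : s ∈ I) :
    α s 1 ≠ 0 := by
  intro h
  have := hα.norm_sq_eq hs
  rw [h, norm_zero] at this
  nlinarith [sq_nonneg ‖α s 0‖]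

/-- Orthogonality gives `|α₁'| |α₁| = |α₂'| |α₂|`. With `|α₂|² = |α₁|² + 1` it follows that `|α'|²
|α₂|² = |α₁'|²`, and `α₁' = 0` would force `α' = 0`. -/
lemma IsLegendreCurve.speedSq_pos (hα : IsLegendreCurve I α) {s : ℝ} (hs : s ∈ I) :
    0 < speedSq α s := by
  have h1 := hα.hForm_deriv_eq_zero hs
  rw [hForm_fin_two, sub_eq_zero] at h1
  have h2 := congrArg (fun x => ‖x‖ ^ 2) h1
  simp only [norm_mul, RCLike.norm_conj, mul_pow] at h2
  have h3 := hα.norm_sq_eq hs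
  have h4 : speedSq α s = ‖deriv α s 0‖ ^ 2 - ‖deriv α s 1‖ ^ 2 := by
    rw [speedSq, hForm_fin_two, Complex.mul_conj, Complex.mul_conj, ← Complex.ofReal_sub,
      Complex.ofReal_re, Complex.normSq_eq_norm_sq, Complex.normSq_eq_norm_sq]
  have hpos : 0 < ‖α s 1‖ ^ 2 := by rw [h3]; positivity
  have h5 : speedSq α s * ‖α s 1‖ ^ 2 = ‖deriv α s 0‖ ^ 2 := by
    rw [h4]; nlinarith
  have h6 : ‖deriv α s 0‖ ^ 2 ≠ 0 := by
    intro h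
    have h0 : deriv α s 0 = 0 := by simpa using h
    refine hα.regular s hs (funext fun i => ?_)
    fin_cases i
    · exact h0
    · rw [h0, zero_mul] at h1
      exact (mul_eq_zero.1 h1.symm).resolve_right (by simpa using hα.snd_ne_zero hs)
  by_contra! hcon
  exact h6 (le_antisymm (h5 ▸ mul_nonpos_of_nonpos_of_nonneg hcon hpos.le) (sq_nonneg _))

end Curve

/-! ### Smoothness and derivative of the product map -/

section Product
variable {n₁ n₂ : ℕ} {N₁ N₂ : Type*} [TopologicalSpace N₁]
  [ChartedSpace (EuclideanSpace ℝ (Fin n₁)) N₁]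
  [TopologicalSpace N₂] [ChartedSpace (EuclideanSpace ℝ (Fin n₂)) N₂]
  {ψ₁ : N₁ → Fin (n₁ + 1) → ℂ} {ψ₂ : N₂ → Fin (n₂ + 1) → ℂ}
  {I : TopologicalSpace.Opens ℝ} {α : ℝ → Fin 2 → ℂ}

/-- The inclusion of an open set of the line has derivative the identity. -/
lemma hasMFDerivAt_subtype_val (s : I) :
    HasMFDerivAt 𝓘(ℝ, ℝ) 𝓘(ℝ, ℝ) (Subtype.val : I → ℝ) s (ContinuousLinearMap.id ℝ ℝ) := by
  refine ⟨continuous_subtype_val.continuousAt, ?_⟩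
  have h := TopologicalSpace.Opens.chartAt_subtype_val_symm_eventuallyEq (H := ℝ) I (x := s)
  exact ((hasFDerivAt_id _).congr_of_eventuallyEq h.symm).hasFDerivWithinAt

lemma contMDiff_product (hψ₁ : ContMDiff (𝓡 n₁) 𝓘(ℝ, Fin (n₁ + 1) → ℂ) ∞ ψ₁)
    (hψ₂ : ContMDiff (𝓡 n₂) 𝓘(ℝ, Fin (n₂ + 1) → ℂ) ∞ ψ₂) (hα : IsLegendreCurve I α) :
    ContMDiff (prodModel n₁ n₂) 𝓘(ℝ, Fin (n₁ + 1 + n₂ + 1) → ℂ) ∞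
      (fun x : I × N₁ × N₂ => product α ψ₁ ψ₂ x.1 x.2.1 x.2.2) := by
  have h1 : ContMDiff (prodModel n₁ n₂) 𝓘(ℝ, ℝ × (Fin (n₁ + 1) → ℂ) × (Fin (n₂ + 1) → ℂ)) ∞
      (fun x : I × N₁ × N₂ => ((x.1 : ℝ), ψ₁ x.2.1, ψ₂ x.2.2)) :=
    (contMDiff_subtype_val.comp contMDiff_fst).prodMk_space
      ((hψ₁.comp (contMDiff_fst.comp contMDiff_snd)).prodMk_space
        (hψ₂.comp (contMDiff_snd.comp contMDiff_snd)))
  -- The curve is smooth on `I` only, so the map is factored through the part of a vector space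
  -- lying over `I`.
  have h2 : ContDiffOn ℝ ∞ (fun y : ℝ × (Fin (n₁ + 1) → ℂ) × (Fin (n₂ + 1) → ℂ) =>
      join (α y.1 0 • y.2.1) (α y.1 1 • y.2.2)) (Prod.fst ⁻¹' I) := by
    have hα' : ∀ i, ContDiffOn ℝ ∞ (fun y : ℝ × (Fin (n₁ + 1) → ℂ) × (Fin (n₂ + 1) → ℂ) => α y.1 i)
        (Prod.fst ⁻¹' I) := fun i =>
      ((contDiffOn_pi.1 hα.smooth) i).comp contDiff_fst.contDiffOn fun y hy => hy
    exact (joinCLM n₁ n₂).contDiff.comp_contDiffOn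
      (((hα' 0).smul contDiff_snd.fst.contDiffOn).prodMk
        ((hα' 1).smul contDiff_snd.snd.contDiffOn))
  exact h2.contMDiffOn.comp_contMDiff h1 fun x => x.1.2

/-- The derivative of `(α₁ ψ₁, α₂ ψ₂)`. -/
lemma mvfderiv_product (hψ₁ : ContMDiff (𝓡 n₁) 𝓘(ℝ, Fin (n₁ + 1) → ℂ) ∞ ψ₁)
    (hψ₂ : ContMDiff (𝓡 n₂) 𝓘(ℝ, Fin (n₂ + 1) → ℂ) ∞ ψ₂) (hα : IsLegendreCurve I α)
    (s : I) (p : N₁) (q : N₂) (v : ℝ × TangentSpace (𝓡 n₁) p × TangentSpace (𝓡 n₂) q) :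
    mvfderiv (prodModel n₁ n₂) (fun x : I × N₁ × N₂ => product α ψ₁ ψ₂ x.1 x.2.1 x.2.2) (s, p, q) v =
      join (α s 0 • mvfderiv (𝓡 n₁) ψ₁ p v.2.1 + (v.1 • deriv α s 0) • ψ₁ p)
        (α s 1 • mvfderiv (𝓡 n₂) ψ₂ q v.2.2 + (v.1 • deriv α s 1) • ψ₂ q) := by
  have hf₁ : HasMFDerivAt (prodModel n₁ n₂) (𝓡 n₁) (fun x : I × N₁ × N₂ => x.2.1) (s, p, q) _ :=
    (hasMFDerivAt_fst (p, q)).comp (s, p, q) (hasMFDerivAt_snd (s, p, q))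
  have hf₂ : HasMFDerivAt (prodModel n₁ n₂) (𝓡 n₂) (fun x : I × N₁ × N₂ => x.2.2) (s, p, q) _ :=
    (hasMFDerivAt_snd (p, q)).comp (s, p, q) (hasMFDerivAt_snd (s, p, q))
  have hf₀ := (hasMFDerivAt_subtype_val s).comp (s, p, q)
    (hasMFDerivAt_fst (I := 𝓘(ℝ, ℝ)) (I' := (𝓡 n₁).prod (𝓡 n₂)) (s, p, q))
  have hg₁ := (hψ₁.mdifferentiableAt (by simp) (x := p)).hasMFDerivAt.comp (s, p, q) hf₁
  have hg₂ := (hψ₂.mdifferentiableAt (by simp) (x := q)).hasMFDerivAt.comp (s, p, q) hf₂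
  have h1 : HasMFDerivAt (prodModel n₁ n₂) 𝓘(ℝ, ℝ × (Fin (n₁ + 1) → ℂ) × (Fin (n₂ + 1) → ℂ))
      (fun x : I × N₁ × N₂ => ((x.1 : ℝ), ψ₁ x.2.1, ψ₂ x.2.2)) (s, p, q) _ :=
    ⟨hf₀.1.prodMk (hg₁.1.prodMk hg₂.1), hf₀.2.prodMk (hg₁.2.prodMk hg₂.2)⟩
  have hαd : ∀ i, HasFDerivAt (fun y : ℝ × (Fin (n₁ + 1) → ℂ) × (Fin (n₂ + 1) → ℂ) => α y.1 i)
      (((ContinuousLinearMap.toSpanSingleton ℝ (deriv α s i)).comp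
        (ContinuousLinearMap.fst ℝ _ _))) ((s : ℝ), ψ₁ p, ψ₂ q) := fun i =>
    HasFDerivAt.comp (g := fun t => α t i) (f := Prod.fst) ((s : ℝ), ψ₁ p, ψ₂ q)
      ((hasDerivAt_pi.1 (hα.hasDerivAt s.2)) i).hasFDerivAt hasFDerivAt_fst
  have h2 := hasFDerivAt_join (hαd 0) (hαd 1)
    (hasFDerivAt_fst.comp ((s : ℝ), ψ₁ p, ψ₂ q) hasFDerivAt_snd)
    (hasFDerivAt_snd.comp ((s : ℝ), ψ₁ p, ψ₂ q) hasFDerivAt_snd)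
  have h3 := h2.hasMFDerivAt.comp (s, p, q) h1
  have h4 := congrArg (fun L : ℝ × EuclideanSpace ℝ (Fin n₁) × EuclideanSpace ℝ (Fin n₂) →L[ℝ]
    Fin (n₁ + 1 + n₂ + 1) → ℂ => L v) h3.mfderiv
  exact h4

end Product

/-- The tangential part `v` and the radial part `z` are orthogonal, so no cross terms arise.
Horizontality and the metric of the product both come from this formula in each block. -/
lemma hForm_smul_add_smul {n : ℕ} {ε : ℝ} {z v w : Fin (n + 1) → ℂ} (a c c' : ℂ)
    (hz : hForm ε z z = ε) (hv : hForm ε v z = 0) (hw : hForm ε w z = 0) :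
    hForm ε (a • v + c • z) (a • w + c' • z) = (‖a‖ ^ 2 : ℝ) * hForm ε v w + c * conj c' * ε := by
  have hw' : hForm ε z w = 0 := by rw [← conj_hForm, hw, map_zero]
  rw [hForm_add_left, hForm_add_right, hForm_add_right]
  simp only [hForm_smul_left, hForm_smul_right, hz, hv, hw']
  rw [← Complex.normSq_eq_norm_sq, ← Complex.mul_conj]
  ring

/-! ### Warped metrics and the value on an orthonormal frame -/

section Angle
variable {n₁ n₂ : ℕ}

/-- The metric of a warped product `ℝ × V₁ × V₂`. -/
def warpedForm {V₁ V₂ : Type*} [AddCommGroup V₁] [Module ℝ V₁] [AddCommGroup V₂] [Module ℝ V₂]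
    (r r₁ r₂ : ℝ) (g₁ : LinearMap.BilinForm ℝ V₁) (g₂ : LinearMap.BilinForm ℝ V₂) :
    LinearMap.BilinForm ℝ (ℝ × V₁ × V₂) :=
  LinearMap.mk₂ ℝ (fun v w => r * (v.1 * w.1) + r₁ * g₁ v.2.1 w.2.1 + r₂ * g₂ v.2.2 w.2.2)
    (fun v v' w => by simp; ring) (fun c v w => by simp; ring)
    (fun v w w' => by simp; ring) (fun c v w => by simp; ring)

lemma warpedForm_productBasis {V₁ V₂ : Type*} [AddCommGroup V₁] [Module ℝ V₁] [AddCommGroup V₂]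
    [Module ℝ V₂] (r r₁ r₂ : ℝ) {g₁ : LinearMap.BilinForm ℝ V₁} {g₂ : LinearMap.BilinForm ℝ V₂}
    {b₁ : Module.Basis (Fin n₁) ℝ V₁} {b₂ : Module.Basis (Fin n₂) ℝ V₂}
    (h₁ : ∀ i j, g₁ (b₁ i) (b₁ j) = if i = j then 1 else 0)
    (h₂ : ∀ i j, g₂ (b₂ i) (b₂ j) = if i = j then 1 else 0) (i j : Fin (n₁ + 1 + n₂)) :
    warpedForm r r₁ r₂ g₁ g₂ (productBasis b₁ b₂ i) (productBasis b₁ b₂ j) =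
      if i = j then Fin.append (m := n₁ + 1) (n := n₂) (Fin.cons r fun _ => r₁) (fun _ => r₂) i
      else 0 := by
  have hne : ∀ (i : Fin (n₁ + 1)) (j : Fin n₂), Fin.castAdd n₂ i ≠ Fin.natAdd (n₁ + 1) j :=
    fun i j h => by
      have := Fin.ext_iff.1 h
      simp at this
      omega
  rw [productBasis_eq_append]
  refine Fin.addCases (m := n₁ + 1) (n := n₂) (fun i => ?_) (fun i => ?_) i <;>
    refine Fin.addCases (m := n₁ + 1) (n := n₂) (fun j => ?_) (fun j => ?_) j
  · simp only [Fin.append_left, Fin.castAdd_inj]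
    refine Fin.cases ?_ (fun i => ?_) i <;> refine Fin.cases ?_ (fun j => ?_) j
    · simp [warpedForm]
    · simp [warpedForm, (Fin.succ_ne_zero _).symm]
    · simp [warpedForm]
    · simp [warpedForm, h₁]
  · rw [if_neg (hne i j), Fin.append_left, Fin.append_right]
    refine Fin.cases ?_ (fun i => ?_) i <;> simp [warpedForm]
  · rw [if_neg (hne j i).symm, Fin.append_left, Fin.append_right]
    refine Fin.cases ?_ (fun j => ?_) j <;> simp [warpedForm]
  · simp [warpedForm, h₂]

/-- The complex volume form of `(α₁ ψ₁, α₂ ψ₂)` on an orthonormal frame. -/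
lemma frameSign_mul_volForm_join {r : ℝ} (hr : 0 < r) {a b : ℂ} (a' b' : ℂ) (hb : b ≠ 0)
    (ha : n₁ = 0 ∨ a ≠ 0) (z₁ : Fin (n₁ + 1) → ℂ) (z₂ : Fin (n₂ + 1) → ℂ)
    (L₁ : EuclideanSpace ℝ (Fin n₁) →ₗ[ℝ] Fin (n₁ + 1) → ℂ)
    (L₂ : EuclideanSpace ℝ (Fin n₂) →ₗ[ℝ] Fin (n₂ + 1) → ℂ)
    (L : ℝ × EuclideanSpace ℝ (Fin n₁) × EuclideanSpace ℝ (Fin n₂) →ₗ[ℝ]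
      Fin (n₁ + 1 + n₂ + 1) → ℂ)
    (hL : ∀ v, L v = join (a • L₁ v.2.1 + (v.1 • a') • z₁) (b • L₂ v.2.2 + (v.1 • b') • z₂))
    {g₁ : LinearMap.BilinForm ℝ (EuclideanSpace ℝ (Fin n₁))}
    {g₂ : LinearMap.BilinForm ℝ (EuclideanSpace ℝ (Fin n₂))}
    {b₁ : Module.Basis (Fin n₁) ℝ (EuclideanSpace ℝ (Fin n₁))}
    {b₂ : Module.Basis (Fin n₂) ℝ (EuclideanSpace ℝ (Fin n₂))}
    (h₁ : ∀ i j, g₁ (b₁ i) (b₁ j) = if i = j then 1 else 0)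
    (h₂ : ∀ i j, g₂ (b₂ i) (b₂ j) = if i = j then 1 else 0)
    (o₁ : Orientation ℝ (EuclideanSpace ℝ (Fin n₁)) (Fin n₁))
    (o₂ : Orientation ℝ (EuclideanSpace ℝ (Fin n₂)) (Fin n₂))
    (e : Module.Basis (Fin (n₁ + 1 + n₂)) ℝ
      (ℝ × EuclideanSpace ℝ (Fin n₁) × EuclideanSpace ℝ (Fin n₂)))
    (he : ∀ i j, warpedForm r (‖a‖ ^ 2) (‖b‖ ^ 2) g₁ g₂ (e i) (e j) = if i = j then 1 else 0) :
    (frameSign (productOrientation o₁ o₂) e : ℂ) *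
        volForm (join (a • z₁) (b • z₂)) (fun i => L (e i)) =
      (-1) ^ n₁ * (((√r)⁻¹ : ℝ) * (a * b' - b * a')) * (a / ‖a‖) ^ n₁ * (b / ‖b‖) ^ n₂ *
        (frameSign o₁ b₁ * volForm z₁ fun i => L₁ (b₁ i)) *
        (frameSign o₂ b₂ * volForm z₂ fun i => L₂ (b₂ i)) := by
  set c := productBasis b₁ b₂
  have hdet := det_sq_mul_prod_eq_one _ c e _ (warpedForm_productBasis r _ _ h₁ h₂) he
  rw [Fin.prod_univ_add (a := n₁ + 1) (b := n₂), Fin.prod_univ_succ] at hdet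
  simp only [Fin.append_left, Fin.append_right, Fin.cons_zero, Fin.cons_succ, Finset.prod_const,
    Finset.card_univ, Fintype.card_fin] at hdet
  -- For `n₁ = 0` the power is empty, so `a` may vanish.
  have ha' : 0 < ‖a‖ ^ n₁ := by
    rcases ha with rfl | ha
    · simp
    · exact pow_pos (norm_pos_iff.2 ha) _
  have hb' : 0 < ‖b‖ ^ n₂ := pow_pos (norm_pos_iff.2 hb) _
  have hX : 0 < √r * ‖a‖ ^ n₁ * ‖b‖ ^ n₂ :=
    mul_pos (mul_pos (Real.sqrt_pos.2 hr) ha') hb'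
  -- The product frame is orthogonal, with lengths `√r` once, `‖a‖` `n₁` times and `‖b‖` `n₂` times.
  -- The determinant is the reciprocal of their product, up to sign.
  have habs : |c.det e| = (√r * ‖a‖ ^ n₁ * ‖b‖ ^ n₂)⁻¹ := by
    refine eq_inv_of_mul_eq_one_left ?_
    rw [← pow_eq_one_iff_of_nonneg (mul_nonneg (abs_nonneg _) hX.le) two_ne_zero]
    rw [mul_pow, mul_pow, mul_pow, sq_abs, Real.sq_sqrt hr.le, ← hdet]
    ring
  have hLc : (fun i => L (c i)) = Fin.append (m := n₁ + 1) (n := n₂)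
      (Fin.cons (join (a' • z₁) (b' • z₂)) fun i => join (a • L₁ (b₁ i)) 0)
      (fun j => join 0 (b • L₂ (b₂ j))) := by
    funext i
    rw [hL]
    simp only [c, productBasis_eq_append]
    refine Fin.addCases (m := n₁ + 1) (n := n₂) (fun i => ?_) (fun j => ?_) i
    · rw [Fin.append_left, Fin.append_left]
      refine Fin.cases ?_ (fun i => ?_) i <;> simp
    · rw [Fin.append_right, Fin.append_right]
      simp
  have hsign := frameSign_mul_det (productOrientation o₁ o₂) c e
  rw [frameSign_productBasis, habs] at hsign
  rw [volForm_comp_basis _ L c e, hLc, volForm_join _ _ _ _ hb, ← mul_assoc, ← Complex.ofReal_mul,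
    hsign]
  push_cast
  rw [div_pow, div_pow]
  have h3 : ((‖a‖ : ℂ)) ^ n₁ ≠ 0 := by exact_mod_cast ha'.ne'
  have h4 : ((‖b‖ : ℂ)) ^ n₂ ≠ 0 := by exact_mod_cast hb'.ne'
  have h5 : ((√r : ℝ) : ℂ) ≠ 0 := by exact_mod_cast (Real.sqrt_pos.2 hr).ne'
  field_simp

lemma toCircle_nsmul (n : ℕ) (θ : Real.Angle) :
    ((n • θ).toCircle : ℂ) = (θ.toCircle : ℂ) ^ n := by
  induction n with
  | zero => simp
  | succ k ih => rw [succ_nsmul, Real.Angle.toCircle_add, Circle.coe_mul, ih, pow_succ]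

lemma toCircle_arg {z : ℂ} (hz : z ≠ 0) :
    (((z.arg : Real.Angle)).toCircle : ℂ) = z / ‖z‖ := by
  have h : (‖z‖ : ℂ) ≠ 0 := by exact_mod_cast (norm_pos_iff.2 hz).ne'
  rw [Real.Angle.toCircle_coe, Circle.coe_exp, eq_div_iff h, mul_comm,
    Complex.norm_mul_exp_arg_mul_I]

end Angle

/-- The real part of the Hermitian form, pulled back by a linear map. -/
def pullbackForm {n : ℕ} {V : Type*} [AddCommGroup V] [Module ℝ V] (ε : ℝ)
    (L : V →ₗ[ℝ] Fin (n + 1) → ℂ) : LinearMap.BilinForm ℝ V :=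
  LinearMap.mk₂ ℝ (fun v w => (hForm ε (L v) (L w)).re)
    (fun v v' w => by rw [map_add, hForm_add_left, Complex.add_re])
    (fun c v w => by rw [map_smul, hForm_real_smul_left, Complex.re_ofReal_mul, smul_eq_mul])
    (fun v w w' => by rw [map_add, hForm_add_right, Complex.add_re])
    (fun c v w => by rw [map_smul, hForm_real_smul_right, Complex.re_ofReal_mul, smul_eq_mul])

lemma pullbackForm_comm {n : ℕ} {V : Type*} [AddCommGroup V] [Module ℝ V] (ε : ℝ)
    (L : V →ₗ[ℝ] Fin (n + 1) → ℂ) (v w : V) : pullbackForm ε L v w = pullbackForm ε L w v := by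
  change (hForm ε (L v) (L w)).re = (hForm ε (L w) (L v)).re
  rw [← conj_hForm, Complex.conj_re]

/-! ### The product map is Legendrian: metric and angle -/

section Product
variable {n₁ n₂ : ℕ} {N₁ N₂ : Type*} [TopologicalSpace N₁]
  [ChartedSpace (EuclideanSpace ℝ (Fin n₁)) N₁]
  [TopologicalSpace N₂] [ChartedSpace (EuclideanSpace ℝ (Fin n₂)) N₂]
  {ψ₁ : N₁ → Fin (n₁ + 1) → ℂ} {ψ₂ : N₂ → Fin (n₂ + 1) → ℂ}
  {I : TopologicalSpace.Opens ℝ} {α : ℝ → Fin 2 → ℂ}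

theorem isLegendrianMap_product (hψ₁ : IsLegendrianMap (𝓡 n₁) 1 ψ₁)
    (hψ₂ : IsLegendrianMap (𝓡 n₂) (-1) ψ₂) (hα : IsLegendreCurve I α) :
    IsLegendrianMap (prodModel n₁ n₂) (-1)
      (fun x : I × N₁ × N₂ => product α ψ₁ ψ₂ x.1 x.2.1 x.2.2) where
  smooth := contMDiff_product hψ₁.smooth hψ₂.smooth hα
  mem_quadric := fun ⟨s, p, q⟩ => by
    have h := hα.mem_quadric s s.2
    rw [mem_quadric, hForm_fin_two] at h
    rw [mem_quadric, product, hForm_join, hForm_smul_left, hForm_smul_right, hForm_smul_left,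
      hForm_smul_right, hψ₁.mem_quadric p, hψ₂.mem_quadric q]
    push_cast at h ⊢
    linear_combination h
  horizontal := by
    rintro ⟨s, p, q⟩ (v : ℝ × TangentSpace (𝓡 n₁) p × TangentSpace (𝓡 n₂) q)
    have h := hα.hForm_deriv_eq_zero s.2
    rw [hForm_fin_two] at h
    rw [liouville_eq]
    refine (congrArg (fun u => (hForm (-1) u (product α ψ₁ ψ₂ s p q)).im)
      (mvfderiv_product hψ₁.smooth hψ₂.smooth hα s p q v)).trans ?_
    rw [product, hForm_join]
    -- The position is treated as a vector without tangential part. The two radial terms then add up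
    -- to a multiple of `(α', α) = 0`.
    have h₁ := hForm_smul_add_smul (α s 0) ((v.1 : ℝ) • deriv α s 0) (α s 0) (hψ₁.mem_quadric p)
      (hψ₁.hForm_mvfderiv_eq_zero p v.2.1) (hForm_zero_left 1 _)
    have h₂ := hForm_smul_add_smul (α s 1) ((v.1 : ℝ) • deriv α s 1) (α s 1) (hψ₂.mem_quadric q)
      (hψ₂.hForm_mvfderiv_eq_zero q v.2.2) (hForm_zero_left (-1) _)
    rw [smul_zero, zero_add, hForm_zero_right, mul_zero, zero_add] at h₁ h₂
    rw [h₁, h₂, Complex.real_smul, Complex.real_smul]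
    rw [show ((v.1 : ℝ) : ℂ) * deriv α s 0 * conj (α s 0) * ((1 : ℝ) : ℂ) +
      ((v.1 : ℝ) : ℂ) * deriv α s 1 * conj (α s 1) * ((-1 : ℝ) : ℂ) = 0 by
        push_cast
        linear_combination ((v.1 : ℝ) : ℂ) * h]
    rfl

/-- The induced metric is a warped product. -/
theorem inducedMetric_product (hψ₁ : IsLegendrianMap (𝓡 n₁) 1 ψ₁)
    (hψ₂ : IsLegendrianMap (𝓡 n₂) (-1) ψ₂) (hα : IsLegendreCurve I α) (s : I) (p : N₁) (q : N₂)
    (v w : ℝ × TangentSpace (𝓡 n₁) p × TangentSpace (𝓡 n₂) q) :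
    inducedMetric (prodModel n₁ n₂) (-1)
        (fun x : I × N₁ × N₂ => product α ψ₁ ψ₂ x.1 x.2.1 x.2.2) (s, p, q) v w =
      speedSq α s * (v.1 * w.1) + ‖α s 0‖ ^ 2 * inducedMetric (𝓡 n₁) 1 ψ₁ p v.2.1 w.2.1
        + ‖α s 1‖ ^ 2 * inducedMetric (𝓡 n₂) (-1) ψ₂ q v.2.2 w.2.2 := by
  refine (congrArg₂ (fun x y => (hForm (-1) x y).re)
    (mvfderiv_product hψ₁.smooth hψ₂.smooth hα s p q v)
    (mvfderiv_product hψ₁.smooth hψ₂.smooth hα s p q w)).trans ?_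
  rw [hForm_join,
    hForm_smul_add_smul _ _ _ (hψ₁.mem_quadric p) (hψ₁.hForm_mvfderiv_eq_zero p _)
      (hψ₁.hForm_mvfderiv_eq_zero p _),
    hForm_smul_add_smul _ _ _ (hψ₂.mem_quadric q) (hψ₂.hForm_mvfderiv_eq_zero q _)
      (hψ₂.hForm_mvfderiv_eq_zero q _), speedSq, hForm_fin_two, inducedMetric, inducedMetric,
    Complex.add_re, Complex.add_re, Complex.add_re, Complex.re_ofReal_mul, Complex.re_ofReal_mul,
    Complex.re_mul_ofReal, Complex.re_mul_ofReal]
  simp only [Complex.real_smul, map_mul, Complex.conj_ofReal, Complex.sub_re]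
  rw [show ((v.1 : ℝ) : ℂ) * deriv α s 0 * (((w.1 : ℝ) : ℂ) * conj (deriv α s 0)) =
      ((v.1 * w.1 : ℝ) : ℂ) * (deriv α s 0 * conj (deriv α s 0)) by push_cast; ring,
    show ((v.1 : ℝ) : ℂ) * deriv α s 1 * (((w.1 : ℝ) : ℂ) * conj (deriv α s 1)) =
      ((v.1 * w.1 : ℝ) : ℂ) * (deriv α s 1 * conj (deriv α s 1)) by push_cast; ring,
    Complex.re_ofReal_mul, Complex.re_ofReal_mul]
  ring

/-- A vector in the kernel has square `0` in the warped metric. All three terms of the metric are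
nonnegative, so each of them vanishes. -/
theorem injective_mvfderiv_product (hψ₁ : IsLegendrianMap (𝓡 n₁) 1 ψ₁)
    (hψ₂ : IsLegendrianMap (𝓡 n₂) (-1) ψ₂) (hα : IsLegendreCurve I α) (s : I) (p : N₁) (q : N₂)
    (h₁ : ∀ v, v ≠ 0 → 0 < inducedMetric (𝓡 n₁) 1 ψ₁ p v v)
    (h₂ : ∀ v, v ≠ 0 → 0 < inducedMetric (𝓡 n₂) (-1) ψ₂ q v v) (h : n₁ = 0 ∨ α s 0 ≠ 0) :
    Function.Injective (mvfderiv (prodModel n₁ n₂)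
      (fun x : I × N₁ × N₂ => product α ψ₁ ψ₂ x.1 x.2.1 x.2.2) (s, p, q)) := by
  rw [injective_iff_map_eq_zero]
  intro (v : ℝ × TangentSpace (𝓡 n₁) p × TangentSpace (𝓡 n₂) q) hv
  have hm := (congrArg (fun u => (hForm (-1) u u).re) hv).symm.trans
    (inducedMetric_product hψ₁ hψ₂ hα s p q v v)
  rw [hForm_zero_left, Complex.zero_re] at hm
  have hr := hα.speedSq_pos s.2
  have hb : 0 < ‖α s 1‖ ^ 2 := pow_pos (norm_pos_iff.2 (hα.snd_ne_zero s.2)) 2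
  have hn₁ : 0 ≤ inducedMetric (𝓡 n₁) 1 ψ₁ p v.2.1 v.2.1 := by
    by_cases h0 : v.2.1 = 0
    · rw [h0, inducedMetric, map_zero, hForm_zero_left, Complex.zero_re]
    · exact (h₁ _ h0).le
  have hn₂ : 0 ≤ inducedMetric (𝓡 n₂) (-1) ψ₂ q v.2.2 v.2.2 := by
    by_cases h0 : v.2.2 = 0
    · rw [h0, inducedMetric, map_zero, hForm_zero_left, Complex.zero_re]
    · exact (h₂ _ h0).le
  have t0 : 0 ≤ speedSq α s * (v.1 * v.1) := mul_nonneg hr.le (mul_self_nonneg _)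
  have t1 := mul_nonneg (sq_nonneg ‖α s 0‖) hn₁
  have t2 := mul_nonneg hb.le hn₂
  have e0 : v.1 = 0 := by
    have : speedSq α s * (v.1 * v.1) = 0 := by linarith
    exact mul_self_eq_zero.1 ((mul_eq_zero.1 this).resolve_left hr.ne')
  have e2 : v.2.2 = 0 := by
    by_contra h0
    have := mul_pos hb (h₂ _ h0)
    linarith
  have e1 : v.2.1 = 0 := by
    rcases h with rfl | h
    · exact Subsingleton.elim (α := EuclideanSpace ℝ (Fin 0)) _ _
    · by_contra h0
      have := mul_pos (pow_pos (norm_pos_iff.2 h) 2) (h₁ _ h0)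
      linarith
  exact Prod.ext e0 (Prod.ext e1 e2)

/-- The Legendrian angle of a product. -/
theorem isLegendrianAngleAt_product (hψ₁ : IsLegendrianMap (𝓡 n₁) 1 ψ₁)
    (hψ₂ : IsLegendrianMap (𝓡 n₂) (-1) ψ₂) (hα : IsLegendreCurve I α) (s : I) (p : N₁) (q : N₂)
    (hp₁ : ∀ v, v ≠ 0 → 0 < inducedMetric (𝓡 n₁) 1 ψ₁ p v v)
    (hp₂ : ∀ v, v ≠ 0 → 0 < inducedMetric (𝓡 n₂) (-1) ψ₂ q v v)
    (h : n₁ = 0 ∨ α s 0 ≠ 0)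
    (o₁ : Orientation ℝ (EuclideanSpace ℝ (Fin n₁)) (Fin n₁))
    (o₂ : Orientation ℝ (EuclideanSpace ℝ (Fin n₂)) (Fin n₂)) {β β₁ β₂ : Real.Angle}
    (hβ : IsLegendreAngleAt α s β) (hβ₁ : IsLegendrianAngleAt (𝓡 n₁) 1 ψ₁ p o₁ β₁)
    (hβ₂ : IsLegendrianAngleAt (𝓡 n₂) (-1) ψ₂ q o₂ β₂) :
    IsLegendrianAngleAt (prodModel n₁ n₂) (-1)
      (fun x : I × N₁ × N₂ => product α ψ₁ ψ₂ x.1 x.2.1 x.2.2) (s, p, q)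
      (productOrientation o₁ o₂)
      (n₁ • (Real.pi : Real.Angle) + β + n₁ • ((α s 0).arg : Real.Angle)
        + n₂ • ((α s 1).arg : Real.Angle) + β₁ + β₂) := by
  intro e he
  let L₁ : EuclideanSpace ℝ (Fin n₁) →ₗ[ℝ] Fin (n₁ + 1) → ℂ := (mvfderiv (𝓡 n₁) ψ₁ p).toLinearMap
  let L₂ : EuclideanSpace ℝ (Fin n₂) →ₗ[ℝ] Fin (n₂ + 1) → ℂ := (mvfderiv (𝓡 n₂) ψ₂ q).toLinearMap
  obtain ⟨b₁, hb₁⟩ := exists_orthonormal_basis finrank_euclideanSpace_fin (pullbackForm 1 L₁)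
    (pullbackForm_comm 1 L₁) hp₁
  obtain ⟨b₂, hb₂⟩ := exists_orthonormal_basis finrank_euclideanSpace_fin (pullbackForm (-1) L₂)
    (pullbackForm_comm (-1) L₂) hp₂
  have k₁ := hβ₁ b₁ hb₁
  have k₂ := hβ₂ b₂ hb₂
  have he' : ∀ i j, warpedForm (speedSq α s) (‖α s 0‖ ^ 2) (‖α s 1‖ ^ 2)
      (pullbackForm 1 L₁) (pullbackForm (-1) L₂) (e i) (e j) =
      if i = j then 1 else 0 := fun i j => by
    refine Eq.trans ?_ (he i j)
    exact (inducedMetric_product hψ₁ hψ₂ hα s p q (e i) (e j)).symm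
  have key := frameSign_mul_volForm_join (hα.speedSq_pos s.2) (deriv α s 0) (deriv α s 1)
    (hα.snd_ne_zero s.2) h (ψ₁ p) (ψ₂ q) L₁ L₂
    (mvfderiv (prodModel n₁ n₂) (fun x : I × N₁ × N₂ => product α ψ₁ ψ₂ x.1 x.2.1 x.2.2)
      (s, p, q)).toLinearMap
    (fun v => mvfderiv_product hψ₁.smooth hψ₂.smooth hα s p q v) hb₁ hb₂ o₁ o₂ e he'
  refine key.trans ((congrArg₂ (fun x y => (-1) ^ n₁ * (((√(speedSq α s))⁻¹ : ℝ) *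
    (α s 0 * deriv α s 1 - α s 1 * deriv α s 0)) * (α s 0 / ‖α s 0‖) ^ n₁ *
    (α s 1 / ‖α s 1‖) ^ n₂ * x * y) k₁ k₂).trans ?_)
  have hβ' : (((√(speedSq α s))⁻¹ : ℝ) : ℂ) * (α s 0 * deriv α s 1 - α s 1 * deriv α s 0) =
      β.toCircle := by
    rw [← hβ, volForm_fin_two]
    simp only [Pi.smul_apply, Complex.real_smul]
    ring
  -- For `n₁ = 0` the argument is multiplied by `0`, so its default value at `α₁ = 0` does no harm.
  have ha : (α s 0 / ‖α s 0‖) ^ n₁ = ((n₁ • ((α s 0).arg : Real.Angle)).toCircle : ℂ) := by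
    rcases h with rfl | h
    · simp
    · rw [toCircle_nsmul, toCircle_arg h]
  rw [hβ', ha, ← toCircle_arg (hα.snd_ne_zero s.2), ← toCircle_nsmul]
  have hpi : ((n₁ • (Real.pi : Real.Angle)).toCircle : ℂ) = (-1) ^ n₁ := by
    rw [toCircle_nsmul, Real.Angle.toCircle_coe, Circle.coe_exp, Complex.exp_pi_mul_I]
  simp only [Real.Angle.toCircle_add, Circle.coe_mul, hpi]

end Product

end AdSLegendrian

end

/-! ### Assembly of the theorem -/

theorem theorem2 (n₁ n₂ : ℕ) :
    -- the construction, its metric and its Legendrian angle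
    (∀ (N₁ : Type*) [TopologicalSpace N₁] [ChartedSpace (EuclideanSpace ℝ (Fin n₁)) N₁]
      [IsManifold (𝓡 n₁) ∞ N₁]
      (N₂ : Type*) [TopologicalSpace N₂] [ChartedSpace (EuclideanSpace ℝ (Fin n₂)) N₂]
      [IsManifold (𝓡 n₂) ∞ N₂]
      (g₁ : Bundle.ContMDiffRiemannianMetric (𝓡 n₁) ∞ (EuclideanSpace ℝ (Fin n₁))
        (fun p : N₁ => TangentSpace (𝓡 n₁) p))
      (g₂ : Bundle.ContMDiffRiemannianMetric (𝓡 n₂) ∞ (EuclideanSpace ℝ (Fin n₂))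
        (fun q : N₂ => TangentSpace (𝓡 n₂) q))
      (o₁ : ManifoldOrientation (𝓡 n₁) N₁ n₁) (o₂ : ManifoldOrientation (𝓡 n₂) N₂ n₂)
      (ψ₁ : N₁ → Fin (n₁ + 1) → ℂ) (ψ₂ : N₂ → Fin (n₂ + 1) → ℂ)
      (I : TopologicalSpace.Opens ℝ) (α : ℝ → Fin 2 → ℂ),
      IsLegendrianImmersion (𝓡 n₁) 1 ψ₁ →
      (∀ p v w, inducedMetric (𝓡 n₁) 1 ψ₁ p v w = g₁.inner p v w) →
      IsLegendrianImmersion (𝓡 n₂) (-1) ψ₂ →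
      (∀ q v w, inducedMetric (𝓡 n₂) (-1) ψ₂ q v w = g₂.inner q v w) →
      IsLegendreCurve I α →
      ∀ φ : I × N₁ × N₂ → Fin (n₁ + 1 + n₂ + 1) → ℂ,
      (∀ s p q, φ (s, p, q) = product α ψ₁ ψ₂ s p q) →
        -- `φ` is Legendrian, and immersive where it is not singular
        IsLegendrianMap (prodModel n₁ n₂) (-1) φ ∧
        (∀ (s : I) (p : N₁) (q : N₂), n₁ = 0 ∨ α s 0 ≠ 0 →
          Function.Injective (mvfderiv (prodModel n₁ n₂) φ (s, p, q))) ∧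
        -- the induced metric
        (∀ (s : I) (p : N₁) (q : N₂)
          (v w : ℝ × TangentSpace (𝓡 n₁) p × TangentSpace (𝓡 n₂) q),
          inducedMetric (prodModel n₁ n₂) (-1) φ (s, p, q) v w =
            speedSq α s * (v.1 * w.1) + ‖α s 0‖ ^ 2 * g₁.inner p v.2.1 w.2.1
              + ‖α s 1‖ ^ 2 * g₂.inner q v.2.2 w.2.2) ∧
        -- the Legendrian angle
        (∀ (βα : I → Real.Angle) (β₁ : N₁ → Real.Angle) (β₂ : N₂ → Real.Angle),
          (∀ s : I, IsLegendreAngleAt α s (βα s)) →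
          (∀ p, IsLegendrianAngleAt (𝓡 n₁) 1 ψ₁ p (o₁.orient p) (β₁ p)) →
          (∀ q, IsLegendrianAngleAt (𝓡 n₂) (-1) ψ₂ q (o₂.orient q) (β₂ q)) →
          ∀ (s : I) (p : N₁) (q : N₂), n₁ = 0 ∨ α s 0 ≠ 0 →
            IsLegendrianAngleAt (prodModel n₁ n₂) (-1) φ (s, p, q)
              (productOrientation (o₁.orient p) (o₂.orient q))
              (n₁ • (Real.pi : Real.Angle) + βα s + n₁ • ((α s 0).arg : Real.Angle)
                + n₂ • ((α s 1).arg : Real.Angle) + β₁ p + β₂ q))) ∧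
    -- the invariant Legendrian immersions
    (2 ≤ n₁ → 2 ≤ n₂ →
      (∀ (M : Type*) [TopologicalSpace M] [T2Space M] [SecondCountableTopology M]
        [ChartedSpace (EuclideanSpace ℝ (Fin (n₁ + 1 + n₂))) M]
        [IsManifold (𝓡 (n₁ + 1 + n₂)) ∞ M] (φ : M → Fin (n₁ + 1 + n₂ + 1) → ℂ),
        IsLegendrianImmersion (𝓡 (n₁ + 1 + n₂)) (-1) φ →
          (IsLocallyInvariant φ ↔ ∀ p, fstPart (φ p) ≠ 0 → IsStandardNear φ p) ∧
          (IsImageInvariant φ → ∀ p, fstPart (φ p) ≠ 0 → IsStandardNear φ p)) ∧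
      (∀ (I : Set ℝ) (α : ℝ → Fin 2 → ℂ), IsLegendreCurve I α →
        IsImageInvariant (fun x : I × RS n₁ × RH n₂ =>
          product α (sphereIncl n₁) (hypIncl n₂) x.1 x.2.1 x.2.2))) := by
  refine ⟨?_, fun h₁ h₂ => ⟨?_, fun I α _ => isImageInvariant_product I α⟩⟩
  · intro N₁ _ _ _ N₂ _ _ _ g₁ g₂ o₁ o₂ ψ₁ ψ₂ I α hψ₁ hg₁ hψ₂ hg₂ hα φ hφ
    obtain rfl : φ = fun x => product α ψ₁ ψ₂ x.1 x.2.1 x.2.2 := funext fun x => hφ x.1 x.2.1 x.2.2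
    have hψ₁' := hψ₁.toIsLegendrianMap
    have hψ₂' := hψ₂.toIsLegendrianMap
    -- The Riemannian metrics make the induced metrics positive definite, also for `ψ₂`, whose
    -- ambient form is indefinite.
    have hp₁ := fun p v hv => (g₁.pos p v hv).trans_eq (hg₁ p v v).symm
    have hp₂ := fun q v hv => (g₂.pos q v hv).trans_eq (hg₂ q v v).symm
    refine ⟨isLegendrianMap_product hψ₁' hψ₂' hα,
      fun s p q h => injective_mvfderiv_product hψ₁' hψ₂' hα s p q (hp₁ p) (hp₂ q) h,
      fun s p q v w => ?_, fun βα β₁ β₂ hβ hβ₁ hβ₂ s p q h =>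
        isLegendrianAngleAt_product hψ₁' hψ₂' hα s p q (hp₁ p) (hp₂ q) h _ _ (hβ s) (hβ₁ p) (hβ₂ q)⟩
    rw [← hg₁, ← hg₂]
    exact inducedMetric_product hψ₁' hψ₂' hα s p q v w
  · intro M _ _ _ _ _ φ hφ
    exact ⟨⟨fun hinv p hp => isStandardNear_of_isRealBlocks hφ
        (isRealBlocks_of_isLocallyInvariant hφ hinv) hp,
      isLocallyInvariant_of_isStandardNear (by omega) hφ⟩,
      fun hinv p hp => isStandardNear_of_isRealBlocks hφ
        (isRealBlocks_of_isImageInvariant hφ hinv) hp⟩
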